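/- **Setting.** Fix integers $d,r,p$ with $p\ge 1$. Let $\{Y_t\}_{t\in\mathbb Z}$ be an $\mathbb R^d$-valued time series on a probability space $(\Omega,\mathcal F,P)$ with strong mixing coefficients $$\alpha(n)=\sup\{|P(A\cap B)-P(A)P(B)| : A\in\sigma(Y_t:t\le a),\ B\in\sigma(Y_t:t\ge a+n),\ a\in\mathbb Z\}.$$ For each $m\ge1$ let $n=mp$, and let a gap length $q=q_n\in\mathbb N$, a window length $\ell=\ell_n\in\mathbb N$ and weights $w_{1n},\dots,w_{pn}\in[0,1]$ with $\sum_{j}w_{jn}=1$ be given. The data are $X_{ip+j}=Y_{i(p+q)+j}$, $0\le i\le m-1$, $1\le j\le p$, arranged in a $p\times m$ array whose $j$th row is $(X_{ip+j})_{0\le i<m}$. For every $n$ the column process $\{(X_{ip+1},\dots,X_{(i+1)p})\}_{i\ge0}$ (defined by the same formula for all $i\geq 0$) is strictly stationary. For all large $n$, $1<\ell<m$, and $\ell/m\to0$. Let $\theta\in\mathbb R^r$ be the parameter. Let $\hat\theta_n$ be a (measurable) function of the whole array, with values in $\mathbb R^r$. For each row $j$ and each sample size $N$ let $T_{j,N}:(\mathbb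 R^d)^N\to\mathbb R^r$ be a measurable estimation algorithm, and put * $\hat\theta_{jn}=T_{j,m}(X_j,X_{p+j},\dots,X_{(m-1)p+j})$ (row-wise estimators); * $\theta^*_{jn}=T_{j,m}(X^*_j,\dots,X^*_{(m-1)p+j})$, where, given the data, the $X^*_{ip+j}$, $0\le i<m$, are drawn independently and uniformly, with replacement, from the $m$ values in row $j$; $E_*$ and $\mathrm{Var}_*$ are the conditional expectation and variance given the data; * $\tilde\theta^{(i)}_{jn}=T_{j,\ell}(X_{(i-1)p+j},\dots,X_{(i+\ell-2)p+j})$, $i=1,\dots,I=m-\ell+1$ (subseries versions). Let $\hat\Sigma_{jn}=\mathrm{Var}_*(\theta^*_{jn})$, $$M_{jk}=I^{-1}\sum_{i=1}^I(\tilde\theta^{(i)}_{jn}-\hat\theta_n)(\tilde\theta^{(i)}_{kn}-\hat\theta_n)',\qquad \tilde R_n(j,k)=M_{jj}^{-1/2}M_{jk}M_{kk}^{-1/2},$$ where, for a symmetric positive semidefinite $A$, $A^{1/2}$ is the principal square root and $A^{-1/2}$ its inverse (its Moore–Penrose inverse if $A$ is singular). The Gap Bootstrap II variance estimator is $$\widehat{\mathrm{Var}}_{\text{GB-II}}(\hat\theta_n)=\sum_{j=1}^p\sum_{k=1}^p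 w_{jn}w_{kn}\,\hat\Sigma_{jn}^{1/2}\,\tilde R_n(j,k)\,\hat\Sigma_{kn}^{1/2}.$$ **Theorem 4.2.** Suppose that there are measurable functions $\psi_j:\mathbb R^d\to\mathbb R^r$, $1\le j\le p$, such that, as $n\to\infty$: * (C.1) for some $C,\delta\in(0,\infty)$, $E\psi_j(X_j)=0$ and $E|\psi_j(X_j)|^{2+\delta}<C$ for $j=1,\dots,p$, and $\sum_{n\ge1}\alpha(n)^{\delta/(2+\delta)}<\infty$; * (C.2) $\hat\theta_n-\sum_{j=1}^pw_{jn}\hat\theta_{jn}=o(n^{-1/2})$ in $L^2(P)$; * (C.3) for $j=1,\dots,p$: (i) $\hat\theta_{jn}=\theta+m^{-1}\sum_{i=0}^{m-1}\psi_j(X_{ip+j})+o(m^{-1/2})$ in $L^2(P)$; (ii) $\theta^*_{jn}=\theta+m^{-1}\sum_{i=0}^{m-1}\psi_j(X^*_{ip+j})+R^*_{jn}$ with $E[E_*|R^*_{jn}|^2]=o(m^{-1})$, and $\tilde\theta^{(i)}_{jn}=\theta+\ell^{-1}\sum_{a=i}^{i+\ell-1}\psi_j(X_{(a-1)p+j})+o(\ell^{-1/2})$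 in $L^2(P)$, uniformly in $i=1,\dots,I$; * (C.4) $q\to\infty$ and $p\sum_{j=1}^pw_{jn}^2=O(1)$. Then $$n\left[\widehat{\mathrm{Var}}_{\text{GB-II}}(\hat\theta_n)-\mathrm{Var}(\hat\theta_n)\right]\to0\quad\text{in probability (entrywise)},\qquad n\to\infty.$$ -/

import Mathlib

open MeasureTheory ProbabilityTheory Filter Topology
open scoped ENNReal

noncomputable section

namespace GapBootstrap

/-- Euclidean space of column vectors with `k` real components. -/
abbrev Vec (k : ℕ) : Type := EuclideanSpace ℝ (Fin k)

section Mixing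

variable {Ω : Type*} {d : ℕ}

/-- The sigma-algebra generated by `Y t`, `t ≤ a`. -/
abbrev past (Y : ℤ → Ω → Vec d) (a : ℤ) : MeasurableSpace Ω :=
  ⨆ t ∈ Set.Iic a, MeasurableSpace.comap (Y t) inferInstance

/-- The sigma-algebra generated by `Y t`, `t ≥ a`. -/
abbrev future (Y : ℤ → Ω → Vec d) (a : ℤ) : MeasurableSpace Ω :=
  ⨆ t ∈ Set.Ici a, MeasurableSpace.comap (Y t) inferInstance

/-- The strong mixing coefficient: the supremum of `|P(A ∩ B) - P(A) P(B)|` over `a ∈ ℤ`,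
`A` in the past up to time `a` and `B` in the future from time `a + n` on. -/
def alphaMixing [MeasurableSpace Ω] (P : Measure Ω) (Y : ℤ → Ω → Vec d) (n : ℕ) : ℝ :=
  sSup {x : ℝ | ∃ (a : ℤ) (A B : Set Ω), MeasurableSet[past Y a] A ∧
    MeasurableSet[future Y (a + n)] B ∧ x = |P.real (A ∩ B) - P.real A * P.real B|}

end Mixing

/-- The principal square root of a symmetric positive semidefinite matrix. -/
def matSqrt {r : ℕ} (A : Matrix (Fin r) (Fin r) ℝ) : Matrix (Fin r) (Fin r) ℝ :=
  cfc (fun x : ℝ => √x) A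

/-- The inverse square root of a symmetric positive semidefinite matrix. If the matrix is singular
this is the Moore-Penrose inverse of its square root. -/
def matInvSqrt {r : ℕ} (A : Matrix (Fin r) (Fin r) ℝ) : Matrix (Fin r) (Fin r) ℝ :=
  cfc (fun x : ℝ => (√x)⁻¹) A

/-- For a positive semidefinite matrix, `matSqrt` is indeed a square root. -/
theorem matSqrt_mul_self {r : ℕ} {A : Matrix (Fin r) (Fin r) ℝ} (hA : A.PosSemidef) :
    matSqrt A * matSqrt A = A := by
  have hs := (Matrix.posSemidef_iff_isHermitian_and_spectrum_nonneg.1 hA).2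
  have hfin : (spectrum ℝ A).Finite := A.finite_real_spectrum
  unfold matSqrt
  rw [← cfc_mul (R := ℝ) _ _ A (hfin.continuousOn _) (hfin.continuousOn _)]
  conv_rhs => rw [← cfc_id ℝ A hA.1]
  exact cfc_congr fun x hx => Real.mul_self_sqrt (hs hx)

/-- For a positive definite matrix, `matInvSqrt` is the inverse of its square root. -/
theorem matInvSqrt_mul_matSqrt {r : ℕ} {A : Matrix (Fin r) (Fin r) ℝ} (hA : A.PosDef) :
    matInvSqrt A * matSqrt A = 1 := by
  have hfin : (spectrum ℝ A).Finite := A.finite_real_spectrum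
  have hs := (Matrix.posSemidef_iff_isHermitian_and_spectrum_nonneg.1 hA.posSemidef).2
  unfold matSqrt matInvSqrt
  rw [← cfc_mul (R := ℝ) _ _ A (hfin.continuousOn _) (hfin.continuousOn _)]
  rw [← cfc_one ℝ A hA.1]
  refine cfc_congr fun x hx => ?_
  have h0 : x ≠ 0 := by
    rintro rfl
    exact spectrum.zero_notMem ℝ hA.isUnit hx
  have hx0 : 0 < x := lt_of_le_of_ne (hs hx) (Ne.symm h0)
  exact inv_mul_cancel₀ (Real.sqrt_pos.2 hx0).ne'

/-- Conditional expectation (given the data) of the i.i.d. bootstrap: the resampled index vector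
`σ` is uniformly distributed on the `N ^ N` maps `Fin N → Fin N`, that is, its components are
independent and uniform on `Fin N`. -/
def bootMean {N : ℕ} (f : (Fin N → Fin N) → ℝ) : ℝ :=
  ((N : ℝ) ^ N)⁻¹ * ∑ σ, f σ

/-- Conditional variance matrix (given the data) under the i.i.d. bootstrap. -/
def bootVar {N r : ℕ} (f : (Fin N → Fin N) → Vec r) : Matrix (Fin r) (Fin r) ℝ :=
  Matrix.of fun a b => bootMean fun σ =>
    (f σ a - bootMean fun τ => f τ a) * (f σ b - bootMean fun τ => f τ b)

section Estimators

variable {Ω : Type*} {d r p : ℕ}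

/-- The observation in column `i` and row `j` of the data array with `p` rows and gaps of length
`q`. Rows and columns are counted from `0`, so this is `Y_{i (p + q) + (j + 1)}`. -/
def obs (Y : ℤ → Ω → Vec d) (q : ℕ) (i : ℕ) (j : Fin p) (ω : Ω) : Vec d :=
  Y ((i : ℤ) * ((p : ℤ) + (q : ℤ)) + (j : ℤ) + 1) ω

/-- Row `j` of the sub-array formed by the `N` consecutive columns `i, …, i + N - 1`. -/
def rowData (Y : ℤ → Ω → Vec d) (q : ℕ) (j : Fin p) (i N : ℕ) (ω : Ω) : Fin N → Vec d :=
  fun s => obs Y q (i + s) j ω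

/-- The whole data array with `m` columns. -/
def fullData (p : ℕ) (Y : ℤ → Ω → Vec d) (q m : ℕ) (ω : Ω) : Fin m → Fin p → Vec d :=
  fun i j => obs Y q i j ω

/-- The average of `ψ` over a sample of size `N`. -/
def avg {N : ℕ} (ψ : Vec d → Vec r) (x : Fin N → Vec d) : Vec r :=
  (N : ℝ)⁻¹ • ∑ s, ψ (x s)

/-- The estimator based on row `j` of the sub-array of columns `i, …, i + N - 1`. With `i = 0`,
`N = m` it is the row-wise estimator; with `N = ℓ` it is its `i`-th subseries version. Here
`T j N` is the estimation algorithm for row `j` at sample size `N`. -/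
def rowEst (T : Fin p → (N : ℕ) → (Fin N → Vec d) → Vec r) (Y : ℤ → Ω → Vec d)
    (q : ℕ) (j : Fin p) (i N : ℕ) (ω : Ω) : Vec r :=
  T j N (rowData Y q j i N ω)

/-- The i.i.d. bootstrap version of the estimator of row `j`, for the resampled indices `σ`. -/
def bootEst (T : Fin p → (N : ℕ) → (Fin N → Vec d) → Vec r) (Y : ℤ → Ω → Vec d)
    (q : ℕ) (j : Fin p) (m : ℕ) (ω : Ω) (σ : Fin m → Fin m) : Vec r :=
  T j m (rowData Y q j 0 m ω ∘ σ)

/-- The bootstrap estimator of the variance matrix of the estimator of row `j`. -/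
def bootVarEst (T : Fin p → (N : ℕ) → (Fin N → Vec d) → Vec r) (Y : ℤ → Ω → Vec d)
    (q : ℕ) (j : Fin p) (m : ℕ) (ω : Ω) : Matrix (Fin r) (Fin r) ℝ :=
  bootVar (bootEst T Y q j m ω)

/-- The sampling window product moment matrix
`I⁻¹ ∑ᵢ (θ̃_j⁽ⁱ⁾ - t) (θ̃_k⁽ⁱ⁾ - t)'` over the `I = m - ℓ + 1` overlapping windows of `ℓ` columns,
centred at `t`. -/
def windowMoment (T : Fin p → (N : ℕ) → (Fin N → Vec d) → Vec r) (Y : ℤ → Ω → Vec d)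
    (q m ℓ : ℕ) (t : Vec r) (j k : Fin p) (ω : Ω) : Matrix (Fin r) (Fin r) ℝ :=
  Matrix.of fun a b => ((m - ℓ + 1 : ℕ) : ℝ)⁻¹ * ∑ i ∈ Finset.range (m - ℓ + 1),
    (rowEst T Y q j i ℓ ω a - t a) * (rowEst T Y q k i ℓ ω b - t b)

/-- The sampling window estimator of the correlation matrix of the estimators of rows `j`, `k`. -/
def windowCorr (T : Fin p → (N : ℕ) → (Fin N → Vec d) → Vec r) (Y : ℤ → Ω → Vec d)
    (q m ℓ : ℕ) (t : Vec r) (j k : Fin p) (ω : Ω) : Matrix (Fin r) (Fin r) ℝ :=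
  matInvSqrt (windowMoment T Y q m ℓ t j j ω) * windowMoment T Y q m ℓ t j k ω *
    matInvSqrt (windowMoment T Y q m ℓ t k k ω)

/-- The Gap Bootstrap II estimator of the variance matrix of the full-sample estimator, which is
the algorithm `T₀` applied to the whole array; `w` are the weights of the rows. -/
def gapBootVarII (T₀ : (m : ℕ) → (Fin m → Fin p → Vec d) → Vec r)
    (T : Fin p → (N : ℕ) → (Fin N → Vec d) → Vec r) (w : Fin p → ℝ) (Y : ℤ → Ω → Vec d)
    (q m ℓ : ℕ) (ω : Ω) : Matrix (Fin r) (Fin r) ℝ :=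
  ∑ j, ∑ k, (w j * w k) • (matSqrt (bootVarEst T Y q j m ω) *
    windowCorr T Y q m ℓ (T₀ m (fullData p Y q m ω)) j k ω * matSqrt (bootVarEst T Y q k m ω))

/-- The variance matrix of a random vector. -/
def varMatrix [MeasurableSpace Ω] (P : Measure Ω) (Z : Ω → Vec r) :
    Matrix (Fin r) (Fin r) ℝ :=
  Matrix.of fun a b => cov[fun ω => Z ω a, fun ω => Z ω b; P]

end Estimators

end GapBootstrap

end

/-!
Both the variance of the full-sample estimator and its Gap Bootstrap estimator follow the same
deterministic quantity. Write `Γ j k` for the covariance matrix of the scores of rows `j` and `k`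
in a single column (`scoreCov` of `rowScore`). Since `p` is fixed it suffices to work at the scale
of `m`; there both are close to `∑ j, ∑ k, w j w k Γ j k`.

*The variance.* By asymptotic linearity the full-sample estimator is, up to an error that is
negligible in `L²`, a weighted mean of the averages of the scores. The columns are separated by
gaps that tend to infinity, so Davydov's inequality (`abs_integral_mul_sub_le`) bounds the
contribution of distinct columns by a tail of the series of powers of the mixing coefficients, and
only covariances within a column survive (`tendsto_varMatrix_sub`).

*The ingredients of the estimator.* The bootstrap variance of a row is a sample covariance up to
the remainder of the linear representation (`IsGappedArray.tendstoInMeasure_bootVarEst`), and the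
window moments are averages of products of normalized window sums of scores
(`IsGappedArray.tendstoInMeasure_windowMoment`). The probabilistic core is the law of large numbers
for squared window sums, for windows whose length may be bounded or not
(`IsMixingSeq.integral_abs_average_sq_sub_le`). The squares need not have finite variance, and so
they are replaced by the bounded functions `smoothSq u`, for which Chebyshev's inequality applies;
that this loses little of the mean, uniformly in the window length, is shown by Lindeberg's method
(`IsMixingSeq.le_integral_smoothSq_add`). Because `smoothSq u x ≤ x ^ 2`, closeness of the means
implies closeness in `L¹`. Products follow by polarization.

*The matrix step.* If the limits `Γ j j` are singular, then inverse square roots are not continuous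
there. But the correlation matrices have entries bounded by one, and multiplying them by the square
roots of the window moments gives back the window cross moments exactly
(`matSqrt_mul_crossCorr_mul_matSqrt`). As the square root is Hölder continuous, exchanging the
square roots of the window moments for those of the bootstrap variances changes the product by
little (`abs_smul_corr_sub_apply_le`), whatever the rank of the limits.
-/

/-! ### Covariance inequalities under strong mixing -/

namespace GapBootstrap

section Covariance

variable {Ω : Type*} {m₁ m₂ m₀ : MeasurableSpace Ω} {P : Measure Ω} [IsProbabilityMeasure P]

/-- The optimal bounded multiplier of a centred variable `Z` is, up to its size, the sign of the
conditional expectation of `Z`, and thus comes from a single event. -/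
theorem exists_abs_integral_mul_le (hm : m₁ ≤ m₀) {X Z : Ω → ℝ} {K : ℝ}
    (hX : Measurable[m₁] X) (hXK : ∀ ω, |X ω| ≤ K) (hZ : Integrable Z P)
    (hZ0 : ∫ ω, Z ω ∂P = 0) :
    ∃ A, MeasurableSet[m₁] A ∧ |∫ ω, X ω * Z ω ∂P| ≤ 2 * K * |∫ ω in A, Z ω ∂P| := by
  have hgm : Measurable[m₁] (P[Z|m₁]) := stronglyMeasurable_condExp.measurable
  have hgi : Integrable (P[Z|m₁]) P := integrable_condExp
  set A : Set Ω := {ω | 0 ≤ (P[Z|m₁]) ω} with hA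
  have hAm : MeasurableSet[m₁] A := measurableSet_le measurable_const hgm
  refine ⟨A, hAm, ?_⟩
  have hK : 0 ≤ K := by
    obtain ⟨ω⟩ : Nonempty Ω := P.nonempty_of_neZero
    exact (abs_nonneg _).trans (hXK ω)
  have h1 : ∫ ω, X ω * Z ω ∂P = ∫ ω, X ω * (P[Z|m₁]) ω ∂P := by
    rw [← integral_condExp hm (f := fun ω => X ω * Z ω)]
    exact integral_congr_ae (condExp_stronglyMeasurable_mul_of_bound hm hX.stronglyMeasurable hZ K
      (Eventually.of_forall hXK))
  have h2 : ∫ ω, |(P[Z|m₁]) ω| ∂P = 2 * ∫ ω in A, Z ω ∂P := by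
    rw [← setIntegral_condExp hm hZ hAm]
    have h0 : ∫ ω, (P[Z|m₁]) ω ∂P = 0 := by rw [integral_condExp hm, hZ0]
    rw [← integral_add_compl (hm _ hAm) hgi] at h0
    rw [← integral_add_compl (hm _ hAm) hgi.abs]
    have e1 : ∫ ω in A, |(P[Z|m₁]) ω| ∂P = ∫ ω in A, (P[Z|m₁]) ω ∂P :=
      setIntegral_congr_fun (hm _ hAm) fun ω hω => abs_of_nonneg hω
    have e2 : ∫ ω in Aᶜ, |(P[Z|m₁]) ω| ∂P = -∫ ω in Aᶜ, (P[Z|m₁]) ω ∂P := by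
      rw [← integral_neg]
      exact setIntegral_congr_fun (hm _ hAm).compl fun ω hω =>
        abs_of_neg (not_le.1 hω)
    rw [e1, e2]; linarith
  rw [h1]
  calc |∫ ω, X ω * (P[Z|m₁]) ω ∂P| ≤ ∫ ω, |X ω * (P[Z|m₁]) ω| ∂P := abs_integral_le_integral_abs
    _ ≤ ∫ ω, K * |(P[Z|m₁]) ω| ∂P := by
        refine integral_mono_of_nonneg (Eventually.of_forall fun _ => abs_nonneg _)
          (hgi.abs.const_mul K) (Eventually.of_forall fun ω => ?_)
        simp only [abs_mul]
        exact mul_le_mul_of_nonneg_right (hXK ω) (abs_nonneg _)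
    _ = 2 * K * ∫ ω in A, Z ω ∂P := by rw [integral_const_mul, h2]; ring
    _ ≤ _ := mul_le_mul_of_nonneg_left (le_abs_self _) (by positivity)

/-- Covariance inequality for bounded variables. -/
theorem abs_integral_mul_sub_le_of_bounded (hm₁ : m₁ ≤ m₀) (hm₂ : m₂ ≤ m₀) {α : ℝ}
    (hα : ∀ A B, MeasurableSet[m₁] A → MeasurableSet[m₂] B →
      |P.real (A ∩ B) - P.real A * P.real B| ≤ α)
    {X Y : Ω → ℝ} {K L : ℝ} (hX : Measurable[m₁] X) (hY : Measurable[m₂] Y)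
    (hXK : ∀ ω, |X ω| ≤ K) (hYL : ∀ ω, |Y ω| ≤ L) :
    |∫ ω, X ω * Y ω ∂P - (∫ ω, X ω ∂P) * ∫ ω, Y ω ∂P| ≤ 4 * α * K * L := by
  obtain ⟨ω₀⟩ : Nonempty Ω := P.nonempty_of_neZero
  have hK : 0 ≤ K := (abs_nonneg _).trans (hXK ω₀)
  have hL : 0 ≤ L := (abs_nonneg _).trans (hYL ω₀)
  have iX : Integrable X P := Integrable.of_bound
    (hX.mono hm₁ le_rfl).aestronglyMeasurable K (Eventually.of_forall hXK)
  have iY : Integrable Y P := Integrable.of_bound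
    (hY.mono hm₂ le_rfl).aestronglyMeasurable L (Eventually.of_forall hYL)
  have iXY : Integrable (fun ω => X ω * Y ω) P :=
    iY.bdd_mul (hX.mono hm₁ le_rfl).aestronglyMeasurable (Eventually.of_forall hXK)
  set y := ∫ ω, Y ω ∂P
  obtain ⟨A, hA, h1⟩ := exists_abs_integral_mul_le hm₁ (Z := fun ω => Y ω - y) hX hXK
    (iY.sub (integrable_const _)) (by rw [integral_sub iY (integrable_const _)]; simp [y])
  have iA : Integrable (A.indicator fun _ => (1 : ℝ)) P :=
    (integrable_const _).indicator (hm₁ _ hA)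
  obtain ⟨B, hB, h2⟩ := exists_abs_integral_mul_le hm₂
    (Z := fun ω => A.indicator (fun _ => (1 : ℝ)) ω - P.real A) hY hYL
    (iA.sub (integrable_const _))
    (by rw [integral_sub iA (integrable_const _), integral_indicator (hm₁ _ hA)]; simp)
  have e1 : ∫ ω, X ω * (Y ω - y) ∂P = ∫ ω, X ω * Y ω ∂P - (∫ ω, X ω ∂P) * y := by
    simp_rw [mul_sub]
    rw [integral_sub iXY (iX.mul_const _), integral_mul_const]
  have e2 : ∫ ω, Y ω * (A.indicator (fun _ => (1 : ℝ)) ω - P.real A) ∂P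
      = ∫ ω in A, (Y ω - y) ∂P := by
    have : ∀ ω, Y ω * (A.indicator (fun _ => (1 : ℝ)) ω - P.real A)
        = A.indicator Y ω - Y ω * P.real A := fun ω => by
      by_cases h : ω ∈ A <;> simp [h, mul_sub]
    simp_rw [this]
    rw [integral_sub (iY.indicator (hm₁ _ hA)) (iY.mul_const _), integral_indicator (hm₁ _ hA),
      integral_mul_const, integral_sub iY.integrableOn (integrable_const _)]
    simp [y, mul_comm]
  have e3 : ∫ ω in B, (A.indicator (fun _ => (1 : ℝ)) ω - P.real A) ∂P
      = P.real (A ∩ B) - P.real A * P.real B := by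
    rw [integral_sub iA.integrableOn (integrable_const _), integral_indicator (hm₁ _ hA),
      Measure.restrict_restrict (hm₁ _ hA)]
    simp [mul_comm]
  rw [e1] at h1
  rw [e2, e3] at h2
  calc _ ≤ 2 * K * |∫ ω in A, (Y ω - y) ∂P| := h1
    _ ≤ 2 * K * (2 * L * α) := by
        refine mul_le_mul_of_nonneg_left (h2.trans ?_) (by positivity)
        exact mul_le_mul_of_nonneg_left (hα A B hA hB) (by positivity)
    _ = _ := by ring

/-- The truncation of `x` at level `K`. -/
noncomputable def trunc (K x : ℝ) : ℝ := if |x| ≤ K then x else 0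

theorem measurable_trunc (K : ℝ) : Measurable (trunc K) :=
  Measurable.ite (measurableSet_le measurable_norm measurable_const) measurable_id
    measurable_const

theorem abs_trunc_le {K : ℝ} (hK : 0 ≤ K) (x : ℝ) : |trunc K x| ≤ K := by
  unfold trunc; split_ifs with h
  · exact h
  · simpa using hK

theorem sq_le_of_lt_abs {K s x : ℝ} (hK : 0 < K) (hs : 2 ≤ s) (hx : K < |x|) :
    x ^ 2 ≤ K ^ (2 - s) * |x| ^ s := by
  have h0 : 0 < |x| := hK.trans hx
  have h1 : |x| ^ (2 - s) ≤ K ^ (2 - s) :=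
    Real.rpow_le_rpow_of_nonpos hK hx.le (by linarith)
  calc x ^ 2 = |x| ^ (2 - s) * |x| ^ s := by
        rw [← Real.rpow_add h0, sub_add_cancel, ← sq_abs]; norm_cast
    _ ≤ _ := mul_le_mul_of_nonneg_right h1 (by positivity)

theorem abs_mul_sub_trunc_le {K s : ℝ} (hK : 0 < K) (hs : 2 ≤ s) (x y : ℝ) :
    |x * y - trunc K x * trunc K y| ≤ K ^ (2 - s) * (|x| ^ s + |y| ^ s) := by
  have hxs : 0 ≤ K ^ (2 - s) * |x| ^ s := by positivity
  have hys : 0 ≤ K ^ (2 - s) * |y| ^ s := by positivity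
  rw [mul_add]
  by_cases h : |x| ≤ K ∧ |y| ≤ K
  · simp only [trunc, h.1, h.2, if_true, sub_self, abs_zero]; linarith
  have h0 : |x * y - trunc K x * trunc K y| = |x| * |y| := by
    rw [← abs_mul]; unfold trunc
    by_cases h1 : |x| ≤ K
    · have h2 : ¬ |y| ≤ K := fun h2 => h ⟨h1, h2⟩
      simp [h2]
    · simp [h1]
  rw [h0]
  rcases le_total |x| |y| with hxy | hxy
  · have hy : K < |y| := by
      by_contra hy; exact h ⟨hxy.trans (not_lt.1 hy), not_lt.1 hy⟩
    have := sq_le_of_lt_abs hK hs hy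
    have h2 : |x| * |y| ≤ y ^ 2 := by
      rw [← sq_abs, sq]; exact mul_le_mul_of_nonneg_right hxy (abs_nonneg _)
    linarith
  · have hx : K < |x| := by
      by_contra hx; exact h ⟨not_lt.1 hx, hxy.trans (not_lt.1 hx)⟩
    have := sq_le_of_lt_abs hK hs hx
    have h2 : |x| * |y| ≤ x ^ 2 := by
      rw [← sq_abs, sq]; exact mul_le_mul_of_nonneg_left hxy (abs_nonneg _)
    linarith

theorem memLp_two_of_integrable_rpow {X : Ω → ℝ} {s : ℝ} (hs : 2 ≤ s) (hX : Measurable X)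
    (hXs : Integrable (fun ω => |X ω| ^ s) P) : MemLp X 2 P := by
  rw [memLp_two_iff_integrable_sq hX.aestronglyMeasurable]
  refine ((integrable_const (1 : ℝ)).add hXs).mono' (hX.pow_const 2).aestronglyMeasurable
    (Eventually.of_forall fun ω => ?_)
  rw [Real.norm_of_nonneg (sq_nonneg _)]
  have h0 : 0 ≤ |X ω| ^ s := by positivity
  by_cases h : 1 < |X ω|
  · have := sq_le_of_lt_abs one_pos hs h
    simp at this ⊢; linarith
  · have : X ω ^ 2 ≤ 1 := by rw [← sq_abs]; exact pow_le_one₀ (abs_nonneg _) (not_lt.1 h)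
    simp; linarith

/-- Optimization of the truncation level `K`: a bound of order `K² α` for the truncated variables
and of order `K ^ (2 - s)` for the rest yields the order `α ^ ((s - 2) / s)`. -/
theorem le_rpow_of_forall_truncation {α s x b c : ℝ} (hα : 0 ≤ α) (hs : 2 < s)
    (h : ∀ K : ℝ, 0 < K → x ≤ b * (K ^ 2 * α) + c * K ^ (2 - s)) :
    x ≤ (b + c) * α ^ ((s - 2) / s) := by
  have hs0 : 0 < s := by linarith
  rcases hα.eq_or_lt with rfl | hα
  · rw [Real.zero_rpow (div_pos (by linarith) hs0).ne', mul_zero]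
    have ht : Tendsto (fun K : ℝ => c * K ^ (2 - s)) atTop (𝓝 (c * 0)) := by
      have := (tendsto_rpow_neg_atTop (y := s - 2) (by linarith)).const_mul c
      simpa using this
    rw [mul_zero] at ht
    refine ge_of_tendsto ht ((eventually_gt_atTop 0).mono fun K hK => ?_)
    simpa using h K hK
  -- the level `α ^ (-1 / s)` balances the two terms
  · have hK : 0 < α ^ (-1 / s) := by positivity
    have := h _ hK
    have e1 : (α ^ (-1 / s)) ^ 2 * α = α ^ ((s - 2) / s) := by
      rw [← Real.rpow_natCast, ← Real.rpow_mul hα.le]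
      nth_rw 2 [← Real.rpow_one α]
      rw [← Real.rpow_add hα]; congr 1; push_cast; field_simp; ring
    have e2 : (α ^ (-1 / s)) ^ (2 - s) = α ^ ((s - 2) / s) := by
      rw [← Real.rpow_mul hα.le]; congr 1; field_simp; ring
    rw [e1, e2] at this; linarith

/-- Davydov's covariance inequality, with equal moment orders. -/
theorem abs_integral_mul_sub_le (hm₁ : m₁ ≤ m₀) (hm₂ : m₂ ≤ m₀) {α : ℝ} (hα0 : 0 ≤ α)
    (hα : ∀ A B, MeasurableSet[m₁] A → MeasurableSet[m₂] B →
      |P.real (A ∩ B) - P.real A * P.real B| ≤ α)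
    {X Y : Ω → ℝ} {s C : ℝ} (hs : 2 < s) (hX : Measurable[m₁] X) (hY : Measurable[m₂] Y)
    (hXs : Integrable (fun ω => |X ω| ^ s) P) (hYs : Integrable (fun ω => |Y ω| ^ s) P)
    (hXC : ∫ ω, |X ω| ^ s ∂P ≤ C) (hYC : ∫ ω, |Y ω| ^ s ∂P ≤ C) :
    |∫ ω, X ω * Y ω ∂P - (∫ ω, X ω ∂P) * ∫ ω, Y ω ∂P| ≤ (4 + 4 * C) * α ^ ((s - 2) / s) := by
  have hX' := hX.mono hm₁ le_rfl
  have hY' := hY.mono hm₂ le_rfl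
  have lX := memLp_two_of_integrable_rpow hs.le hX' hXs
  have lY := memLp_two_of_integrable_rpow hs.le hY' hYs
  have iXY : Integrable (fun ω => X ω * Y ω) P := lX.integrable_mul lY
  have iX := lX.integrable one_le_two
  have iY := lY.integrable one_le_two
  refine le_rpow_of_forall_truncation hα0 hs fun K hK => ?_
  have hXt : Measurable[m₁] fun ω => trunc K (X ω) := (measurable_trunc K).comp hX
  have hYt : Measurable[m₂] fun ω => trunc K (Y ω) := (measurable_trunc K).comp hY
  have bX : ∀ ω, |trunc K (X ω)| ≤ K := fun ω => abs_trunc_le hK.le _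
  have bY : ∀ ω, |trunc K (Y ω)| ≤ K := fun ω => abs_trunc_le hK.le _
  have iXt : Integrable (fun ω => trunc K (X ω)) P := Integrable.of_bound
    (hXt.mono hm₁ le_rfl).aestronglyMeasurable K (Eventually.of_forall bX)
  have iYt : Integrable (fun ω => trunc K (Y ω)) P := Integrable.of_bound
    (hYt.mono hm₂ le_rfl).aestronglyMeasurable K (Eventually.of_forall bY)
  have iXYt : Integrable (fun ω => trunc K (X ω) * trunc K (Y ω)) P :=
    iYt.bdd_mul (hXt.mono hm₁ le_rfl).aestronglyMeasurable (Eventually.of_forall bX)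
  have hb := abs_integral_mul_sub_le_of_bounded hm₁ hm₂ hα hXt hYt bX bY
  have hKs : 0 ≤ K ^ (2 - s) := by positivity
  have t1 : |∫ ω, X ω * Y ω ∂P - ∫ ω, trunc K (X ω) * trunc K (Y ω) ∂P|
      ≤ K ^ (2 - s) * (C + C) := by
    rw [← integral_sub iXY iXYt]
    refine (abs_integral_le_integral_abs).trans ?_
    refine (integral_mono (iXY.sub iXYt).abs ((hXs.add hYs).const_mul _)
      fun ω => abs_mul_sub_trunc_le hK hs.le _ _).trans ?_
    simp only [Pi.add_apply]
    rw [integral_const_mul, integral_add hXs hYs]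
    exact mul_le_mul_of_nonneg_left (add_le_add hXC hYC) hKs
  -- The product of the means is the mean of the product on the square of the probability space.
  have t2 : |(∫ ω, X ω ∂P) * ∫ ω, Y ω ∂P - (∫ ω, trunc K (X ω) ∂P) * ∫ ω, trunc K (Y ω) ∂P|
      ≤ K ^ (2 - s) * (C + C) := by
    rw [← integral_prod_mul, ← integral_prod_mul (fun ω => trunc K (X ω))
      (fun ω => trunc K (Y ω)), ← integral_sub (iX.mul_prod iY) (iXt.mul_prod iYt)]
    refine (abs_integral_le_integral_abs).trans ?_
    refine (integral_mono ((iX.mul_prod iY).sub (iXt.mul_prod iYt)).abs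
      (((hXs.comp_fst P).add (hYs.comp_snd P)).const_mul _)
      fun ω => abs_mul_sub_trunc_le hK hs.le _ _).trans ?_
    simp only [Pi.add_apply]
    rw [integral_const_mul, integral_add (hXs.comp_fst P) (hYs.comp_snd P),
      integral_fun_fst (fun ω => |X ω| ^ s), integral_fun_snd (fun ω => |Y ω| ^ s)]
    simp only [probReal_univ, one_smul]
    exact mul_le_mul_of_nonneg_left (add_le_add hXC hYC) hKs
  rw [abs_le] at *
  constructor <;> nlinarith [t1.1, t1.2, t2.1, t2.2, hb.1, hb.2]

/-- A covariance inequality for a bounded variable and a square, which has only moments of an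
order above one. -/
theorem abs_integral_mul_sq_sub_le (hm₁ : m₁ ≤ m₀) (hm₂ : m₂ ≤ m₀) {α : ℝ} (hα0 : 0 ≤ α)
    (hα : ∀ A B, MeasurableSet[m₁] A → MeasurableSet[m₂] B →
      |P.real (A ∩ B) - P.real A * P.real B| ≤ α)
    {X Y : Ω → ℝ} {s C : ℝ} (hs : 2 < s) (hX : Measurable[m₁] X) (hY : Measurable[m₂] Y)
    (hX1 : ∀ ω, |X ω| ≤ 1) (hYs : Integrable (fun ω => |Y ω| ^ s) P)
    (hYC : ∫ ω, |Y ω| ^ s ∂P ≤ C) :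
    |∫ ω, X ω * Y ω ^ 2 ∂P - (∫ ω, X ω ∂P) * ∫ ω, Y ω ^ 2 ∂P|
      ≤ (4 + 2 * C) * α ^ ((s - 2) / s) := by
  have hX' := hX.mono hm₁ le_rfl
  have hY' := hY.mono hm₂ le_rfl
  have iY := (memLp_two_of_integrable_rpow hs.le hY' hYs).integrable_sq
  have iXY : Integrable (fun ω => X ω * Y ω ^ 2) P :=
    iY.bdd_mul hX'.aestronglyMeasurable (Eventually.of_forall hX1)
  refine le_rpow_of_forall_truncation hα0 hs fun K hK => ?_
  have hYt : Measurable[m₂] fun ω => trunc K (Y ω) ^ 2 :=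
    ((measurable_trunc K).comp hY).pow_const 2
  have bY : ∀ ω, |trunc K (Y ω) ^ 2| ≤ K ^ 2 := fun ω => by
    rw [abs_pow]; exact pow_le_pow_left₀ (abs_nonneg _) (abs_trunc_le hK.le _) 2
  have iYt : Integrable (fun ω => trunc K (Y ω) ^ 2) P := Integrable.of_bound
    (hYt.mono hm₂ le_rfl).aestronglyMeasurable (K ^ 2) (Eventually.of_forall bY)
  have iXYt : Integrable (fun ω => X ω * trunc K (Y ω) ^ 2) P :=
    iYt.bdd_mul hX'.aestronglyMeasurable (Eventually.of_forall hX1)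
  have hb := abs_integral_mul_sub_le_of_bounded hm₁ hm₂ hα hX hYt hX1 bY
  have hKs : 0 ≤ K ^ (2 - s) := by positivity
  have key : ∀ y, |y ^ 2 - trunc K y ^ 2| ≤ K ^ (2 - s) * |y| ^ s := fun y => by
    unfold trunc; split_ifs with h
    · simp; positivity
    · simpa using sq_le_of_lt_abs hK hs.le (not_le.1 h)
  have t0 : ∫ ω, |Y ω ^ 2 - trunc K (Y ω) ^ 2| ∂P ≤ K ^ (2 - s) * C := by
    refine (integral_mono (iY.sub iYt).abs (hYs.const_mul _) fun ω => key (Y ω)).trans ?_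
    rw [integral_const_mul]
    exact mul_le_mul_of_nonneg_left hYC hKs
  have t1 : |∫ ω, X ω * Y ω ^ 2 ∂P - ∫ ω, X ω * trunc K (Y ω) ^ 2 ∂P|
      ≤ K ^ (2 - s) * C := by
    rw [← integral_sub iXY iXYt]
    refine (abs_integral_le_integral_abs).trans ((integral_mono (iXY.sub iXYt).abs
      (iY.sub iYt).abs fun ω => ?_).trans t0)
    simp only [Pi.sub_apply, ← mul_sub, abs_mul]
    exact mul_le_of_le_one_left (abs_nonneg _) (hX1 ω)
  have hX1' : |∫ ω, X ω ∂P| ≤ 1 := by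
    refine (norm_integral_le_of_norm_le_const (f := X) (C := 1) (μ := P)
      (Eventually.of_forall hX1)).trans ?_
    simp
  have t2 : |(∫ ω, X ω ∂P) * ∫ ω, Y ω ^ 2 ∂P - (∫ ω, X ω ∂P) * ∫ ω, trunc K (Y ω) ^ 2 ∂P|
      ≤ K ^ (2 - s) * C := by
    rw [← mul_sub, abs_mul, ← integral_sub iY iYt]
    exact (mul_le_of_le_one_left (abs_nonneg _) hX1').trans (abs_integral_le_integral_abs.trans t0)
  rw [abs_le] at *
  constructor <;> nlinarith [t1.1, t1.2, t2.1, t2.2, hb.1, hb.2]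

end Covariance

/-! ### A bounded smooth substitute for the square -/

/-- The bounded smooth function `2 (1 - cos (u x)) / u²`, which is at most `x²` and tends to
`x²` as `u → 0`. Its first two derivatives are `2 sin (u x) / u` and `2 cos (u x)`. -/
noncomputable def smoothSq (u x : ℝ) : ℝ := 2 * (1 - Real.cos (u * x)) / u ^ 2

theorem continuous_smoothSq (u : ℝ) : Continuous (smoothSq u) := by
  unfold smoothSq; fun_prop

theorem smoothSq_nonneg (u x : ℝ) : 0 ≤ smoothSq u x := by
  have := Real.cos_le_one (u * x)
  exact div_nonneg (by linarith) (sq_nonneg _)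

theorem smoothSq_le_sq {u : ℝ} (hu : 0 < u) (x : ℝ) : smoothSq u x ≤ x ^ 2 := by
  have := Real.one_sub_sq_div_two_le_cos (x := u * x)
  rw [smoothSq, div_le_iff₀ (by positivity)]
  nlinarith

theorem smoothSq_le {u : ℝ} (hu : 0 < u) (x : ℝ) : smoothSq u x ≤ 4 / u ^ 2 := by
  have := Real.neg_one_le_cos (u * x)
  exact div_le_div_of_nonneg_right (by linarith) (by positivity)

theorem abs_one_sub_cos_sub_le {s v : ℝ} (hs2 : 2 ≤ s) (hs3 : s ≤ 3) :
    |1 - Real.cos v - v ^ 2 / 2| ≤ |v| ^ s / 2 := by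
  have h1 := Real.one_sub_sq_div_two_le_cos (x := v)
  have h2 := Real.cos_le_one v
  rw [abs_le]
  rcases le_total |v| 1 with hv | hv
  · have h3 := (abs_le.1 (Real.cos_bound hv)).2
    have h4 : |v| ^ (3 : ℝ) ≤ |v| ^ s := by
      rcases (abs_nonneg v).eq_or_lt with h | h
      · rw [← h, Real.zero_rpow (by norm_num), Real.zero_rpow (by linarith)]
      · exact Real.rpow_le_rpow_of_exponent_ge h hv hs3
    have h5 : |v| ^ (3 : ℝ) = |v| ^ 3 := by norm_cast
    have h6 : |v| ^ 4 ≤ |v| ^ 3 := pow_le_pow_of_le_one (abs_nonneg _) hv (by norm_num)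
    rw [h5] at h4
    constructor <;> nlinarith [pow_nonneg (abs_nonneg v) 3]
  · have h3 : v ^ 2 ≤ |v| ^ s := by
      rw [← sq_abs]
      calc |v| ^ 2 = |v| ^ (2 : ℝ) := by norm_cast
        _ ≤ _ := Real.rpow_le_rpow_of_exponent_le hv hs2
    constructor <;> nlinarith

theorem abs_sin_sub_le {s v : ℝ} (hs2 : 2 ≤ s) (hs3 : s ≤ 3) :
    |Real.sin v - v| ≤ 2 * |v| ^ s := by
  rcases le_total |v| 1 with hv | hv
  · have h3 := abs_le.1 (Real.sin_bound hv)
    have h4 : |v| ^ (3 : ℝ) ≤ |v| ^ s := by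
      rcases (abs_nonneg v).eq_or_lt with h | h
      · rw [← h, Real.zero_rpow (by norm_num), Real.zero_rpow (by linarith)]
      · exact Real.rpow_le_rpow_of_exponent_ge h hv hs3
    have h5 : |v| ^ (3 : ℝ) = |v| ^ 3 := by norm_cast
    have h6 : |v| ^ 5 ≤ |v| ^ 3 := pow_le_pow_of_le_one (abs_nonneg _) hv (by norm_num)
    have h7 : |v ^ 3| = |v| ^ 3 := abs_pow _ _
    have h8 := abs_le.1 h7.le
    rw [h5] at h4
    rw [abs_le]
    constructor <;> nlinarith [pow_nonneg (abs_nonneg v) 3, h8.1, h8.2, h3.1, h3.2]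
  · have h1 : |Real.sin v| ≤ |v| := Real.abs_sin_le_abs
    have h3 : |v| ≤ |v| ^ s := Real.self_le_rpow_of_one_le hv (by linarith)
    calc |Real.sin v - v| ≤ |Real.sin v| + |v| := abs_sub _ _
      _ ≤ _ := by linarith

/-- Second order Taylor expansion of `smoothSq`, with a remainder that needs only moments of an
order slightly above two. -/
theorem abs_smoothSq_add_sub_le {u s : ℝ} (hu : 0 < u) (hs2 : 2 ≤ s) (hs3 : s ≤ 3) (x h : ℝ) :
    |smoothSq u (x + h) - smoothSq u x - 2 * Real.sin (u * x) / u * h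
      - Real.cos (u * x) * h ^ 2| ≤ 5 * u ^ (s - 2) * |h| ^ s := by
  set v := u * h with hv
  have e : smoothSq u (x + h) - smoothSq u x - 2 * Real.sin (u * x) / u * h
      - Real.cos (u * x) * h ^ 2 = 2 / u ^ 2 * (Real.cos (u * x) * (1 - Real.cos v - v ^ 2 / 2)
        + Real.sin (u * x) * (Real.sin v - v)) := by
    rw [smoothSq, smoothSq, mul_add, ← hv, Real.cos_add]
    have : h = v / u := by rw [hv]; field_simp
    rw [this]; field_simp; ring
  have h1 := abs_one_sub_cos_sub_le (v := v) hs2 hs3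
  have h2 := abs_sin_sub_le (v := v) hs2 hs3
  have e2 : |v| ^ s = u ^ s * |h| ^ s := by
    rw [hv, abs_mul, abs_of_pos hu, Real.mul_rpow hu.le (abs_nonneg _)]
  have e3 : u ^ s = u ^ (s - 2) * u ^ 2 := by
    rw [← Real.rpow_natCast u 2, ← Real.rpow_add hu]; congr 1; push_cast; ring
  rw [e, abs_mul, abs_of_pos (by positivity : 0 < 2 / u ^ 2)]
  have h3 : |Real.cos (u * x) * (1 - Real.cos v - v ^ 2 / 2)
        + Real.sin (u * x) * (Real.sin v - v)| ≤ |v| ^ s / 2 + 2 * |v| ^ s := by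
    refine (abs_add_le _ _).trans (add_le_add ?_ ?_)
    · rw [abs_mul]
      exact (mul_le_of_le_one_left (abs_nonneg _) (Real.abs_cos_le_one _)).trans h1
    · rw [abs_mul]
      exact (mul_le_of_le_one_left (abs_nonneg _) (Real.abs_sin_le_one _)).trans h2
  calc _ ≤ 2 / u ^ 2 * (|v| ^ s / 2 + 2 * |v| ^ s) :=
        mul_le_mul_of_nonneg_left h3 (by positivity)
    _ = _ := by rw [e2, e3]; field_simp; ring

/-! ### Window sums of a mixing sequence -/

section Sequence

variable {Ω : Type*} {ξ : ℕ → Ω → ℝ}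

/-- The sigma-algebra generated by the members of a sequence before `k`. -/
abbrev seqPast (ξ : ℕ → Ω → ℝ) (k : ℕ) : MeasurableSpace Ω :=
  ⨆ i ∈ Set.Iio k, MeasurableSpace.comap (ξ i) inferInstance

/-- The sigma-algebra generated by the members of a sequence from `k` on. -/
abbrev seqFuture (ξ : ℕ → Ω → ℝ) (k : ℕ) : MeasurableSpace Ω :=
  ⨆ i ∈ Set.Ici k, MeasurableSpace.comap (ξ i) inferInstance

theorem measurable_seqPast {i k : ℕ} (h : i < k) : Measurable[seqPast ξ k] (ξ i) :=
  (comap_measurable (ξ i)).mono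
    (le_iSup₂_of_le (f := fun i (_ : i ∈ Set.Iio k) =>
      MeasurableSpace.comap (ξ i) inferInstance) i h le_rfl) le_rfl

theorem measurable_seqFuture {i k : ℕ} (h : k ≤ i) : Measurable[seqFuture ξ k] (ξ i) :=
  (comap_measurable (ξ i)).mono
    (le_iSup₂_of_le (f := fun i (_ : i ∈ Set.Ici k) =>
      MeasurableSpace.comap (ξ i) inferInstance) i h le_rfl) le_rfl

/-- The sum over the window of length `n` that starts at `i`. -/
def windowSum (ξ : ℕ → Ω → ℝ) (i n : ℕ) (ω : Ω) : ℝ := ∑ k ∈ Finset.range n, ξ (i + k) ω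

theorem windowSum_succ (ξ : ℕ → Ω → ℝ) (i n : ℕ) (ω : Ω) :
    windowSum ξ i (n + 1) ω = windowSum ξ i n ω + ξ (i + n) ω := Finset.sum_range_succ _ _

@[simp] theorem windowSum_zero (ξ : ℕ → Ω → ℝ) (i : ℕ) (ω : Ω) : windowSum ξ i 0 ω = 0 := rfl

theorem measurable_windowSum_past {i n k : ℕ} (h : i + n ≤ k) :
    Measurable[seqPast ξ k] (windowSum ξ i n) :=
  Finset.measurable_sum _ fun _ hj => measurable_seqPast (by
    have := Finset.mem_range.1 hj; omega)

theorem measurable_windowSum_future {i n k : ℕ} (h : k ≤ i) :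
    Measurable[seqFuture ξ k] (windowSum ξ i n) :=
  Finset.measurable_sum _ fun _ _ => measurable_seqFuture (by omega)

variable [MeasurableSpace Ω] {P : Measure Ω} {s C v η : ℝ}

/-- A centred sequence with constant variance `v`, moments of order `s` bounded by `C`, and strong
mixing coefficients `a 0, a 1, …` (`a h` belongs to the lag `h + 1`) whose powers of order
`(s - 2) / s` have sum at most `η`. -/
structure IsMixingSeq (P : Measure Ω) (ξ : ℕ → Ω → ℝ) (s C v η : ℝ) : Prop where
  measurable : ∀ i, Measurable (ξ i)
  mean : ∀ i, ∫ ω, ξ i ω ∂P = 0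
  var : ∀ i, ∫ ω, ξ i ω ^ 2 ∂P = v
  integrable : ∀ i, Integrable (fun ω => |ξ i ω| ^ s) P
  moment : ∀ i, ∫ ω, |ξ i ω| ^ s ∂P ≤ C
  mixing : ∃ a : ℕ → ℝ, (∀ h, 0 ≤ a h) ∧
    (∀ N, ∑ h ∈ Finset.range N, a h ^ ((s - 2) / s) ≤ η) ∧
    ∀ k h A B, MeasurableSet[seqPast ξ k] A → MeasurableSet[seqFuture ξ (k + h)] B →
      |P.real (A ∩ B) - P.real A * P.real B| ≤ a h

theorem seqPast_le (hξ : ∀ i, Measurable (ξ i)) (k : ℕ) : seqPast ξ k ≤ ‹MeasurableSpace Ω› :=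
  iSup₂_le fun i _ => (hξ i).comap_le

theorem seqFuture_le (hξ : ∀ i, Measurable (ξ i)) (k : ℕ) :
    seqFuture ξ k ≤ ‹MeasurableSpace Ω› :=
  iSup₂_le fun i _ => (hξ i).comap_le

namespace IsMixingSeq

theorem measurable_windowSum (H : IsMixingSeq P ξ s C v η) (i n : ℕ) :
    Measurable (windowSum ξ i n) :=
  Finset.measurable_sum _ fun _ _ => H.measurable _

theorem eta_nonneg (H : IsMixingSeq P ξ s C v η) : 0 ≤ η := by
  obtain ⟨a, -, h, -⟩ := H.mixing
  simpa using h 0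

theorem moment_nonneg (H : IsMixingSeq P ξ s C v η) : 0 ≤ C :=
  (integral_nonneg fun _ => by positivity).trans (H.moment 0)

theorem var_nonneg (H : IsMixingSeq P ξ s C v η) : 0 ≤ v := by
  rw [← H.var 0]; exact integral_nonneg fun _ => sq_nonneg _

variable [IsProbabilityMeasure P]

theorem memLp (H : IsMixingSeq P ξ s C v η) (hs : 2 < s) (i : ℕ) : MemLp (ξ i) 2 P :=
  memLp_two_of_integrable_rpow hs.le (H.measurable i) (H.integrable i)

theorem memLp_windowSum (H : IsMixingSeq P ξ s C v η) (hs : 2 < s) (i n : ℕ) :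
    MemLp (windowSum ξ i n) 2 P := memLp_finsetSum _ fun _ _ => H.memLp hs _

/-- Variables that each depend on one past member, and are dominated by it, are jointly almost
uncorrelated with the next member. -/
theorem abs_integral_sum_mul_le (H : IsMixingSeq P ξ s C v η) (hs : 2 < s) {i n : ℕ}
    {D : ℕ → Ω → ℝ} (hD : ∀ j < n, Measurable[seqPast ξ (i + j + 1)] (D j))
    (hDξ : ∀ j < n, ∀ ω, |D j ω| ≤ |ξ (i + j) ω|) :
    |∫ ω, (∑ j ∈ Finset.range n, D j ω) * ξ (i + n) ω ∂P| ≤ (4 + 4 * C) * η := by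
  obtain ⟨a, ha0, haη, ha⟩ := H.mixing
  have hC := H.moment_nonneg
  have hDm : ∀ j < n, Measurable (D j) := fun j hj =>
    (hD j hj).mono (seqPast_le H.measurable _) le_rfl
  have hDle : ∀ j < n, ∀ ω, |D j ω| ^ s ≤ |ξ (i + j) ω| ^ s := fun j hj ω =>
    Real.rpow_le_rpow (abs_nonneg _) (hDξ j hj ω) (by linarith)
  have hDi : ∀ j < n, Integrable (fun ω => |D j ω| ^ s) P := fun j hj =>
    (H.integrable (i + j)).mono' ((hDm j hj).abs.pow_const s).aestronglyMeasurable
      (Eventually.of_forall fun ω => by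
        rw [Real.norm_of_nonneg (by positivity)]; exact hDle j hj ω)
  have hprod : ∀ j < n, Integrable (fun ω => D j ω * ξ (i + n) ω) P := fun j hj =>
    (memLp_two_of_integrable_rpow hs.le (hDm j hj) (hDi j hj)).integrable_mul (H.memLp hs _)
  have hcov : ∀ j < n, |∫ ω, D j ω * ξ (i + n) ω ∂P|
      ≤ (4 + 4 * C) * a (n - 1 - j) ^ ((s - 2) / s) := fun j hj => by
    have hidx : i + n = i + j + 1 + (n - 1 - j) := by omega
    have := abs_integral_mul_sub_le (P := P) (seqPast_le H.measurable (i + j + 1))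
      (seqFuture_le H.measurable (i + j + 1 + (n - 1 - j))) (ha0 (n - 1 - j))
      (ha (i + j + 1) (n - 1 - j)) hs (hD j hj) (measurable_seqFuture hidx.ge) (hDi j hj)
      (H.integrable (i + n))
      ((integral_mono (hDi j hj) (H.integrable _) (hDle j hj)).trans (H.moment _)) (H.moment _)
    rwa [H.mean, mul_zero, sub_zero] at this
  simp_rw [Finset.sum_mul]
  rw [integral_finsetSum _ fun j hj => hprod j (Finset.mem_range.1 hj)]
  calc _ ≤ ∑ j ∈ Finset.range n, |∫ ω, D j ω * ξ (i + n) ω ∂P| := Finset.abs_sum_le_sum_abs _ _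
    _ ≤ ∑ j ∈ Finset.range n, (4 + 4 * C) * a (n - 1 - j) ^ ((s - 2) / s) :=
        Finset.sum_le_sum fun j hj => hcov j (Finset.mem_range.1 hj)
    _ = (4 + 4 * C) * ∑ j ∈ Finset.range n, a j ^ ((s - 2) / s) := by
        rw [← Finset.mul_sum, Finset.sum_range_reflect (fun j => a j ^ ((s - 2) / s))]
    _ ≤ _ := mul_le_mul_of_nonneg_left (haη n) (by positivity)

/-- The variance of a window sum is that of an uncorrelated sequence, up to the mixing
coefficients. -/
theorem abs_integral_windowSum_sq_sub_le (H : IsMixingSeq P ξ s C v η) (hs : 2 < s) (i n : ℕ) :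
    |∫ ω, windowSum ξ i n ω ^ 2 ∂P - n * v| ≤ n * (2 * (4 + 4 * C) * η) := by
  induction n with
  | zero => simp
  | succ n ih =>
    have h1 := H.abs_integral_sum_mul_le hs (i := i) (n := n) (D := fun j => ξ (i + j))
      (fun j _ => measurable_seqPast (by omega)) (fun _ _ _ => le_rfl)
    have e : ∀ ω, windowSum ξ i (n + 1) ω ^ 2 = windowSum ξ i n ω ^ 2
        + 2 * (windowSum ξ i n ω * ξ (i + n) ω) + ξ (i + n) ω ^ 2 := fun ω => by
      rw [windowSum_succ]; ring
    have i1 := (H.memLp_windowSum hs i n).integrable_sq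
    have i2 : Integrable (fun ω => windowSum ξ i n ω * ξ (i + n) ω) P :=
      (H.memLp_windowSum hs i n).integrable_mul (H.memLp hs _)
    have i3 := (H.memLp hs (i + n)).integrable_sq
    have i12 : Integrable (fun ω => windowSum ξ i n ω ^ 2
        + 2 * (windowSum ξ i n ω * ξ (i + n) ω)) P := i1.add (i2.const_mul 2)
    simp_rw [e]
    rw [integral_add i12 i3, integral_add i1 (i2.const_mul _),
      integral_const_mul, H.var]
    change |∫ ω, windowSum ξ i n ω * ξ (i + n) ω ∂P| ≤ _ at h1
    push_cast
    rw [abs_le] at *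
    constructor <;> nlinarith [h1.1, h1.2, ih.1, ih.2]

/-- Moments of a lower order `s'` are at most `1 + C`. -/
theorem integral_rpow_le (H : IsMixingSeq P ξ s C v η) {s' : ℝ} (h0 : 0 ≤ s') (hs : s' ≤ s)
    (i : ℕ) : Integrable (fun ω => |ξ i ω| ^ s') P ∧ ∫ ω, |ξ i ω| ^ s' ∂P ≤ 1 + C := by
  have key : ∀ x : ℝ, |x| ^ s' ≤ 1 + |x| ^ s := fun x => by
    have : 0 ≤ |x| ^ s := by positivity
    rcases le_total |x| 1 with h | h
    · have := Real.rpow_le_one (abs_nonneg x) h h0; linarith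
    · have := Real.rpow_le_rpow_of_exponent_le h hs; linarith
  have hi : Integrable (fun ω => 1 + |ξ i ω| ^ s) P := (integrable_const 1).add (H.integrable i)
  have hint : Integrable (fun ω => |ξ i ω| ^ s') P :=
    hi.mono' ((H.measurable i).abs.pow_const s').aestronglyMeasurable
      (Eventually.of_forall fun ω => by
        rw [Real.norm_of_nonneg (by positivity)]; exact key _)
  refine ⟨hint, (integral_mono hint hi fun ω => key _).trans ?_⟩
  rw [integral_add (integrable_const 1) (H.integrable i)]
  simpa using H.moment i

theorem var_le (H : IsMixingSeq P ξ s C v η) (hs : 2 < s) : v ≤ 1 + C := by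
  have := (H.integral_rpow_le zero_le_two hs.le 0).2
  rw [← H.var 0]
  simpa using this

end IsMixingSeq

end Sequence

/-! ### The law of large numbers for squared window sums -/

section Sequence

variable {Ω : Type*} [MeasurableSpace Ω] {P : Measure Ω} [IsProbabilityMeasure P]

theorem integral_abs_sub_integral_le {X : Ω → ℝ} (hX : MemLp X 2 P) :
    ∫ ω, |X ω - ∫ ω', X ω' ∂P| ∂P ≤ √Var[X; P] := by
  set W : Ω → ℝ := fun ω => |X ω - ∫ ω', X ω' ∂P| with hW
  have hW2 : MemLp W 2 P := (hX.sub (memLp_const _)).abs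
  have h1 := variance_nonneg W P
  rw [variance_eq_sub hW2] at h1
  have h2 : Var[X; P] = ∫ ω, (W ^ 2) ω ∂P := by
    rw [variance_eq_integral hX.aemeasurable]
    simp [hW, sq_abs]
  rw [h2]
  exact Real.le_sqrt_of_sq_le (by linarith)

/-- Chebyshev's law of large numbers for variables with values in `[0, 1]` that are almost
uncorrelated as soon as their indices differ by at least `ℓ`. -/
theorem integral_abs_average_sub_le {g : ℕ → Ω → ℝ} (hg : ∀ i, Measurable (g i))
    (h0 : ∀ i ω, 0 ≤ g i ω) (h1 : ∀ i ω, g i ω ≤ 1) {c : ℝ} (hc : 0 ≤ c) {ℓ I : ℕ} (hI : 0 < I)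
    (hcov : ∀ i j, i + ℓ ≤ j → |cov[g i, g j; P]| ≤ c) :
    ∫ ω, |(I : ℝ)⁻¹ * ∑ i ∈ Finset.range I, (g i ω - ∫ ω', g i ω' ∂P)| ∂P
      ≤ √(c + 2 * ℓ / I) := by
  have hb : ∀ i ω, |g i ω| ≤ 1 := fun i ω => abs_le.2 ⟨by linarith [h0 i ω], h1 i ω⟩
  have hL : ∀ i, MemLp (g i) 2 P := fun i =>
    MemLp.of_bound (hg i).aestronglyMeasurable 1 (Eventually.of_forall (hb i))
  have hi : ∀ i, Integrable (g i) P := fun i => (hL i).integrable one_le_two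
  have hI0 : (0 : ℝ) < I := by exact_mod_cast hI
  have hcov1 : ∀ i j, |cov[g i, g j; P]| ≤ 1 := fun i j => by
    rw [covariance_eq_sub (hL i) (hL j)]
    have hij : Integrable (g i * g j) P := (hL i).integrable_mul (hL j)
    have m0 : ∀ i, 0 ≤ ∫ ω, g i ω ∂P := fun i => integral_nonneg (h0 i)
    have m1 : ∀ i, ∫ ω, g i ω ∂P ≤ 1 := fun i => by
      simpa using integral_mono (hi i) (integrable_const (1 : ℝ)) (h1 i)
    have p0 : 0 ≤ ∫ ω, (g i * g j) ω ∂P := integral_nonneg fun ω => mul_nonneg (h0 _ _) (h0 _ _)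
    have p1 : ∫ ω, (g i * g j) ω ∂P ≤ 1 := by
      simpa using integral_mono hij (integrable_const (1 : ℝ))
        fun ω => mul_le_one₀ (h1 i ω) (h0 j ω) (h1 j ω)
    have q0 := mul_nonneg (m0 i) (m0 j)
    have q1 := mul_le_one₀ (m1 i) (m0 j) (m1 j)
    rw [abs_le]; constructor <;> linarith
  have hcard : ∀ i, (∑ j ∈ Finset.range I, cov[g i, g j; P]) ≤ I * c + 2 * ℓ := fun i => by
    have hle : ∀ j ∈ Finset.range I, cov[g i, g j; P]
        ≤ c + (if j ∈ Finset.Ico (i - ℓ) (i + ℓ) then 1 else 0) := fun j _ => by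
      split_ifs with h
      · linarith [(abs_le.1 (hcov1 i j)).2]
      · rw [Finset.mem_Ico, not_and_or] at h
        rw [add_zero]
        rcases h with h | h
        · rw [covariance_comm]; exact (abs_le.1 (hcov j i (by omega))).2
        · exact (abs_le.1 (hcov i j (by omega))).2
    refine (Finset.sum_le_sum hle).trans ?_
    rw [Finset.sum_add_distrib, Finset.sum_boole]
    have hc2 : (Finset.filter (fun j => j ∈ Finset.Ico (i - ℓ) (i + ℓ)) (Finset.range I)).card
        ≤ 2 * ℓ := by
      refine (Finset.card_le_card (t := Finset.Ico (i - ℓ) (i + ℓ)) fun j hj => ?_).trans ?_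
      · exact (Finset.mem_filter.1 hj).2
      · rw [Nat.card_Ico]; omega
    have : ((Finset.filter (fun j => j ∈ Finset.Ico (i - ℓ) (i + ℓ)) (Finset.range I)).card : ℝ)
        ≤ 2 * ℓ := by exact_mod_cast hc2
    simp only [Finset.sum_const, Finset.card_range, nsmul_eq_mul]
    linarith
  set X : Ω → ℝ := fun ω => (I : ℝ)⁻¹ * ∑ i ∈ Finset.range I, g i ω with hX
  have hsum : MemLp (fun ω => ∑ i ∈ Finset.range I, g i ω) 2 P :=
    memLp_finsetSum _ fun i _ => hL i
  have hXL : MemLp X 2 P := hsum.const_mul _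
  have hXE : ∀ ω, (I : ℝ)⁻¹ * ∑ i ∈ Finset.range I, (g i ω - ∫ ω', g i ω' ∂P)
      = X ω - ∫ ω', X ω' ∂P := fun ω => by
    rw [hX, integral_const_mul, integral_finsetSum _ fun i _ => hi i, Finset.sum_sub_distrib,
      mul_sub]
  simp_rw [hXE]
  refine (integral_abs_sub_integral_le hXL).trans (Real.sqrt_le_sqrt ?_)
  rw [hX, variance_const_mul, variance_fun_sum' fun i _ => hL i]
  have := Finset.sum_le_sum fun i (_ : i ∈ Finset.range I) => hcard i
  simp only [Finset.sum_const, Finset.card_range, nsmul_eq_mul] at this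
  calc _ ≤ ((I : ℝ)⁻¹) ^ 2 * (I * (I * c + 2 * ℓ)) :=
        mul_le_mul_of_nonneg_left this (by positivity)
    _ = _ := by field_simp

namespace IsMixingSeq

variable {ξ : ℕ → Ω → ℝ} {s C v η : ℝ}

/-- Lindeberg's method: along a window, the mean of the smoothed square of the partial sums grows by
almost `v` at each step. The first order term of the expansion vanishes up to the mixing
coefficients, since the derivative at the partial sum telescopes into increments that are
dominated by single members of the sequence. -/
theorem le_integral_smoothSq_add (H : IsMixingSeq P ξ s C v η) (hs : 2 < s) {u t κ : ℝ}
    (hu : 0 < u) (ht : 0 < t) (ht1 : t ≤ 1) (hκ0 : 0 ≤ κ) (hκ1 : κ ≤ 1) (hκs : 2 + κ ≤ s)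
    (i n : ℕ) (hn : n * t ^ 2 ≤ 1) :
    ∫ ω, smoothSq u (t * windowSum ξ i n ω) ∂P + t ^ 2 * (v - (2 * (4 + 4 * C) * η
      + (4 + 2 * C) * η + v * (u ^ 2 * (v + 2 * (4 + 4 * C) * η) / 2) + 5 * u ^ κ * (1 + C)))
      ≤ ∫ ω, smoothSq u (t * windowSum ξ i (n + 1) ω) ∂P := by
  have hC := H.moment_nonneg
  have hη := H.eta_nonneg
  have hv := H.var_nonneg
  have hSm := H.measurable_windowSum i n
  set S := windowSum ξ i n
  set x := ξ (i + n) with hx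
  have hxm : Measurable x := H.measurable _
  have hxL : MemLp x 2 P := H.memLp hs _
  have hSL : MemLp S 2 P := H.memLp_windowSum hs i n
  -- first order term: the sine at the partial sum is the sum of its increments along the window
  have f1 : |∫ ω, Real.sin (u * (t * S ω)) * x ω ∂P| ≤ u * t * ((4 + 4 * C) * η) := by
    set D : ℕ → Ω → ℝ := fun j ω => (u * t)⁻¹ * (Real.sin (u * (t * windowSum ξ i (j + 1) ω))
      - Real.sin (u * (t * windowSum ξ i j ω))) with hD
    have hut : 0 < u * t := mul_pos hu ht
    have := H.abs_integral_sum_mul_le hs (i := i) (n := n) (D := D) (fun j _ => by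
        have m1 : Measurable[seqPast ξ (i + j + 1)] (windowSum ξ i (j + 1)) :=
          measurable_windowSum_past (by omega)
        have m2 : Measurable[seqPast ξ (i + j + 1)] (windowSum ξ i j) :=
          measurable_windowSum_past (by omega)
        exact ((Real.measurable_sin.comp ((m1.const_mul t).const_mul u)).sub
          (Real.measurable_sin.comp ((m2.const_mul t).const_mul u))).const_mul _)
      (fun j _ ω => by
        rw [hD, abs_mul, abs_of_pos (inv_pos.2 hut), inv_mul_le_iff₀ hut]
        have hl := Real.abs_sin_sub_sin_le (u * (t * windowSum ξ i (j + 1) ω))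
          (u * (t * windowSum ξ i j ω))
        rw [windowSum_succ] at hl ⊢
        refine hl.trans (le_of_eq ?_)
        rw [← abs_of_pos hut, ← abs_mul]; congr 1; ring)
    have hsum : ∀ ω, ∑ j ∈ Finset.range n, D j ω = (u * t)⁻¹ * Real.sin (u * (t * S ω)) :=
      fun ω => by
        rw [hD, ← Finset.mul_sum, Finset.sum_range_sub
          (fun j => Real.sin (u * (t * windowSum ξ i j ω)))]
        simp [S]
    simp_rw [hsum, mul_assoc] at this
    rw [integral_const_mul, abs_mul, abs_of_pos (inv_pos.2 (by positivity)),
      inv_mul_le_iff₀ (by positivity)] at this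
    simpa [mul_assoc] using this
  -- second order term: the cosine, almost uncorrelated with `x²`, is close to one in the mean
  have f2 : v * (∫ ω, Real.cos (u * (t * S ω)) ∂P) - (4 + 2 * C) * η
      ≤ ∫ ω, Real.cos (u * (t * S ω)) * x ω ^ 2 ∂P := by
    obtain ⟨a, ha0, haη, ha⟩ := H.mixing
    have m1 : Measurable[seqPast ξ (i + n)] S := measurable_windowSum_past le_rfl
    have := abs_integral_mul_sq_sub_le (P := P) (X := fun ω => Real.cos (u * (t * S ω))) (Y := x)
      (seqPast_le H.measurable (i + n)) (seqFuture_le H.measurable (i + n + 0)) (ha0 0)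
      (ha (i + n) 0) hs (Real.measurable_cos.comp ((m1.const_mul t).const_mul u))
      (measurable_seqFuture le_rfl) (fun ω => Real.abs_cos_le_one _) (H.integrable _) (H.moment _)
    have h2 : a 0 ^ ((s - 2) / s) ≤ η := by simpa using haη 1
    have h3 := mul_le_mul_of_nonneg_left h2 (by positivity : 0 ≤ 4 + 2 * C)
    have h4 : ∫ ω, x ω ^ 2 ∂P = v := H.var _
    rw [h4] at this
    linarith [(abs_le.1 this).1]
  have hcosm : Measurable fun ω => Real.cos (u * (t * S ω)) :=
    Real.measurable_cos.comp ((hSm.const_mul t).const_mul u)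
  have hsinm : Measurable fun ω => Real.sin (u * (t * S ω)) :=
    Real.measurable_sin.comp ((hSm.const_mul t).const_mul u)
  have icos : Integrable (fun ω => Real.cos (u * (t * S ω))) P :=
    Integrable.of_bound hcosm.aestronglyMeasurable 1
      (Eventually.of_forall fun ω => Real.abs_cos_le_one _)
  have f3 : 1 - u ^ 2 * (v + 2 * (4 + 4 * C) * η) / 2 ≤ ∫ ω, Real.cos (u * (t * S ω)) ∂P := by
    have h1 : ∫ ω, (1 - (u * t) ^ 2 / 2 * S ω ^ 2) ∂P ≤ ∫ ω, Real.cos (u * (t * S ω)) ∂P :=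
      integral_mono ((integrable_const _).sub (hSL.integrable_sq.const_mul _)) icos fun ω => by
        have := Real.one_sub_sq_div_two_le_cos (x := u * (t * S ω))
        change 1 - (u * t) ^ 2 / 2 * S ω ^ 2 ≤ _
        nlinarith
    rw [integral_sub (integrable_const _) (hSL.integrable_sq.const_mul _),
      integral_const_mul] at h1
    simp only [integral_const, probReal_univ, smul_eq_mul, mul_one] at h1
    have h2 := (abs_le.1 (H.abs_integral_windowSum_sq_sub_le hs i n)).2
    change ∫ ω, S ω ^ 2 ∂P - _ ≤ _ at h2
    have h3 : (u * t) ^ 2 / 2 * ∫ ω, S ω ^ 2 ∂P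
        ≤ u ^ 2 / 2 * (n * t ^ 2) * (v + 2 * (4 + 4 * C) * η) := by
      have := mul_le_mul_of_nonneg_left
        (show ∫ ω, S ω ^ 2 ∂P ≤ n * (v + 2 * (4 + 4 * C) * η) by linarith)
        (by positivity : 0 ≤ (u * t) ^ 2 / 2)
      linarith
    have h4 : u ^ 2 / 2 * (n * t ^ 2) * (v + 2 * (4 + 4 * C) * η)
        ≤ u ^ 2 / 2 * 1 * (v + 2 * (4 + 4 * C) * η) := by gcongr
    linarith
  -- remainder
  obtain ⟨ir, hr⟩ := H.integral_rpow_le (s' := 2 + κ) (by linarith) hκs (i + n)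
  have htκ : t ^ (2 + κ) ≤ t ^ 2 := by
    calc t ^ (2 + κ) ≤ t ^ (2 : ℝ) :=
          Real.rpow_le_rpow_of_exponent_ge ht ht1 (by linarith)
      _ = t ^ 2 := by norm_cast
  have iφ : ∀ n, Integrable (fun ω => smoothSq u (t * windowSum ξ i n ω)) P := fun n =>
    Integrable.of_bound ((continuous_smoothSq u).measurable.comp
      ((H.measurable_windowSum i n).const_mul t)).aestronglyMeasurable (4 / u ^ 2)
      (Eventually.of_forall fun ω => by
        rw [Real.norm_of_nonneg (smoothSq_nonneg _ _)]; exact smoothSq_le hu _)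
  have isin : Integrable (fun ω => Real.sin (u * (t * S ω)) * x ω) P :=
    (hxL.integrable one_le_two).bdd_mul hsinm.aestronglyMeasurable
      (Eventually.of_forall fun ω => Real.abs_sin_le_one _)
  have icx : Integrable (fun ω => Real.cos (u * (t * S ω)) * x ω ^ 2) P :=
    hxL.integrable_sq.bdd_mul hcosm.aestronglyMeasurable
      (Eventually.of_forall fun ω => Real.abs_cos_le_one _)
  have main : ∫ ω, smoothSq u (t * S ω) ∂P + 2 * t / u * (∫ ω, Real.sin (u * (t * S ω)) * x ω ∂P)
      + t ^ 2 * (∫ ω, Real.cos (u * (t * S ω)) * x ω ^ 2 ∂P)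
      - 5 * u ^ κ * t ^ 2 * (∫ ω, |x ω| ^ (2 + κ) ∂P)
      ≤ ∫ ω, smoothSq u (t * windowSum ξ i (n + 1) ω) ∂P := by
    have j1 : Integrable (fun ω => smoothSq u (t * S ω)
        + 2 * t / u * (Real.sin (u * (t * S ω)) * x ω)) P := (iφ n).add (isin.const_mul _)
    have j2 : Integrable (fun ω => smoothSq u (t * S ω)
        + 2 * t / u * (Real.sin (u * (t * S ω)) * x ω)
        + t ^ 2 * (Real.cos (u * (t * S ω)) * x ω ^ 2)) P := j1.add (icx.const_mul _)
    have j3 : Integrable (fun ω => 5 * u ^ κ * t ^ 2 * |x ω| ^ (2 + κ)) P := ir.const_mul _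
    rw [← integral_const_mul, ← integral_const_mul, ← integral_const_mul,
      ← integral_add (iφ n) (isin.const_mul _), ← integral_add j1 (icx.const_mul _),
      ← integral_sub j2 j3]
    refine integral_mono (j2.sub j3) (iφ (n + 1)) fun ω => ?_
    have hT := (abs_le.1 (abs_smoothSq_add_sub_le (s := 2 + κ) hu (by linarith) (by linarith)
      (t * S ω) (t * x ω))).1
    have e1 : t * S ω + t * x ω = t * windowSum ξ i (n + 1) ω := by
      rw [windowSum_succ]; ring
    have e2 : |t * x ω| ^ (2 + κ) ≤ t ^ 2 * |x ω| ^ (2 + κ) := by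
      rw [abs_mul, abs_of_pos ht, Real.mul_rpow ht.le (abs_nonneg _)]
      exact mul_le_mul_of_nonneg_right htκ (by positivity)
    have e3 : 5 * u ^ κ * |t * x ω| ^ (2 + κ) ≤ 5 * u ^ κ * (t ^ 2 * |x ω| ^ (2 + κ)) :=
      mul_le_mul_of_nonneg_left e2 (by positivity)
    rw [e1, add_sub_cancel_left] at hT
    have e4 : 2 * Real.sin (u * (t * S ω)) / u * (t * x ω)
        = 2 * t / u * (Real.sin (u * (t * S ω)) * x ω) := by ring
    rw [e4] at hT
    change smoothSq u (t * S ω) + 2 * t / u * (Real.sin (u * (t * S ω)) * x ω)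
        + t ^ 2 * (Real.cos (u * (t * S ω)) * x ω ^ 2)
        - 5 * u ^ κ * t ^ 2 * |x ω| ^ (2 + κ) ≤ _
    linarith
  have g1 : -(t ^ 2 * (2 * (4 + 4 * C) * η))
      ≤ 2 * t / u * (∫ ω, Real.sin (u * (t * S ω)) * x ω ∂P) := by
    have := mul_le_mul_of_nonneg_left (abs_le.1 f1).1 (by positivity : 0 ≤ 2 * t / u)
    have e : 2 * t / u * -(u * t * ((4 + 4 * C) * η)) = -(t ^ 2 * (2 * (4 + 4 * C) * η)) := by
      field_simp
    linarith
  have g2 : t ^ 2 * (v - v * (u ^ 2 * (v + 2 * (4 + 4 * C) * η) / 2) - (4 + 2 * C) * η)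
      ≤ t ^ 2 * (∫ ω, Real.cos (u * (t * S ω)) * x ω ^ 2 ∂P) := by
    refine mul_le_mul_of_nonneg_left (le_trans ?_ f2) (by positivity)
    have := mul_le_mul_of_nonneg_left f3 hv
    linarith
  have g3 : 5 * u ^ κ * t ^ 2 * (∫ ω, |x ω| ^ (2 + κ) ∂P) ≤ 5 * u ^ κ * t ^ 2 * (1 + C) :=
    mul_le_mul_of_nonneg_left hr (by positivity)
  linarith

end IsMixingSeq

end Sequence

namespace IsMixingSeq

variable {Ω : Type*} [MeasurableSpace Ω] {P : Measure Ω} [IsProbabilityMeasure P]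
  {ξ : ℕ → Ω → ℝ} {s C v η : ℝ}

/-- Along a whole window of length `ℓ`, smoothing the square of the normalized sum loses little of
its mean. -/
theorem le_integral_smoothSq (H : IsMixingSeq P ξ s C v η) (hs : 2 < s) {u κ : ℝ}
    (hu : 0 < u) (hu1 : u ≤ 1) (hκ0 : 0 ≤ κ) (hκ1 : κ ≤ 1) (hκs : 2 + κ ≤ s) (hη1 : η ≤ 1)
    (i : ℕ) {ℓ : ℕ} (hℓ : 0 < ℓ) :
    v - 12 * (1 + C) ^ 2 * (η + u ^ κ)
      ≤ ∫ ω, smoothSq u ((√ℓ)⁻¹ * windowSum ξ i ℓ ω) ∂P := by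
  have hC := H.moment_nonneg
  have hη := H.eta_nonneg
  have hv := H.var_nonneg
  have hv1 := H.var_le hs
  have hℓ0 : (0 : ℝ) < ℓ := by exact_mod_cast hℓ
  set t : ℝ := (√ℓ)⁻¹
  have ht : 0 < t := by positivity
  have ht1 : t ≤ 1 := inv_le_one_of_one_le₀ (Real.one_le_sqrt.2 (by exact_mod_cast hℓ))
  have ht2 : ℓ * t ^ 2 = 1 := by
    rw [inv_pow, Real.sq_sqrt hℓ0.le]; field_simp
  set τ := 2 * (4 + 4 * C) * η + (4 + 2 * C) * η
    + v * (u ^ 2 * (v + 2 * (4 + 4 * C) * η) / 2) + 5 * u ^ κ * (1 + C) with hτ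
  have step : ∀ n ≤ ℓ, n * t ^ 2 * (v - τ) ≤ ∫ ω, smoothSq u (t * windowSum ξ i n ω) ∂P := by
    intro n hn
    induction n with
    | zero => simp [smoothSq]
    | succ n ih =>
      have h1 := ih (by omega)
      have h2 := H.le_integral_smoothSq_add hs hu ht ht1 hκ0 hκ1 hκs i n (by
        rw [← ht2]
        exact mul_le_mul_of_nonneg_right (by exact_mod_cast (by omega : n ≤ ℓ)) (by positivity))
      rw [← hτ] at h2
      push_cast
      linarith
  have h := step ℓ le_rfl
  rw [ht2, one_mul] at h
  refine le_trans ?_ h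
  have huκ : u ^ 2 ≤ u ^ κ := by
    calc u ^ 2 = u ^ (2 : ℝ) := by norm_cast
      _ ≤ u ^ κ := Real.rpow_le_rpow_of_exponent_ge hu hu1 (by linarith)
  have huκ0 : 0 ≤ u ^ κ := by positivity
  have h1 : v * (u ^ 2 * (v + 2 * (4 + 4 * C) * η) / 2)
      ≤ (1 + C) * (u ^ κ * ((1 + C) + 2 * (4 + 4 * C) * 1) / 2) := by gcongr
  have h2 : 0 ≤ C * η := by positivity
  have h3 : 0 ≤ C * u ^ κ := by positivity
  have h4 : 0 ≤ C ^ 2 * η := by positivity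
  have h5 : 0 ≤ C ^ 2 * u ^ κ := by positivity
  rw [hτ]
  nlinarith

/-- Law of large numbers for the squared normalized window sums, with an explicit error: it is
small if `u` is small, `η` is small depending on `u`, and the windows are short relative to their
number `I`. -/
theorem integral_abs_average_sq_sub_le (H : IsMixingSeq P ξ s C v η) (hs : 2 < s) {u κ : ℝ}
    (hu : 0 < u) (hu1 : u ≤ 1) (hκ0 : 0 ≤ κ) (hκ1 : κ ≤ 1) (hκs : 2 + κ ≤ s) (hη1 : η ≤ 1)
    {ℓ I : ℕ} (hℓ : 0 < ℓ) (hI : 0 < I) :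
    ∫ ω, |(I : ℝ)⁻¹ * ∑ i ∈ Finset.range I, ((√ℓ)⁻¹ * windowSum ξ i ℓ ω) ^ 2 - v| ∂P
      ≤ 40 * (1 + C) ^ 2 * (η + u ^ κ) + 4 / u ^ 2 * √(8 * η + 2 * ℓ / I) := by
  have hC := H.moment_nonneg
  have hη := H.eta_nonneg
  have hℓ0 : (0 : ℝ) < ℓ := by exact_mod_cast hℓ
  have hI0 : (0 : ℝ) < I := by exact_mod_cast hI
  set t : ℝ := (√ℓ)⁻¹
  have ht2 : ℓ * t ^ 2 = 1 := by
    rw [inv_pow, Real.sq_sqrt hℓ0.le]; field_simp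
  set X : ℕ → Ω → ℝ := fun i ω => t * windowSum ξ i ℓ ω with hX
  set V : ℕ → Ω → ℝ := fun i ω => smoothSq u (X i ω) with hV
  have hXm : ∀ i, Measurable (X i) := fun i => (H.measurable_windowSum i ℓ).const_mul t
  have hVm : ∀ i, Measurable (V i) := fun i => (continuous_smoothSq u).measurable.comp (hXm i)
  have iX : ∀ i, Integrable (fun ω => X i ω ^ 2) P := fun i =>
    ((H.memLp_windowSum hs i ℓ).const_mul t).integrable_sq
  have iV : ∀ i, Integrable (V i) P := fun i =>
    Integrable.of_bound (hVm i).aestronglyMeasurable (4 / u ^ 2)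
      (Eventually.of_forall fun ω => by
        rw [Real.norm_of_nonneg (smoothSq_nonneg _ _)]; exact smoothSq_le hu _)
  have EX : ∀ i, ∫ ω, X i ω ^ 2 ∂P ≤ v + 8 * (1 + C) * η := fun i => by
    have h := (abs_le.1 (H.abs_integral_windowSum_sq_sub_le hs i ℓ)).2
    have h2 := mul_le_mul_of_nonneg_left h (sq_nonneg t)
    simp_rw [hX, mul_pow]
    rw [integral_const_mul]
    have e1 : t ^ 2 * (ℓ * (2 * (4 + 4 * C) * η)) = 8 * (1 + C) * η := by
      linear_combination (2 * (4 + 4 * C) * η) * ht2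
    have e2 : t ^ 2 * (ℓ * v) = v := by linear_combination v * ht2
    rw [mul_sub, e1, e2] at h2
    linarith
  have EV : ∀ i, v - 12 * (1 + C) ^ 2 * (η + u ^ κ) ≤ ∫ ω, V i ω ∂P := fun i =>
    H.le_integral_smoothSq hs hu hu1 hκ0 hκ1 hκs hη1 i hℓ
  have hVX : ∀ i ω, V i ω ≤ X i ω ^ 2 := fun i ω => smoothSq_le_sq hu _
  have EVX : ∀ i, ∫ ω, V i ω ∂P ≤ ∫ ω, X i ω ^ 2 ∂P := fun i =>
    integral_mono (iV i) (iX i) (hVX i)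
  -- Windows that start at least `ℓ` apart are disjoint, so the averages of the smoothed squares,
  -- which are bounded, concentrate.
  have hconc : ∫ ω, |(I : ℝ)⁻¹ * ∑ i ∈ Finset.range I, (V i ω - ∫ ω', V i ω' ∂P)| ∂P
      ≤ 4 / u ^ 2 * √(8 * η + 2 * ℓ / I) := by
    have hu4 : 0 < u ^ 2 / 4 := by positivity
    set g : ℕ → Ω → ℝ := fun i ω => u ^ 2 / 4 * V i ω with hg
    have hg0 : ∀ i ω, 0 ≤ g i ω := fun i ω => mul_nonneg hu4.le (smoothSq_nonneg _ _)
    have hg1 : ∀ i ω, g i ω ≤ 1 := fun i ω => by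
      have := mul_le_mul_of_nonneg_left (smoothSq_le hu (X i ω)) hu4.le
      calc g i ω ≤ u ^ 2 / 4 * (4 / u ^ 2) := this
        _ = 1 := by field_simp
    have hgm : ∀ i, Measurable (g i) := fun i => (hVm i).const_mul _
    have hgs : ∀ i ω, |g i ω| ^ s ≤ 1 := fun i ω =>
      Real.rpow_le_one (abs_nonneg _) (by rw [abs_of_nonneg (hg0 i ω)]; exact hg1 i ω)
        (by linarith)
    have hgL : ∀ i, MemLp (g i) 2 P := fun i =>
      MemLp.of_bound (hgm i).aestronglyMeasurable 1 (Eventually.of_forall fun ω => by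
        rw [Real.norm_of_nonneg (hg0 i ω)]; exact hg1 i ω)
    have igs : ∀ i, Integrable (fun ω => |g i ω| ^ s) P := fun i =>
      Integrable.of_bound ((hgm i).abs.pow_const s).aestronglyMeasurable 1
        (Eventually.of_forall fun ω => by
          rw [Real.norm_of_nonneg (by positivity)]; exact hgs i ω)
    have Egs : ∀ i, ∫ ω, |g i ω| ^ s ∂P ≤ 1 := fun i => by
      simpa using integral_mono (igs i) (integrable_const (1 : ℝ)) (hgs i)
    have hmeas : ∀ {m : MeasurableSpace Ω} {i}, Measurable[m] (windowSum ξ i ℓ) →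
        Measurable[m] (g i) := fun h =>
      ((continuous_smoothSq u).measurable.comp (h.const_mul t)).const_mul _
    have := integral_abs_average_sub_le (P := P) (g := g) hgm hg0 hg1 (c := 8 * η)
      (by positivity) (ℓ := ℓ) hI fun i j hij => by
        obtain ⟨a, ha0, haη, ha⟩ := H.mixing
        have hidx : j = i + ℓ + (j - (i + ℓ)) := by omega
        have h1 := abs_integral_mul_sub_le (P := P) (seqPast_le H.measurable (i + ℓ))
          (seqFuture_le H.measurable (i + ℓ + (j - (i + ℓ)))) (ha0 (j - (i + ℓ)))
          (ha (i + ℓ) (j - (i + ℓ))) hs (hmeas (measurable_windowSum_past le_rfl))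
          (hmeas (measurable_windowSum_future hidx.ge)) (igs i) (igs j) (Egs i) (Egs j)
        have h2 : a (j - (i + ℓ)) ^ ((s - 2) / s) ≤ η :=
          (Finset.single_le_sum (f := fun h => a h ^ ((s - 2) / s))
            (fun h _ => Real.rpow_nonneg (ha0 h) _)
            (Finset.self_mem_range_succ (j - (i + ℓ)))).trans (haη _)
        rw [covariance_eq_sub (hgL i) (hgL j)]
        exact h1.trans (by linarith)
    have e : ∀ ω, (I : ℝ)⁻¹ * ∑ i ∈ Finset.range I, (g i ω - ∫ ω', g i ω' ∂P)
        = u ^ 2 / 4 * ((I : ℝ)⁻¹ * ∑ i ∈ Finset.range I, (V i ω - ∫ ω', V i ω' ∂P)) := fun ω => by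
      simp_rw [hg, integral_const_mul, ← mul_sub, ← Finset.mul_sum]; ring
    simp_rw [e, abs_mul, abs_of_pos hu4] at this
    rw [integral_const_mul] at this
    simp_rw [abs_mul]
    have h2 := mul_le_mul_of_nonneg_left this (by positivity : 0 ≤ 4 / u ^ 2)
    rw [← mul_assoc, show 4 / u ^ 2 * (u ^ 2 / 4) = 1 by field_simp, one_mul] at h2
    exact h2
  have hpt : ∀ ω, |(I : ℝ)⁻¹ * ∑ i ∈ Finset.range I, X i ω ^ 2 - v|
      ≤ |(I : ℝ)⁻¹ * ∑ i ∈ Finset.range I, (V i ω - ∫ ω', V i ω' ∂P)|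
        + (I : ℝ)⁻¹ * ∑ i ∈ Finset.range I, ((X i ω ^ 2 - V i ω) + |∫ ω', V i ω' ∂P - v|) := by
    intro ω
    have e : (I : ℝ)⁻¹ * ∑ i ∈ Finset.range I, X i ω ^ 2 - v
        = (I : ℝ)⁻¹ * ∑ i ∈ Finset.range I, (V i ω - ∫ ω', V i ω' ∂P)
          + (I : ℝ)⁻¹ * ∑ i ∈ Finset.range I, ((X i ω ^ 2 - V i ω) + (∫ ω', V i ω' ∂P - v)) := by
      simp only [Finset.sum_add_distrib, Finset.sum_sub_distrib, Finset.sum_const,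
        Finset.card_range, nsmul_eq_mul]
      field_simp; ring
    rw [e]
    refine (abs_add_le _ _).trans (add_le_add le_rfl ?_)
    rw [abs_mul, abs_of_pos (inv_pos.2 hI0)]
    refine mul_le_mul_of_nonneg_left ((Finset.abs_sum_le_sum_abs _ _).trans
      (Finset.sum_le_sum fun i _ => (abs_add_le _ _).trans ?_)) (by positivity)
    rw [abs_of_nonneg (sub_nonneg.2 (hVX i ω))]
  have iterm : ∀ i, Integrable (fun ω => (X i ω ^ 2 - V i ω) + |∫ ω', V i ω' ∂P - v|) P :=
    fun i => ((iX i).sub (iV i)).add (integrable_const _)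
  have huκ0 : 0 ≤ u ^ κ := by positivity
  have Eterm : ∀ i, ∫ ω, ((X i ω ^ 2 - V i ω) + |∫ ω', V i ω' ∂P - v|) ∂P
      ≤ 40 * (1 + C) ^ 2 * (η + u ^ κ) := fun i => by
    have iXV : Integrable (fun ω => X i ω ^ 2 - V i ω) P := (iX i).sub (iV i)
    rw [integral_add iXV (integrable_const _), integral_sub (iX i) (iV i)]
    simp only [integral_const, probReal_univ, smul_eq_mul, one_mul]
    have h1 := EX i
    have h2 := EV i
    have h3 := EVX i
    have h4 : |∫ ω, V i ω ∂P - v| ≤ 12 * (1 + C) ^ 2 * (η + u ^ κ) + 8 * (1 + C) * η :=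
      abs_le.2 ⟨by nlinarith [mul_nonneg hC hη], by nlinarith [sq_nonneg (1 + C)]⟩
    have h5 : (1 + C) * η ≤ (1 + C) ^ 2 * (η + u ^ κ) := by
      calc (1 + C) * η ≤ (1 + C) ^ 2 * η :=
            mul_le_mul_of_nonneg_right (le_self_pow₀ (by linarith) two_ne_zero) hη
        _ ≤ _ := by gcongr; linarith
    linarith
  have isumV : Integrable (fun ω => |(I : ℝ)⁻¹ * ∑ i ∈ Finset.range I,
      (V i ω - ∫ ω', V i ω' ∂P)|) P :=
    ((integrable_finsetSum _ fun i _ => (iV i).sub (integrable_const _)).const_mul _).abs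
  have isum : Integrable (fun ω => (I : ℝ)⁻¹ * ∑ i ∈ Finset.range I,
      ((X i ω ^ 2 - V i ω) + |∫ ω', V i ω' ∂P - v|)) P :=
    (integrable_finsetSum _ fun i _ => iterm i).const_mul _
  refine (integral_mono ((((integrable_finsetSum _ fun i _ => iX i).const_mul _).sub
    (integrable_const _)).abs) (isumV.add isum) hpt).trans ?_
  rw [integral_add' isumV isum, add_comm]
  refine add_le_add ?_ hconc
  rw [integral_const_mul, integral_finsetSum _ fun i _ => iterm i]
  have := Finset.sum_le_sum fun i (_ : i ∈ Finset.range I) => Eterm i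
  simp only [Finset.sum_const, Finset.card_range, nsmul_eq_mul] at this
  rwa [inv_mul_le_iff₀ hI0]

end IsMixingSeq

/-! ### Convergence in probability to constants -/

section InMeasure

variable {Ω : Type*} [MeasurableSpace Ω] {P : Measure Ω}

/-- Continuous mapping theorem for constant limits; no measurability is needed. -/
theorem tendstoInMeasure_of_continuousAt {κ : Type*} [Fintype κ] {f : κ → ℕ → Ω → ℝ} {c : κ → ℝ}
    (hf : ∀ k, TendstoInMeasure P (f k) atTop fun _ => c k) {F : (κ → ℝ) → ℝ}
    (hF : ContinuousAt F c) :
    TendstoInMeasure P (fun m ω => F fun k => f k m ω) atTop fun _ => F c := by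
  rw [tendstoInMeasure_iff_dist]
  intro ε hε
  obtain ⟨δ, hδ, hFδ⟩ := Metric.continuousAt_iff.1 hF ε hε
  have hsum : Tendsto (fun m => ∑ k, P {ω | δ ≤ dist (f k m ω) (c k)}) atTop (𝓝 0) := by
    rw [← Finset.sum_const_zero (s := (Finset.univ : Finset κ))]
    exact tendsto_finsetSum _ fun k _ => tendstoInMeasure_iff_dist.1 (hf k) δ hδ
  refine tendsto_of_tendsto_of_tendsto_of_le_of_le tendsto_const_nhds hsum (fun _ => zero_le)
    fun m => ?_
  refine (measure_mono fun ω hω => ?_).trans (measure_iUnion_fintype_le P _)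
  by_contra h
  simp only [Set.mem_iUnion, Set.mem_ofPred_eq, not_exists, not_le] at h
  exact absurd (hFδ ((dist_pi_lt_iff hδ).2 h)) (not_lt.2 hω)

theorem tendstoInMeasure_of_abs_sub_le {f g : ℕ → Ω → ℝ} {c : ℝ}
    (hfg : ∀ᶠ m in atTop, ∀ ω, |f m ω - c| ≤ g m ω)
    (hg : TendstoInMeasure P g atTop fun _ => 0) :
    TendstoInMeasure P f atTop fun _ => c := by
  rw [tendstoInMeasure_iff_dist] at *
  intro ε hε
  refine tendsto_of_tendsto_of_tendsto_of_le_of_le' tendsto_const_nhds (hg ε hε)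
    (Eventually.of_forall fun _ => zero_le) (hfg.mono fun m hm => measure_mono fun ω hω => ?_)
  simp only [Set.mem_ofPred_eq, Real.dist_eq, sub_zero] at hω ⊢
  exact hω.trans ((hm ω).trans (le_abs_self _))

theorem tendstoInMeasure_of_lintegral {f : ℕ → Ω → ℝ} {c : ℝ}
    (hf : ∀ᶠ m in atTop, Measurable (f m))
    (h : Tendsto (fun m => ∫⁻ ω, ‖f m ω - c‖ₑ ∂P) atTop (𝓝 0)) :
    TendstoInMeasure P f atTop fun _ => c := by
  obtain ⟨N, hN⟩ := eventually_atTop.1 hf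
  have hk : TendstoInMeasure P (fun m => f (m + N)) atTop fun _ => c := by
    refine tendstoInMeasure_of_tendsto_eLpNorm one_ne_zero
      (fun m => (hN _ (by omega)).aestronglyMeasurable) aestronglyMeasurable_const ?_
    simp_rw [eLpNorm_one_eq_lintegral_enorm]
    exact (tendsto_add_atTop_iff_nat N).2 h
  intro ε hε
  exact (tendsto_add_atTop_iff_nat N (f := fun m => P {x | ε ≤ edist (f m x) c})).1 (hk ε hε)

theorem tendstoInMeasure_of_integral {f : ℕ → Ω → ℝ} {c : ℝ}
    (hf : ∀ᶠ m in atTop, Measurable (f m)) (hi : ∀ᶠ m in atTop, Integrable (fun ω => f m ω - c) P)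
    (h : Tendsto (fun m => ∫ ω, |f m ω - c| ∂P) atTop (𝓝 0)) :
    TendstoInMeasure P f atTop fun _ => c := by
  refine tendstoInMeasure_of_lintegral hf ?_
  have h1 := ENNReal.tendsto_ofReal h
  rw [ENNReal.ofReal_zero] at h1
  refine h1.congr' (hi.mono fun m hm => ?_)
  exact ofReal_integral_norm_eq_lintegral_enorm hm

end InMeasure

/-! ### Functions of a column of the array -/

section Columns

variable {Ω : Type*} {d p : ℕ} {Y : ℤ → Ω → Vec d}

theorem obs_zero (q : ℕ) (j : Fin p) (ω : Ω) : obs Y q 0 j ω = Y ((j : ℤ) + 1) ω := by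
  simp [obs]

/-- Column `i` of the data array. -/
def column (p : ℕ) (Y : ℤ → Ω → Vec d) (q i : ℕ) (ω : Ω) : Fin p → Vec d :=
  fun j => obs Y q i j ω

variable [MeasurableSpace Ω] {P : Measure Ω}

theorem le_alphaMixing [IsProbabilityMeasure P] {n : ℕ} {a : ℤ} {A B : Set Ω}
    (hA : MeasurableSet[past Y a] A) (hB : MeasurableSet[future Y (a + n)] B) :
    |P.real (A ∩ B) - P.real A * P.real B| ≤ alphaMixing P Y n := by
  refine le_csSup ⟨1, ?_⟩ ⟨a, A, B, hA, hB, rfl⟩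
  rintro _ ⟨-, A, B, -, -, rfl⟩
  have h1 : P.real (A ∩ B) ≤ 1 := measureReal_le_one
  have h2 : P.real A * P.real B ≤ 1 :=
    mul_le_one₀ measureReal_le_one measureReal_nonneg measureReal_le_one
  have h3 : 0 ≤ P.real A * P.real B := mul_nonneg measureReal_nonneg measureReal_nonneg
  have h4 : 0 ≤ P.real (A ∩ B) := measureReal_nonneg
  rw [abs_le]; constructor <;> linarith

theorem alphaMixing_nonneg [IsProbabilityMeasure P] (n : ℕ) : 0 ≤ alphaMixing P Y n :=
  (abs_nonneg _).trans (le_alphaMixing (P := P) (Y := Y) (n := n) (a := 0) (A := ∅) (B := ∅)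
    (@MeasurableSet.empty _ (past Y 0)) (@MeasurableSet.empty _ (future Y (0 + n))))

theorem measurable_obs (hY : ∀ t, Measurable (Y t)) (q i : ℕ) (j : Fin p) :
    Measurable (obs Y q i j) := hY _

theorem measurable_column (hY : ∀ t, Measurable (Y t)) (q i : ℕ) :
    Measurable (column p Y q i) :=
  measurable_pi_lambda _ fun j => measurable_obs hY q i j

theorem identDistrib_column {q : ℕ} (hY : ∀ t, Measurable (Y t))
    (hstat : IdentDistrib (fun ω (i : ℕ) (j : Fin p) => obs Y q i j ω)
      (fun ω (i : ℕ) (j : Fin p) => obs Y q (i + 1) j ω) P P) (i : ℕ) :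
    IdentDistrib (column p Y q i) (column p Y q 0) P P := by
  induction i with
  | zero => exact IdentDistrib.refl (measurable_column hY q 0).aemeasurable
  | succ i ih => exact (hstat.comp (measurable_pi_apply i)).symm.trans ih

/-- The values of a centred function of the columns form a mixing sequence. Distinct columns are
separated by a gap, so that the sum of the powers of the mixing coefficients is a tail of the
series for the parent process. -/
theorem isMixingSeq_column [IsProbabilityMeasure P] {q : ℕ} (hY : ∀ t, Measurable (Y t))
    (hstat : IdentDistrib (fun ω (i : ℕ) (j : Fin p) => obs Y q i j ω)
      (fun ω (i : ℕ) (j : Fin p) => obs Y q (i + 1) j ω) P P) (hp : 0 < p) {s : ℝ}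
    {F : (Fin p → Vec d) → ℝ} (hF : Measurable F)
    (hF0 : ∫ ω, F (fun j => Y ((j : ℤ) + 1) ω) ∂P = 0)
    (hFs : Integrable (fun ω => |F (fun j => Y ((j : ℤ) + 1) ω)| ^ s) P)
    (hmix : Summable fun n : ℕ => alphaMixing P Y (n + 1) ^ ((s - 2) / s)) :
    IsMixingSeq P (fun i ω => F (column p Y q i ω)) s
      (∫ ω, |F (fun j => Y ((j : ℤ) + 1) ω)| ^ s ∂P) (∫ ω, F (fun j => Y ((j : ℤ) + 1) ω) ^ 2 ∂P)
      (∑' n : ℕ, alphaMixing P Y (n + q + 1) ^ ((s - 2) / s)) := by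
  have hid := identDistrib_column (p := p) hY hstat
  have e0 : ∀ ω, column p Y q 0 ω = fun j : Fin p => Y ((j : ℤ) + 1) ω := fun ω =>
    funext fun j => obs_zero q j ω
  refine ⟨fun i => hF.comp (measurable_column hY q i), fun i => ?_, fun i => ?_, fun i => ?_,
    fun i => ?_, fun h => alphaMixing P Y (h * (p + q) + q + 1), fun _ => alphaMixing_nonneg _,
    fun N => ?_, fun k h A B hA hB => ?_⟩
  · have := ((hid i).comp hF).integral_eq
    simpa only [Function.comp_apply, e0, hF0] using this
  · have := ((hid i).comp (hF.pow_const 2)).integral_eq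
    simpa only [Function.comp_apply, e0] using this
  · have := ((hid i).comp (hF.abs.pow_const s)).integrable_iff
    refine this.2 ?_
    simpa only [Function.comp_def, e0] using hFs
  · have := ((hid i).comp (hF.abs.pow_const s)).integral_eq
    simp only [Function.comp_apply, e0] at this
    exact this.le
  · have hinj : Function.Injective fun h : ℕ => h * (p + q) := fun a b hab =>
      Nat.eq_of_mul_eq_mul_right (by omega : 0 < p + q) hab
    have hsq : Summable fun n : ℕ => alphaMixing P Y (n + q + 1) ^ ((s - 2) / s) :=
      (summable_nat_add_iff q (f := fun n => alphaMixing P Y (n + 1) ^ ((s - 2) / s))).2 hmix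
    have := hsq.sum_le_tsum ((Finset.range N).image fun h : ℕ => h * (p + q))
      fun n _ => Real.rpow_nonneg (alphaMixing_nonneg _) _
    rwa [Finset.sum_image fun a _ b _ hab => hinj hab] at this
  · -- the last time in the first `k` columns is `k (p + q) - q`
    have hpast : seqPast (fun i ω => F (column p Y q i ω)) k
        ≤ past Y ((k : ℤ) * ((p : ℤ) + q) - q) := by
      refine iSup₂_le fun i hi => ?_
      have hi' : i + 1 ≤ k := hi
      rw [← measurable_iff_comap_le]
      refine hF.comp (@measurable_pi_lambda _ _ _ (past Y _) _ _ fun j => ?_)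
      refine (comap_measurable _).mono (le_iSup₂_of_le
        (f := fun t (_ : t ∈ Set.Iic ((k : ℤ) * ((p : ℤ) + q) - q)) =>
          MeasurableSpace.comap (Y t) inferInstance)
        ((i : ℤ) * ((p : ℤ) + (q : ℤ)) + (j : ℤ) + 1) ?_ le_rfl) le_rfl
      have hj : (j : ℤ) + 1 ≤ p := by exact_mod_cast j.2
      have hik : ((i : ℤ) + 1) * ((p : ℤ) + q) ≤ k * ((p : ℤ) + q) :=
        mul_le_mul_of_nonneg_right (by exact_mod_cast hi') (by positivity)
      simp only [Set.mem_Iic]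
      linarith
    have hfut : seqFuture (fun i ω => F (column p Y q i ω)) (k + h)
        ≤ future Y ((k : ℤ) * ((p : ℤ) + q) - q + ((h * (p + q) + q + 1 : ℕ) : ℤ)) := by
      refine iSup₂_le fun i hi => ?_
      have hi' : k + h ≤ i := hi
      rw [← measurable_iff_comap_le]
      refine hF.comp (@measurable_pi_lambda _ _ _ (future Y _) _ _ fun j => ?_)
      refine (comap_measurable _).mono (le_iSup₂_of_le
        (f := fun t (_ : t ∈ Set.Ici ((k : ℤ) * ((p : ℤ) + q) - q
            + ((h * (p + q) + q + 1 : ℕ) : ℤ))) =>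
          MeasurableSpace.comap (Y t) inferInstance)
        ((i : ℤ) * ((p : ℤ) + (q : ℤ)) + (j : ℤ) + 1) ?_ le_rfl) le_rfl
      have hik : ((k : ℤ) + h) * ((p : ℤ) + q) ≤ i * ((p : ℤ) + q) :=
        mul_le_mul_of_nonneg_right (by exact_mod_cast hi') (by positivity)
      simp only [Set.mem_Ici]
      push_cast
      linarith [Int.natCast_nonneg (j : ℕ)]
    exact le_alphaMixing (hpast _ hA) (hfut _ hB)

end Columns

/-! ### Limits of second moments over columns with growing gaps -/

section Columns

variable {Ω : Type*} {d p : ℕ} {Y : ℤ → Ω → Vec d} {q : ℕ → ℕ} {s : ℝ}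

/-- The values of a function of the columns along the array with `m` columns. -/
def score (Y : ℤ → Ω → Vec d) (q : ℕ → ℕ) (F : (Fin p → Vec d) → ℝ) (m i : ℕ) (ω : Ω) : ℝ :=
  F (column p Y (q m) i ω)

/-- The normalized sum of a score over the window of length `n` that starts at `i`. -/
noncomputable def normSum (Y : ℤ → Ω → Vec d) (q : ℕ → ℕ) (F : (Fin p → Vec d) → ℝ)
    (m i n : ℕ) (ω : Ω) : ℝ :=
  (√n)⁻¹ * windowSum (score Y q F m) i n ω

variable {F G : (Fin p → Vec d) → ℝ}

theorem normSum_add (m i n : ℕ) (ω : Ω) :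
    normSum Y q (fun x => F x + G x) m i n ω = normSum Y q F m i n ω + normSum Y q G m i n ω := by
  simp only [normSum, windowSum, score, Finset.sum_add_distrib, mul_add]

theorem normSum_sub (m i n : ℕ) (ω : Ω) :
    normSum Y q (fun x => F x - G x) m i n ω = normSum Y q F m i n ω - normSum Y q G m i n ω := by
  simp only [normSum, windowSum, score, Finset.sum_sub_distrib, mul_sub]

variable [MeasurableSpace Ω] {P : Measure Ω}

/-- An array with stationary columns and growing gaps, sampled from a strongly mixing series whose
mixing coefficients match moments of order `s > 2`. -/
structure IsGappedArray (P : Measure Ω) (p : ℕ) (Y : ℤ → Ω → Vec d) (q : ℕ → ℕ) (s : ℝ) :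
    Prop where
  rows_pos : 0 < p
  two_lt : 2 < s
  measurable : ∀ t, Measurable (Y t)
  stationary : ∀ m, IdentDistrib (fun ω (i : ℕ) (j : Fin p) => obs Y (q m) i j ω)
      (fun ω (i : ℕ) (j : Fin p) => obs Y (q m) (i + 1) j ω) P P
  mixing : Summable fun n : ℕ => alphaMixing P Y (n + 1) ^ ((s - 2) / s)
  gap : Tendsto q atTop atTop

/-- A real function of the columns that is centred and has a moment of order `s`. The first column
`(Y 1, …, Y p)` is the same for all gaps. -/
structure IsCentredScore (P : Measure Ω) (Y : ℤ → Ω → Vec d) (s : ℝ)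
    (F : (Fin p → Vec d) → ℝ) : Prop where
  measurable : Measurable F
  memLp : MemLp (fun ω => F fun j => Y ((j : ℤ) + 1) ω) (ENNReal.ofReal s) P
  mean : ∫ ω, F (fun j => Y ((j : ℤ) + 1) ω) ∂P = 0

/-- The covariance of two centred scores of the same column. -/
noncomputable def scoreCov (P : Measure Ω) (Y : ℤ → Ω → Vec d) (F G : (Fin p → Vec d) → ℝ) : ℝ :=
  ∫ ω, F (fun j => Y ((j : ℤ) + 1) ω) * G (fun j => Y ((j : ℤ) + 1) ω) ∂P

namespace IsCentredScore

variable [IsProbabilityMeasure P]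

theorem memLp_two (hF : IsCentredScore P Y s F) (hs : 2 < s) :
    MemLp (fun ω => F fun j => Y ((j : ℤ) + 1) ω) 2 P :=
  hF.memLp.mono_exponent (by
    rw [← ENNReal.ofReal_ofNat]; exact ENNReal.ofReal_le_ofReal hs.le)

theorem add (hF : IsCentredScore P Y s F) (hG : IsCentredScore P Y s G) (hs : 2 < s) :
    IsCentredScore P Y s fun x => F x + G x :=
  ⟨hF.measurable.add hG.measurable, hF.memLp.add hG.memLp, by
    rw [integral_add ((hF.memLp_two hs).integrable one_le_two)
      ((hG.memLp_two hs).integrable one_le_two), hF.mean, hG.mean, add_zero]⟩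

theorem sub (hF : IsCentredScore P Y s F) (hG : IsCentredScore P Y s G) (hs : 2 < s) :
    IsCentredScore P Y s fun x => F x - G x :=
  ⟨hF.measurable.sub hG.measurable, hF.memLp.sub hG.memLp, by
    rw [integral_sub ((hF.memLp_two hs).integrable one_le_two)
      ((hG.memLp_two hs).integrable one_le_two), hF.mean, hG.mean, sub_zero]⟩

/-- Polarization, which reduces products of scores to squares. -/
theorem scoreCov_polar (hF : IsCentredScore P Y s F) (hG : IsCentredScore P Y s G) (hs : 2 < s) :
    scoreCov P Y F G = (scoreCov P Y (fun x => F x + G x) (fun x => F x + G x)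
      - scoreCov P Y (fun x => F x - G x) (fun x => F x - G x)) / 4 := by
  have lF := hF.memLp_two hs
  have lG := hG.memLp_two hs
  simp only [scoreCov]
  have i1 : Integrable (fun ω => (F (fun j => Y ((j : ℤ) + 1) ω) + G fun j => Y ((j : ℤ) + 1) ω)
      * (F (fun j => Y ((j : ℤ) + 1) ω) + G fun j => Y ((j : ℤ) + 1) ω)) P :=
    (lF.add lG).integrable_mul (lF.add lG)
  have i2 : Integrable (fun ω => (F (fun j => Y ((j : ℤ) + 1) ω) - G fun j => Y ((j : ℤ) + 1) ω)
      * (F (fun j => Y ((j : ℤ) + 1) ω) - G fun j => Y ((j : ℤ) + 1) ω)) P :=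
    (lF.sub lG).integrable_mul (lF.sub lG)
  rw [← integral_sub i1 i2, ← integral_div]
  congr 1; ext ω; ring

end IsCentredScore

namespace IsGappedArray

theorem tendsto_mixing_tail (hA : IsGappedArray P p Y q s) :
    Tendsto (fun m => ∑' n : ℕ, alphaMixing P Y (n + q m + 1) ^ ((s - 2) / s)) atTop (𝓝 0) :=
  (tendsto_sum_nat_add fun n => alphaMixing P Y (n + 1) ^ ((s - 2) / s)).comp hA.gap

variable [IsProbabilityMeasure P]

theorem isMixingSeq (hA : IsGappedArray P p Y q s) (hF : IsCentredScore P Y s F) (m : ℕ) :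
    IsMixingSeq P (score Y q F m) s (∫ ω, |F (fun j => Y ((j : ℤ) + 1) ω)| ^ s ∂P)
      (scoreCov P Y F F) (∑' n : ℕ, alphaMixing P Y (n + q m + 1) ^ ((s - 2) / s)) := by
  have hs0 : 0 < s := two_pos.trans hA.two_lt
  have h := isMixingSeq_column hA.measurable (hA.stationary m) hA.rows_pos hF.measurable hF.mean
    (by
      have := hF.memLp.integrable_norm_rpow (by simpa using hs0) ENNReal.ofReal_ne_top
      simpa only [ENNReal.toReal_ofReal hs0.le, Real.norm_eq_abs] using this) hA.mixing
  simp only [sq] at h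
  exact h

theorem measurable_normSum (hA : IsGappedArray P p Y q s) (hF : IsCentredScore P Y s F)
    (m i n : ℕ) : Measurable (normSum Y q F m i n) :=
  ((hA.isMixingSeq hF m).measurable_windowSum i n).const_mul _

theorem memLp_normSum (hA : IsGappedArray P p Y q s) (hF : IsCentredScore P Y s F)
    (m i n : ℕ) : MemLp (normSum Y q F m i n) 2 P :=
  ((hA.isMixingSeq hF m).memLp_windowSum hA.two_lt i n).const_mul _

theorem integral_normSum (hA : IsGappedArray P p Y q s) (hF : IsCentredScore P Y s F)
    (m i n : ℕ) : ∫ ω, normSum Y q F m i n ω ∂P = 0 := by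
  have H := hA.isMixingSeq hF m
  unfold normSum windowSum
  rw [integral_const_mul, integral_finsetSum _ fun k _ =>
    (H.memLp hA.two_lt _).integrable one_le_two]
  simp [H.mean]

theorem tendsto_integral_normSum_sq (hA : IsGappedArray P p Y q s)
    (hF : IsCentredScore P Y s F) :
    Tendsto (fun m => ∫ ω, normSum Y q F m 0 m ω ^ 2 ∂P) atTop (𝓝 (scoreCov P Y F F)) := by
  set C := ∫ ω, |F (fun j => Y ((j : ℤ) + 1) ω)| ^ s ∂P
  have h1 := (hA.tendsto_mixing_tail.const_mul (2 * (4 + 4 * C)))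
  rw [mul_zero] at h1
  rw [tendsto_iff_norm_sub_tendsto_zero]
  refine squeeze_zero' (Eventually.of_forall fun _ => norm_nonneg _)
    ((eventually_gt_atTop 0).mono fun m hm => ?_) h1
  have h := (hA.isMixingSeq hF m).abs_integral_windowSum_sq_sub_le hA.two_lt 0 m
  have hm0 : (0 : ℝ) < m := by exact_mod_cast hm
  have e : ∫ ω, normSum Y q F m 0 m ω ^ 2 ∂P - scoreCov P Y F F = (m : ℝ)⁻¹ *
      (∫ ω, windowSum (score Y q F m) 0 m ω ^ 2 ∂P - m * scoreCov P Y F F) := by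
    simp_rw [normSum, mul_pow, inv_pow, Real.sq_sqrt hm0.le]
    rw [integral_const_mul]; field_simp
  rw [e, Real.norm_eq_abs, abs_mul, abs_of_pos (inv_pos.2 hm0), inv_mul_le_iff₀ hm0]
  exact h

/-- Since the gaps grow, scores of different columns do not contribute to the limit of the
covariances. -/
theorem tendsto_integral_normSum_mul (hA : IsGappedArray P p Y q s)
    (hF : IsCentredScore P Y s F) (hG : IsCentredScore P Y s G) :
    Tendsto (fun m => ∫ ω, normSum Y q F m 0 m ω * normSum Y q G m 0 m ω ∂P) atTop
      (𝓝 (scoreCov P Y F G)) := by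
  rw [hF.scoreCov_polar hG hA.two_lt]
  refine (((hA.tendsto_integral_normSum_sq (hF.add hG hA.two_lt)).sub
    (hA.tendsto_integral_normSum_sq (hF.sub hG hA.two_lt))).div_const 4).congr fun m => ?_
  have lF := hA.memLp_normSum hF m 0 m
  have lG := hA.memLp_normSum hG m 0 m
  simp_rw [normSum_add, normSum_sub]
  have i1 : Integrable (fun ω => (normSum Y q F m 0 m ω + normSum Y q G m 0 m ω) ^ 2) P :=
    (lF.add lG).integrable_sq
  have i2 : Integrable (fun ω => (normSum Y q F m 0 m ω - normSum Y q G m 0 m ω) ^ 2) P :=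
    (lF.sub lG).integrable_sq
  rw [← integral_sub i1 i2, ← integral_div]
  congr 1; ext ω; ring

/-- The averages of the squared normalized sums over all windows are consistent. -/
theorem tendstoInMeasure_average_sq (hA : IsGappedArray P p Y q s)
    (hF : IsCentredScore P Y s F) {ℓ : ℕ → ℕ} (hℓ : ∀ᶠ m in atTop, 0 < ℓ m ∧ ℓ m ≤ m)
    (hℓm : Tendsto (fun m => (ℓ m : ℝ) / m) atTop (𝓝 0)) :
    TendstoInMeasure P (fun m ω => ((m - ℓ m + 1 : ℕ) : ℝ)⁻¹ *
      ∑ i ∈ Finset.range (m - ℓ m + 1), normSum Y q F m i (ℓ m) ω ^ 2) atTop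
      fun _ => scoreCov P Y F F := by
  set C := ∫ ω, |F (fun j => Y ((j : ℤ) + 1) ω)| ^ s ∂P with hC
  set η : ℕ → ℝ := fun m => ∑' n : ℕ, alphaMixing P Y (n + q m + 1) ^ ((s - 2) / s) with hη
  have hη0 : Tendsto η atTop (𝓝 0) := hA.tendsto_mixing_tail
  have hs := hA.two_lt
  have hI : ∀ᶠ m : ℕ in atTop, (m : ℝ) / 2 ≤ ((m - ℓ m + 1 : ℕ) : ℝ) := by
    filter_upwards [hℓ, hℓm.eventually_le_const (by norm_num : (0 : ℝ) < 1 / 2),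
      eventually_gt_atTop 0] with m h1 h2 h3
    have hm0 : (0 : ℝ) < m := by exact_mod_cast h3
    rw [div_le_iff₀ hm0] at h2
    push_cast [Nat.cast_sub h1.2]
    linarith
  have hratio : Tendsto (fun m => (ℓ m : ℝ) / ((m - ℓ m + 1 : ℕ) : ℝ)) atTop (𝓝 0) := by
    have h2 := hℓm.const_mul 2
    rw [mul_zero] at h2
    refine squeeze_zero' (Eventually.of_forall fun _ => by positivity) ?_ h2
    filter_upwards [hI, eventually_gt_atTop 0] with m h1 h3
    have hm0 : (0 : ℝ) < m := by exact_mod_cast h3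
    calc (ℓ m : ℝ) / ((m - ℓ m + 1 : ℕ) : ℝ) ≤ ℓ m / (m / 2) := by gcongr
      _ = _ := by field_simp
  have hmeas : ∀ m, Measurable fun ω => ((m - ℓ m + 1 : ℕ) : ℝ)⁻¹ *
      ∑ i ∈ Finset.range (m - ℓ m + 1), normSum Y q F m i (ℓ m) ω ^ 2 := fun m =>
    (Finset.measurable_sum _ fun i _ =>
      (hA.measurable_normSum hF m i (ℓ m)).pow_const 2).const_mul _
  have hint : ∀ m, Integrable (fun ω => ((m - ℓ m + 1 : ℕ) : ℝ)⁻¹ *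
      ∑ i ∈ Finset.range (m - ℓ m + 1), normSum Y q F m i (ℓ m) ω ^ 2) P := fun m =>
    (integrable_finsetSum _ fun i _ => (hA.memLp_normSum hF m i (ℓ m)).integrable_sq).const_mul _
  refine tendstoInMeasure_of_integral (Eventually.of_forall hmeas)
    (Eventually.of_forall fun m => (hint m).sub (integrable_const _)) ?_
  set κ := min 1 (s - 2) with hκ
  have hκ0 : 0 < κ := lt_min one_pos (by linarith)
  have hκ1 : κ ≤ 1 := min_le_left _ _
  have hκs : 2 + κ ≤ s := by linarith [min_le_right 1 (s - 2)]
  -- choose the smoothing parameter first, then let the number of columns grow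
  rw [Metric.tendsto_atTop']
  intro ε hε
  have hu : ∃ u : ℝ, 0 < u ∧ u ≤ 1 ∧ 40 * (1 + C) ^ 2 * u ^ κ < ε := by
    have hc : Tendsto (fun u : ℝ => 40 * (1 + C) ^ 2 * u ^ κ) (𝓝[>] 0) (𝓝 0) := by
      have := ((Real.continuousAt_rpow_const 0 κ (Or.inr hκ0.le)).tendsto.const_mul
        (40 * (1 + C) ^ 2)).mono_left (nhdsWithin_le_nhds (s := Set.Ioi 0))
      simpa [Real.zero_rpow hκ0.ne'] using this
    obtain ⟨u, h1, h2, h3⟩ := ((hc.eventually_lt_const hε).and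
      (Ioc_mem_nhdsGT one_pos : Set.Ioc (0 : ℝ) 1 ∈ 𝓝[>] 0)).exists
    exact ⟨u, h2, h3, h1⟩
  obtain ⟨u, hu0, hu1, hue⟩ := hu
  have hlim : Tendsto (fun m => 40 * (1 + C) ^ 2 * (η m + u ^ κ)
      + 4 / u ^ 2 * √(8 * η m + 2 * ((ℓ m : ℝ) / ((m - ℓ m + 1 : ℕ) : ℝ)))) atTop
      (𝓝 (40 * (1 + C) ^ 2 * (0 + u ^ κ) + 4 / u ^ 2 * √(8 * 0 + 2 * 0))) :=
    ((hη0.add_const _).const_mul _).add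
      (((hη0.const_mul 8).add (hratio.const_mul 2)).sqrt.const_mul _)
  simp only [mul_zero, add_zero, zero_add, Real.sqrt_zero] at hlim
  have hfin : ∀ᶠ m in atTop, ∫ ω, |((m - ℓ m + 1 : ℕ) : ℝ)⁻¹ *
      ∑ i ∈ Finset.range (m - ℓ m + 1), normSum Y q F m i (ℓ m) ω ^ 2
        - scoreCov P Y F F| ∂P < ε := by
    filter_upwards [hlim.eventually_lt_const hue, hη0.eventually_le_const one_pos, hℓ]
      with m h1 h2 h3
    refine lt_of_le_of_lt ?_ h1
    have := (hA.isMixingSeq hF m).integral_abs_average_sq_sub_le hs hu0 hu1 hκ0.le hκ1 hκs h2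
      h3.1 (Nat.succ_pos (m - ℓ m))
    rwa [mul_div_assoc] at this
  obtain ⟨N, hN⟩ := eventually_atTop.1 hfin
  refine ⟨N, fun m hm => ?_⟩
  rw [Real.dist_eq, sub_zero, abs_of_nonneg (integral_nonneg fun _ => abs_nonneg _)]
  exact hN m hm.le

theorem tendstoInMeasure_average_mul (hA : IsGappedArray P p Y q s)
    (hF : IsCentredScore P Y s F) (hG : IsCentredScore P Y s G) {ℓ : ℕ → ℕ}
    (hℓ : ∀ᶠ m in atTop, 0 < ℓ m ∧ ℓ m ≤ m)
    (hℓm : Tendsto (fun m => (ℓ m : ℝ) / m) atTop (𝓝 0)) :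
    TendstoInMeasure P (fun m ω => ((m - ℓ m + 1 : ℕ) : ℝ)⁻¹ *
      ∑ i ∈ Finset.range (m - ℓ m + 1), normSum Y q F m i (ℓ m) ω * normSum Y q G m i (ℓ m) ω)
      atTop fun _ => scoreCov P Y F G := by
  rw [hF.scoreCov_polar hG hA.two_lt]
  have h := tendstoInMeasure_of_continuousAt (P := P) (κ := Bool)
    (f := fun b m ω => bif b then ((m - ℓ m + 1 : ℕ) : ℝ)⁻¹ *
      ∑ i ∈ Finset.range (m - ℓ m + 1), normSum Y q (fun x => F x + G x) m i (ℓ m) ω ^ 2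
      else ((m - ℓ m + 1 : ℕ) : ℝ)⁻¹ *
      ∑ i ∈ Finset.range (m - ℓ m + 1), normSum Y q (fun x => F x - G x) m i (ℓ m) ω ^ 2)
    (c := fun b => bif b then scoreCov P Y (fun x => F x + G x) (fun x => F x + G x)
      else scoreCov P Y (fun x => F x - G x) (fun x => F x - G x))
    (fun b => by
      cases b
      · exact hA.tendstoInMeasure_average_sq (hF.sub hG hA.two_lt) hℓ hℓm
      · exact hA.tendstoInMeasure_average_sq (hF.add hG hA.two_lt) hℓ hℓm)
    (F := fun x => (x true - x false) / 4) (by fun_prop)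
  refine h.congr_left fun m => Eventually.of_forall fun ω => ?_
  simp only [cond_true, cond_false, normSum_add, normSum_sub]
  rw [← mul_sub, ← Finset.sum_sub_distrib, mul_div_assoc, Finset.sum_div]
  congr 1
  exact Finset.sum_congr rfl fun i _ => by ring

end IsGappedArray

end Columns

/-! ### Square roots and correlations of moment matrices -/

section Roots

open Matrix

variable {r : ℕ} {A B : Matrix (Fin r) (Fin r) ℝ}

theorem continuousOn_spectrum (A : Matrix (Fin r) (Fin r) ℝ) (f : ℝ → ℝ) :
    ContinuousOn f (spectrum ℝ A) := A.finite_real_spectrum.continuousOn f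

theorem transpose_cfc (f : ℝ → ℝ) (A : Matrix (Fin r) (Fin r) ℝ) : (cfc f A)ᵀ = cfc f A := by
  have h : IsSelfAdjoint (cfc f A) := cfc_predicate f A
  have h2 := h.star_eq
  rwa [star_eq_conjTranspose, conjTranspose_eq_transpose_of_trivial] at h2

theorem transpose_matSqrt (A : Matrix (Fin r) (Fin r) ℝ) : (matSqrt A)ᵀ = matSqrt A :=
  transpose_cfc _ A

theorem transpose_matInvSqrt (A : Matrix (Fin r) (Fin r) ℝ) : (matInvSqrt A)ᵀ = matInvSqrt A :=
  transpose_cfc _ A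

theorem matSqrt_posSemidef (A : Matrix (Fin r) (Fin r) ℝ) : (matSqrt A).PosSemidef := by
  have h : matSqrt A = cfc (fun x => √√x) A * (cfc (fun x => √√x) A)ᴴ := by
    rw [conjTranspose_eq_transpose_of_trivial, transpose_cfc,
      ← cfc_mul (R := ℝ) _ _ A (continuousOn_spectrum A _) (continuousOn_spectrum A _)]
    exact cfc_congr fun x _ => (Real.mul_self_sqrt (Real.sqrt_nonneg x)).symm
  rw [h]
  exact posSemidef_self_mul_conjTranspose _

theorem matSqrt_smul {c : ℝ} (hc : 0 ≤ c) (hA : A.PosSemidef) :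
    matSqrt (c • A) = √c • matSqrt A := by
  have hA' : IsSelfAdjoint A := hA.1
  unfold matSqrt
  rw [← cfc_comp_const_mul c (fun x : ℝ => √x) A
    ((A.finite_real_spectrum.image _).continuousOn _) hA',
    ← cfc_const_mul _ _ A (continuousOn_spectrum A _)]
  exact cfc_congr fun x _ => Real.sqrt_mul hc x

/-- The orthogonal projection onto the range of a positive semidefinite matrix. -/
noncomputable def rangeProj (A : Matrix (Fin r) (Fin r) ℝ) : Matrix (Fin r) (Fin r) ℝ :=
  matSqrt A * matInvSqrt A

theorem rangeProj_eq_cfc (A : Matrix (Fin r) (Fin r) ℝ) :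
    rangeProj A = cfc (fun x : ℝ => √x * (√x)⁻¹) A :=
  (cfc_mul (R := ℝ) _ _ A (continuousOn_spectrum A _) (continuousOn_spectrum A _)).symm

theorem transpose_rangeProj (A : Matrix (Fin r) (Fin r) ℝ) : (rangeProj A)ᵀ = rangeProj A := by
  rw [rangeProj_eq_cfc, transpose_cfc]

theorem matInvSqrt_mul_matSqrt_eq (A : Matrix (Fin r) (Fin r) ℝ) :
    matInvSqrt A * matSqrt A = rangeProj A := by
  rw [← transpose_rangeProj, rangeProj, transpose_mul, transpose_matSqrt, transpose_matInvSqrt]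

theorem rangeProj_mul_self (A : Matrix (Fin r) (Fin r) ℝ) :
    rangeProj A * rangeProj A = rangeProj A := by
  rw [rangeProj_eq_cfc,
    ← cfc_mul (R := ℝ) _ _ A (continuousOn_spectrum A _) (continuousOn_spectrum A _)]
  refine cfc_congr fun x _ => ?_
  by_cases h : √x = 0
  · simp [h]
  · simp [h]

theorem rangeProj_mul_matSqrt (A : Matrix (Fin r) (Fin r) ℝ) :
    rangeProj A * matSqrt A = matSqrt A := by
  rw [rangeProj_eq_cfc, matSqrt,
    ← cfc_mul (R := ℝ) _ _ A (continuousOn_spectrum A _) (continuousOn_spectrum A _)]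
  refine cfc_congr fun x _ => ?_
  by_cases h : √x = 0
  · simp [h]
  · simp [h]

theorem rangeProj_mul (hA : A.PosSemidef) : rangeProj A * A = A := by
  nth_rw 2 [← matSqrt_mul_self hA]
  rw [← Matrix.mul_assoc, rangeProj_mul_matSqrt, matSqrt_mul_self hA]

theorem rangeProj_apply_self_le (A : Matrix (Fin r) (Fin r) ℝ) (a : Fin r) :
    rangeProj A a a ≤ 1 := by
  have h : ∑ c, rangeProj A a c ^ 2 = rangeProj A a a := by
    conv_rhs => rw [← rangeProj_mul_self, mul_apply]
    refine Finset.sum_congr rfl fun c _ => ?_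
    have : rangeProj A c a = rangeProj A a c := by
      rw [← transpose_apply (rangeProj A), transpose_rangeProj]
    rw [this, sq]
  have h2 : rangeProj A a a ^ 2 ≤ rangeProj A a a := by
    have := Finset.single_le_sum (f := fun c => rangeProj A a c ^ 2) (fun _ _ => sq_nonneg _)
      (Finset.mem_univ a)
    rwa [h] at this
  nlinarith

theorem sq_matSqrt_apply_le (hA : A.PosSemidef) (a b : Fin r) :
    matSqrt A a b ^ 2 ≤ A.trace := by
  have h : ∑ c, matSqrt A a c ^ 2 = A a a := by
    conv_rhs => rw [← matSqrt_mul_self hA, mul_apply]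
    refine Finset.sum_congr rfl fun c _ => ?_
    have : matSqrt A c a = matSqrt A a c := by
      rw [← transpose_apply (matSqrt A), transpose_matSqrt]
    rw [this, sq]
  calc matSqrt A a b ^ 2 ≤ ∑ c, matSqrt A a c ^ 2 :=
        Finset.single_le_sum (f := fun c => matSqrt A a c ^ 2) (fun _ _ => sq_nonneg _)
          (Finset.mem_univ b)
    _ = A a a := h
    _ ≤ A.trace := Finset.single_le_sum (f := fun c => A c c) (fun _ _ => hA.diag_nonneg)
          (Finset.mem_univ a)

/-- The sum of the absolute differences of the entries. -/
def entryDist (A B : Matrix (Fin r) (Fin r) ℝ) : ℝ := ∑ a, ∑ b, |A a b - B a b|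

theorem abs_dotProduct_mulVec_le (D : Matrix (Fin r) (Fin r) ℝ) {x : Fin r → ℝ}
    (hx : ∀ a, |x a| ≤ 1) : |x ⬝ᵥ D *ᵥ x| ≤ ∑ a, ∑ b, |D a b| := by
  simp only [dotProduct, mulVec, Finset.mul_sum]
  refine (Finset.abs_sum_le_sum_abs _ _).trans (Finset.sum_le_sum fun a _ =>
    (Finset.abs_sum_le_sum_abs _ _).trans (Finset.sum_le_sum fun b _ => ?_))
  rw [abs_mul, abs_mul]
  calc |x a| * (|D a b| * |x b|) ≤ 1 * (|D a b| * 1) := by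
        gcongr
        · exact hx a
        · exact hx b
    _ = _ := by ring

/-- An eigenvalue `μ` of `√A - √B` satisfies `μ² ≤ entryDist A B`: at a unit eigenvector the form of
`A - B` is `μ` times that of `√A + √B`, which is at least `|μ|`. -/
theorem sq_le_entryDist_of_eigenvector (hA : A.PosSemidef) (hB : B.PosSemidef) {x : Fin r → ℝ}
    (hx : x ⬝ᵥ x = 1) {μ : ℝ} (hμ : (matSqrt A - matSqrt B) *ᵥ x = μ • x) :
    μ ^ 2 ≤ entryDist A B := by
  set S := matSqrt A with hS
  set T := matSqrt B with hT
  have hs : 0 ≤ x ⬝ᵥ S *ᵥ x := by simpa using (matSqrt_posSemidef A).dotProduct_mulVec_nonneg x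
  have ht : 0 ≤ x ⬝ᵥ T *ᵥ x := by simpa using (matSqrt_posSemidef B).dotProduct_mulVec_nonneg x
  have hDt : (S - T)ᵀ = S - T := by rw [transpose_sub, hS, hT, transpose_matSqrt,
    transpose_matSqrt]
  have e1 : x ⬝ᵥ S *ᵥ x - x ⬝ᵥ T *ᵥ x = μ := by
    rw [← dotProduct_sub, ← sub_mulVec, hμ, dotProduct_smul, hx, smul_eq_mul, mul_one]
  have e2 : x ⬝ᵥ (A - B) *ᵥ x = μ * (x ⬝ᵥ S *ᵥ x + x ⬝ᵥ T *ᵥ x) := by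
    have : A - B = (S - T) * S + T * (S - T) := by
      rw [sub_mul, mul_sub, matSqrt_mul_self hA, matSqrt_mul_self hB]; abel
    rw [this, add_mulVec, dotProduct_add, ← mulVec_mulVec, ← mulVec_mulVec, hμ, mulVec_smul,
      dotProduct_smul, dotProduct_mulVec x (S - T), ← mulVec_transpose, hDt, hμ, smul_dotProduct]
    simp only [smul_eq_mul]; ring
  have hx1 : ∀ a, |x a| ≤ 1 := fun a => by
    rw [← sq_le_one_iff_abs_le_one, ← hx, dotProduct, sq]
    exact Finset.single_le_sum (f := fun a => x a * x a) (fun _ _ => mul_self_nonneg _)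
      (Finset.mem_univ a)
  have h := abs_dotProduct_mulVec_le (A - B) hx1
  rw [e2] at h
  have h2 : |μ| ≤ x ⬝ᵥ S *ᵥ x + x ⬝ᵥ T *ᵥ x := by
    rw [← e1, abs_le]; constructor <;> linarith
  calc μ ^ 2 = |μ| * |μ| := by rw [← sq, sq_abs]
    _ ≤ |μ| * (x ⬝ᵥ S *ᵥ x + x ⬝ᵥ T *ᵥ x) := mul_le_mul_of_nonneg_left h2 (abs_nonneg _)
    _ = |μ * (x ⬝ᵥ S *ᵥ x + x ⬝ᵥ T *ᵥ x)| := by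
        rw [abs_mul, abs_of_nonneg (add_nonneg hs ht)]
    _ ≤ _ := h

/-- The square root is Hölder continuous of order `1 / 2` on positive semidefinite matrices. -/
theorem sq_matSqrt_sub_apply_le (hA : A.PosSemidef) (hB : B.PosSemidef) (a b : Fin r) :
    (matSqrt A a b - matSqrt B a b) ^ 2 ≤ entryDist A B := by
  set D := matSqrt A - matSqrt B with hD
  have hDh : D.IsHermitian := (matSqrt_posSemidef A).1.sub (matSqrt_posSemidef B).1
  have hDt : Dᵀ = D := by rw [hD, transpose_sub, transpose_matSqrt, transpose_matSqrt]
  set v := hDh.eigenvectorBasis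
  set μ := hDh.eigenvalues
  have hv : ∀ i, D *ᵥ (v i : Fin r → ℝ) = μ i • (v i : Fin r → ℝ) :=
    hDh.mulVec_eigenvectorBasis
  have inner_eq : ∀ x y : Vec r, inner ℝ x y = (x : Fin r → ℝ) ⬝ᵥ (y : Fin r → ℝ) := fun x y => by
    rw [EuclideanSpace.inner_eq_star_dotProduct]; simp [dotProduct_comm]
  have hvv : ∀ i, (v i : Fin r → ℝ) ⬝ᵥ (v i : Fin r → ℝ) = 1 := fun i => by
    rw [← inner_eq, real_inner_self_eq_norm_sq, v.orthonormal.1 i, one_pow]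
  set e : Vec r := EuclideanSpace.single b 1 with he
  set w : Vec r := WithLp.toLp 2 (D *ᵥ (e : Fin r → ℝ)) with hw
  have hwi : ∀ i, inner ℝ (v i) w = μ i * inner ℝ (v i) e := fun i => by
    rw [inner_eq, inner_eq, hw]
    change _ ⬝ᵥ (D *ᵥ _) = _
    rw [dotProduct_mulVec, ← mulVec_transpose, hDt, hv, smul_dotProduct, smul_eq_mul]
  have hwa : w a = D a b := by
    rw [hw]; change (D *ᵥ (e : Fin r → ℝ)) a = _
    simp [he]
  have h1 : w a ^ 2 ≤ ‖w‖ ^ 2 := by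
    rw [EuclideanSpace.norm_sq_eq]
    simpa using Finset.single_le_sum (f := fun a => ‖w a‖ ^ 2) (fun _ _ => sq_nonneg _)
      (Finset.mem_univ a)
  rw [← Matrix.sub_apply, ← hD, ← hwa]
  refine h1.trans ?_
  calc ‖w‖ ^ 2 = ∑ i, ‖inner ℝ (v i) w‖ ^ 2 := (v.sum_sq_norm_inner_right w).symm
    _ ≤ ∑ i, entryDist A B * ‖inner ℝ (v i) e‖ ^ 2 := by
        refine Finset.sum_le_sum fun i _ => ?_
        rw [hwi, norm_mul, mul_pow, Real.norm_eq_abs, sq_abs]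
        exact mul_le_mul_of_nonneg_right
          (sq_le_entryDist_of_eigenvector hA hB (hvv i) (hv i)) (sq_nonneg _)
    _ = entryDist A B := by
        rw [← Finset.mul_sum, v.sum_sq_norm_inner_right, he]; simp

theorem abs_mul_mul_apply_le {U R V : Matrix (Fin r) (Fin r) ℝ} {κ τ : ℝ}
    (hU : ∀ a b, |U a b| ≤ κ) (hR : ∀ a b, |R a b| ≤ 1) (hV : ∀ a b, |V a b| ≤ τ) (a b : Fin r) :
    |(U * R * V) a b| ≤ r ^ 2 * (κ * τ) := by
  have hκ : 0 ≤ κ := (abs_nonneg _).trans (hU a b)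
  simp only [mul_apply, Finset.sum_mul]
  calc _ ≤ ∑ c : Fin r, ∑ e : Fin r, |U a e * R e c * V c b| :=
        (Finset.abs_sum_le_sum_abs _ _).trans
          (Finset.sum_le_sum fun c _ => Finset.abs_sum_le_sum_abs _ _)
    _ ≤ ∑ c : Fin r, ∑ e : Fin r, κ * 1 * τ := by
        refine Finset.sum_le_sum fun c _ => Finset.sum_le_sum fun e _ => ?_
        rw [abs_mul, abs_mul]
        gcongr
        · exact hU a e
        · exact hR e c
        · exact hV c b
    _ = _ := by simp; ring

end Roots

section Moments

open Matrix

variable {r : ℕ} {ι : Type*} {S : Finset ι} {c : ℝ} {u v : ι → Fin r → ℝ}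

/-- The product moment matrix `c ∑ᵢ uᵢ vᵢ'`. -/
def crossMoment (S : Finset ι) (c : ℝ) (u v : ι → Fin r → ℝ) : Matrix (Fin r) (Fin r) ℝ :=
  Matrix.of fun a b => c * ∑ i ∈ S, u i a * v i b

theorem transpose_crossMoment : (crossMoment S c u v)ᵀ = crossMoment S c v u := by
  ext a b
  simp [crossMoment, mul_comm]

theorem dotProduct_crossMoment (x y : Fin r → ℝ) :
    x ⬝ᵥ crossMoment S c u v *ᵥ y = c * ∑ i ∈ S, (x ⬝ᵥ u i) * (v i ⬝ᵥ y) := by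
  have h : ∀ i, (x ⬝ᵥ u i) * (v i ⬝ᵥ y) = ∑ a, ∑ b, x a * (u i a * v i b * y b) := fun i => by
    simp only [dotProduct, Finset.sum_mul_sum]
    exact Finset.sum_congr rfl fun a _ => Finset.sum_congr rfl fun b _ => by ring
  simp_rw [h]
  rw [Finset.sum_comm (s := S)]
  simp_rw [Finset.sum_comm (s := S)]
  simp only [dotProduct, mulVec, crossMoment, of_apply, Finset.mul_sum, Finset.sum_mul]
  exact Finset.sum_congr rfl fun a _ => Finset.sum_congr rfl fun b _ =>
    Finset.sum_congr rfl fun i _ => by ring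

theorem crossMoment_posSemidef (hc : 0 ≤ c) : (crossMoment S c u u).PosSemidef := by
  refine .of_dotProduct_mulVec_nonneg ?_ fun x => ?_
  · rw [IsHermitian, conjTranspose_eq_transpose_of_trivial, transpose_crossMoment]
  · rw [star_trivial, dotProduct_crossMoment]
    refine mul_nonneg hc (Finset.sum_nonneg fun i _ => ?_)
    rw [dotProduct_comm (u i)]; exact mul_self_nonneg _

/-- The Cauchy-Schwarz inequality for product moments. -/
theorem sq_dotProduct_crossMoment_le (x y : Fin r → ℝ) :
    (x ⬝ᵥ crossMoment S c u v *ᵥ y) ^ 2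
      ≤ (x ⬝ᵥ crossMoment S c u u *ᵥ x) * (y ⬝ᵥ crossMoment S c v v *ᵥ y) := by
  simp only [dotProduct_crossMoment]
  have h := Finset.sum_mul_sq_le_sq_mul_sq S (fun i => x ⬝ᵥ u i) (fun i => v i ⬝ᵥ y)
  have e1 : ∀ i, (x ⬝ᵥ u i) * (u i ⬝ᵥ x) = (x ⬝ᵥ u i) ^ 2 := fun i => by
    rw [dotProduct_comm (u i), sq]
  have e2 : ∀ i, (y ⬝ᵥ v i) * (v i ⬝ᵥ y) = (v i ⬝ᵥ y) ^ 2 := fun i => by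
    rw [dotProduct_comm y, sq]
  simp only [e1, e2, mul_pow]
  have := mul_le_mul_of_nonneg_left h (sq_nonneg c)
  linarith

theorem mul_mul_apply_eq (U M V : Matrix (Fin r) (Fin r) ℝ) (a b : Fin r) :
    (U * M * V) a b = U a ⬝ᵥ M *ᵥ (fun e => V e b) := by
  rw [Matrix.mul_assoc, mul_apply]
  rfl

/-- By the Cauchy-Schwarz inequality a product moment matrix has its range in that of the moment
matrix of its left factor, so the pseudo-inverse loses nothing. -/
theorem rangeProj_mul_crossMoment (hc : 0 ≤ c) :
    rangeProj (crossMoment S c u u) * crossMoment S c u v = crossMoment S c u v := by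
  set M := crossMoment S c u u with hM
  have hMp : M.PosSemidef := crossMoment_posSemidef hc
  set Q := 1 - rangeProj M with hQ
  have hQM : Q * M = 0 := by rw [hQ, sub_mul, one_mul, rangeProj_mul hMp, sub_self]
  have hQt : Qᵀ = Q := by rw [hQ, transpose_sub, transpose_one, transpose_rangeProj]
  have h : Q * crossMoment S c u v = 0 := by
    ext a b
    have h1 := sq_dotProduct_crossMoment_le (S := S) (c := c) (u := u) (v := v) (Q a)
      (fun e => (1 : Matrix (Fin r) (Fin r) ℝ) e b)
    have h2 : Q a = fun e => Q e a := by
      ext e; rw [← transpose_apply Q, hQt]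
    have h3 : Q a ⬝ᵥ M *ᵥ Q a = 0 := by
      nth_rw 2 [h2]
      rw [← mul_mul_apply_eq, hQM, zero_mul]; rfl
    rw [← hM, h3, zero_mul, ← mul_mul_apply_eq, mul_one] at h1
    exact pow_eq_zero_iff two_ne_zero |>.1 (le_antisymm h1 (sq_nonneg _))
  rw [hQ, sub_mul, one_mul, sub_eq_zero] at h
  exact h.symm

theorem crossMoment_mul_rangeProj (hc : 0 ≤ c) :
    crossMoment S c u v * rangeProj (crossMoment S c v v) = crossMoment S c u v := by
  rw [← transpose_crossMoment (u := v), ← transpose_rangeProj, ← transpose_mul,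
    rangeProj_mul_crossMoment hc]

/-- The correlation matrix of a product moment matrix. For singular moment matrices the inverse
square roots are Moore-Penrose inverses. -/
noncomputable def crossCorr (S : Finset ι) (c : ℝ) (u v : ι → Fin r → ℝ) :
    Matrix (Fin r) (Fin r) ℝ :=
  matInvSqrt (crossMoment S c u u) * crossMoment S c u v * matInvSqrt (crossMoment S c v v)

theorem matSqrt_mul_crossCorr_mul_matSqrt (hc : 0 ≤ c) :
    matSqrt (crossMoment S c u u) * crossCorr S c u v * matSqrt (crossMoment S c v v)
      = crossMoment S c u v := by
  have h : matSqrt (crossMoment S c u u) * crossCorr S c u v * matSqrt (crossMoment S c v v)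
      = rangeProj (crossMoment S c u u) * crossMoment S c u v
        * (matInvSqrt (crossMoment S c v v) * matSqrt (crossMoment S c v v)) := by
    simp only [crossCorr, rangeProj, Matrix.mul_assoc]
  rw [h, matInvSqrt_mul_matSqrt_eq, rangeProj_mul_crossMoment hc, crossMoment_mul_rangeProj hc]

theorem matInvSqrt_row_dotProduct_le {A : Matrix (Fin r) (Fin r) ℝ} (hA : A.PosSemidef)
    (a : Fin r) : (matInvSqrt A a) ⬝ᵥ A *ᵥ (fun e => matInvSqrt A e a) ≤ 1 := by
  have h : matInvSqrt A * A * matInvSqrt A = rangeProj A := by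
    nth_rw 2 [← matSqrt_mul_self hA]
    rw [← Matrix.mul_assoc, matInvSqrt_mul_matSqrt_eq, Matrix.mul_assoc]
    exact rangeProj_mul_self A
  rw [← mul_mul_apply_eq, h]
  exact rangeProj_apply_self_le A a

/-- Correlations are at most one, by the Cauchy-Schwarz inequality; this holds for singular moment
matrices too. -/
theorem abs_crossCorr_apply_le (hc : 0 ≤ c) (a b : Fin r) : |crossCorr S c u v a b| ≤ 1 := by
  have hsym : ∀ (A : Matrix (Fin r) (Fin r) ℝ) a, (fun e => matInvSqrt A e a) = matInvSqrt A a :=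
    fun A a => by ext e; rw [← transpose_apply (matInvSqrt A), transpose_matInvSqrt]
  rw [← sq_le_one_iff_abs_le_one, crossCorr, mul_mul_apply_eq]
  refine (sq_dotProduct_crossMoment_le _ _).trans (mul_le_one₀ ?_ ?_ ?_)
  · nth_rw 2 [← hsym]
    exact matInvSqrt_row_dotProduct_le (crossMoment_posSemidef hc) a
  · simpa using (crossMoment_posSemidef (S := S) (u := v) hc).dotProduct_mulVec_nonneg _
  · nth_rw 1 [hsym]
    exact matInvSqrt_row_dotProduct_le (crossMoment_posSemidef hc) b

/-- Replacing the scale matrices of a product moment matrix by nearby ones changes it little. Since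
the correlations are bounded, the scale matrices may be singular. -/
theorem abs_smul_corr_sub_apply_le (hc : 0 ≤ c) {A B : Matrix (Fin r) (Fin r) ℝ}
    (hA : A.PosSemidef) (hB : B.PosSemidef) {x y : ℝ} (hx : 0 ≤ x) (hy : 0 ≤ y) (a b : Fin r) :
    |(x • (matSqrt A * crossCorr S c u v * matSqrt B) - y • crossMoment S c u v) a b|
      ≤ r ^ 2 * (√(entryDist (x • A) (y • crossMoment S c u u)) * √((x • B).trace)
        + √((y • crossMoment S c u u).trace)
          * √(entryDist (x • B) (y • crossMoment S c v v))) := by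
  set R := crossCorr S c u v with hR
  set M := crossMoment S c u u
  set N := crossMoment S c v v
  have hM : M.PosSemidef := crossMoment_posSemidef hc
  have hN : N.PosSemidef := crossMoment_posSemidef hc
  have hxA := hA.smul hx
  have hxB := hB.smul hx
  have hyM := hM.smul hy
  have hyN := hN.smul hy
  have hR1 : ∀ a b, |R a b| ≤ 1 := abs_crossCorr_apply_le hc
  have e1 : x • (matSqrt A * R * matSqrt B) = matSqrt (x • A) * R * matSqrt (x • B) := by
    rw [matSqrt_smul hx hA, matSqrt_smul hx hB, smul_mul_assoc, smul_mul_assoc, mul_smul_comm,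
      smul_smul, Real.mul_self_sqrt hx]
  have e2 : y • crossMoment S c u v = matSqrt (y • M) * R * matSqrt (y • N) := by
    rw [matSqrt_smul hy hM, matSqrt_smul hy hN, smul_mul_assoc, smul_mul_assoc, mul_smul_comm,
      smul_smul, Real.mul_self_sqrt hy, matSqrt_mul_crossCorr_mul_matSqrt hc]
  have e3 : matSqrt (x • A) * R * matSqrt (x • B) - matSqrt (y • M) * R * matSqrt (y • N)
      = (matSqrt (x • A) - matSqrt (y • M)) * R * matSqrt (x • B)
        + matSqrt (y • M) * R * (matSqrt (x • B) - matSqrt (y • N)) := by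
    simp only [Matrix.sub_mul, Matrix.mul_sub]; abel
  rw [e1, e2, e3, Matrix.add_apply, mul_add]
  refine (abs_add_le _ _).trans (add_le_add ?_ ?_)
  · exact abs_mul_mul_apply_le
      (fun a b => Real.abs_le_sqrt (sq_matSqrt_sub_apply_le hxA hyM a b)) hR1
      (fun a b => Real.abs_le_sqrt (sq_matSqrt_apply_le hxB a b)) a b
  · exact abs_mul_mul_apply_le
      (fun a b => Real.abs_le_sqrt (sq_matSqrt_apply_le hyM a b)) hR1
      (fun a b => Real.abs_le_sqrt (sq_matSqrt_sub_apply_le hxB hyN a b)) a b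

end Moments

/-! ### Moments of the i.i.d. bootstrap -/

section Bootstrap

variable {N : ℕ}

theorem bootMean_const (c : ℝ) : bootMean (fun _ : Fin N → Fin N => c) = c := by
  have h : ((N : ℝ) ^ N) ≠ 0 := by
    rcases N.eq_zero_or_pos with rfl | h
    · simp
    · positivity
  simp [bootMean, h]

theorem bootMean_add (f g : (Fin N → Fin N) → ℝ) :
    bootMean (fun σ => f σ + g σ) = bootMean f + bootMean g := by
  simp only [bootMean, Finset.sum_add_distrib, mul_add]

theorem bootMean_sub (f g : (Fin N → Fin N) → ℝ) :
    bootMean (fun σ => f σ - g σ) = bootMean f - bootMean g := by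
  simp only [bootMean, Finset.sum_sub_distrib, mul_sub]

theorem bootMean_const_mul (c : ℝ) (f : (Fin N → Fin N) → ℝ) :
    bootMean (fun σ => c * f σ) = c * bootMean f := by
  simp only [bootMean, ← Finset.mul_sum]; ring

theorem bootMean_sum {ι : Type*} (s : Finset ι) (f : ι → (Fin N → Fin N) → ℝ) :
    bootMean (fun σ => ∑ i ∈ s, f i σ) = ∑ i ∈ s, bootMean (f i) := by
  simp only [bootMean, Finset.mul_sum]
  exact Finset.sum_comm

theorem bootMean_mono {f g : (Fin N → Fin N) → ℝ} (h : ∀ σ, f σ ≤ g σ) :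
    bootMean f ≤ bootMean g :=
  mul_le_mul_of_nonneg_left (Finset.sum_le_sum fun σ _ => h σ) (by positivity)

/-- Independence of the components of the resampled index vector. -/
theorem bootMean_prod (φ : Fin N → Fin N → ℝ) :
    bootMean (fun σ => ∏ s, φ s (σ s)) = ∏ s, ((N : ℝ)⁻¹ * ∑ i, φ s i) := by
  rw [Finset.prod_mul_distrib, Finset.prod_univ_sum, Fintype.piFinset_univ]
  simp [bootMean]

theorem bootMean_apply (g : Fin N → ℝ) (s : Fin N) :
    bootMean (fun σ => g (σ s)) = (N : ℝ)⁻¹ * ∑ i, g i := by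
  have hN : (N : ℝ) ≠ 0 := by have := s.pos; positivity
  have h := bootMean_prod fun t i => if t = s then g i else 1
  rw [Finset.prod_eq_single s (fun t _ ht => by simp [ht, hN]) (by simp)] at h
  simpa using h

theorem bootMean_apply_mul_apply (g h : Fin N → ℝ) {s t : Fin N} (hst : s ≠ t) :
    bootMean (fun σ => g (σ s) * h (σ t))
      = ((N : ℝ)⁻¹ * ∑ i, g i) * ((N : ℝ)⁻¹ * ∑ i, h i) := by
  have hN : (N : ℝ) ≠ 0 := by have := s.pos; positivity
  have e := bootMean_prod fun k i => if k = s then g i else if k = t then h i else 1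
  rw [Finset.prod_eq_mul s t hst (fun k _ hk => by simp [hk.1, hk.2, hN]) (by simp)
    (by simp)] at e
  have e2 : ∀ σ : Fin N → Fin N,
      (∏ k, if k = s then g (σ k) else if k = t then h (σ k) else 1) = g (σ s) * h (σ t) :=
    fun σ => by
      rw [Finset.prod_eq_mul s t hst (fun k _ hk => by simp [hk.1, hk.2]) (by simp) (by simp)]
      simp [hst.symm]
  simpa [e2, hst.symm] using e

theorem bootMean_average (g : Fin N → ℝ) (hN : 0 < N) :
    bootMean (fun σ => (N : ℝ)⁻¹ * ∑ s, g (σ s)) = (N : ℝ)⁻¹ * ∑ i, g i := by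
  have hN0 : (N : ℝ) ≠ 0 := by positivity
  rw [bootMean_const_mul, bootMean_sum]
  simp only [bootMean_apply, Finset.sum_const, Finset.card_univ, Fintype.card_fin, nsmul_eq_mul]
  field_simp

/-- The bootstrap covariance of two averages is the sample covariance, divided by the sample
size. -/
theorem bootMean_average_cov (g h : Fin N → ℝ) (hN : 0 < N) :
    N * bootMean (fun σ =>
      ((N : ℝ)⁻¹ * ∑ s, g (σ s) - bootMean fun τ => (N : ℝ)⁻¹ * ∑ s, g (τ s)) *
      ((N : ℝ)⁻¹ * ∑ s, h (σ s) - bootMean fun τ => (N : ℝ)⁻¹ * ∑ s, h (τ s)))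
      = (N : ℝ)⁻¹ * ∑ i, g i * h i - ((N : ℝ)⁻¹ * ∑ i, g i) * ((N : ℝ)⁻¹ * ∑ i, h i) := by
  have hN0 : (N : ℝ) ≠ 0 := by positivity
  rw [bootMean_average g hN, bootMean_average h hN]
  set x := (N : ℝ)⁻¹ * ∑ i, g i with hx
  set y := (N : ℝ)⁻¹ * ∑ i, h i with hy
  have hgx : ∑ i, g i = N * x := by rw [hx]; field_simp
  have hhy : ∑ i, h i = N * y := by rw [hy]; field_simp
  have hcent : ∀ (f : Fin N → ℝ) (z : ℝ) (σ : Fin N → Fin N),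
      (N : ℝ)⁻¹ * ∑ s, f (σ s) - z = (N : ℝ)⁻¹ * ∑ s, (f (σ s) - z) := fun f z σ => by
    rw [Finset.sum_sub_distrib, mul_sub]; simp [hN0]
  have hexp : ∀ σ : Fin N → Fin N, ((N : ℝ)⁻¹ * ∑ s, g (σ s) - x) * ((N : ℝ)⁻¹ * ∑ s, h (σ s) - y)
      = ((N : ℝ)⁻¹) ^ 2 * ∑ s, ∑ t, (g (σ s) - x) * (h (σ t) - y) := fun σ => by
    rw [hcent, hcent, ← Finset.sum_mul_sum]; ring
  have hst : ∀ s t : Fin N, bootMean (fun σ => (g (σ s) - x) * (h (σ t) - y))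
      = if s = t then (N : ℝ)⁻¹ * ∑ i, (g i - x) * (h i - y) else 0 := fun s t => by
    split_ifs with hs
    · subst hs
      exact bootMean_apply (fun i => (g i - x) * (h i - y)) s
    · rw [bootMean_apply_mul_apply (fun i => g i - x) (fun i => h i - y) hs,
        Finset.sum_sub_distrib, hgx]
      simp
  simp_rw [hexp]
  rw [bootMean_const_mul, bootMean_sum]
  simp_rw [bootMean_sum, hst]
  simp only [Finset.sum_ite_eq, Finset.mem_univ, if_true, Finset.sum_const, Finset.card_univ,
    Fintype.card_fin, nsmul_eq_mul]
  have e : ∑ i, (g i - x) * (h i - y) = ∑ i, g i * h i - N * (x * y) := by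
    have : ∀ i, (g i - x) * (h i - y) = g i * h i - g i * y - x * h i + x * y := fun i => by ring
    simp_rw [this]
    rw [Finset.sum_add_distrib, Finset.sum_sub_distrib, Finset.sum_sub_distrib, ← Finset.sum_mul,
      ← Finset.mul_sum, hgx, hhy]
    simp; ring
  rw [e]; field_simp

theorem bootMean_sq_sub_le (R : (Fin N → Fin N) → ℝ) :
    bootMean (fun σ => (R σ - bootMean R) ^ 2) ≤ bootMean fun σ => R σ ^ 2 := by
  set z := bootMean R with hz
  have e : ∀ σ, (R σ - z) ^ 2 = R σ ^ 2 - (2 * z) * R σ + z ^ 2 := fun σ => by ring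
  simp_rw [e]
  rw [bootMean_add, bootMean_sub, bootMean_const_mul, bootMean_const, ← hz]
  nlinarith [sq_nonneg z]

/-- The bootstrap variance is a moment matrix over all resampled index vectors. -/
theorem bootVar_eq_crossMoment {r : ℕ} (f : (Fin N → Fin N) → Vec r) :
    bootVar f = crossMoment Finset.univ ((N : ℝ) ^ N)⁻¹
      (fun σ a => f σ a - bootMean fun τ => f τ a) (fun σ a => f σ a - bootMean fun τ => f τ a) :=
  rfl

theorem bootVar_posSemidef {r : ℕ} (f : (Fin N → Fin N) → Vec r) : (bootVar f).PosSemidef := by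
  rw [bootVar_eq_crossMoment]
  exact crossMoment_posSemidef (by positivity)

end Bootstrap

/-! ### Perturbation of averaged products -/

section Perturbation

variable {ι : Type*} {S : Finset ι} {c : ℝ}

theorem abs_average_mul_le (hc : 0 ≤ c) (f g : ι → ℝ) :
    |c * ∑ i ∈ S, f i * g i| ≤ √(c * ∑ i ∈ S, f i ^ 2) * √(c * ∑ i ∈ S, g i ^ 2) := by
  rw [← Real.sqrt_mul (mul_nonneg hc (Finset.sum_nonneg fun _ _ => sq_nonneg _))]
  refine Real.abs_le_sqrt ?_
  have := mul_le_mul_of_nonneg_left (Finset.sum_mul_sq_le_sq_mul_sq S f g) (sq_nonneg c)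
  linarith

/-- Averaged products are stable under perturbations of the factors that are small in mean
square. -/
theorem abs_average_mul_sub_le (hc : 0 ≤ c) (u v x y : ι → ℝ) :
    |c * ∑ i ∈ S, u i * v i - c * ∑ i ∈ S, x i * y i|
      ≤ √(c * ∑ i ∈ S, (u i - x i) ^ 2) * √(c * ∑ i ∈ S, y i ^ 2)
        + √(c * ∑ i ∈ S, x i ^ 2) * √(c * ∑ i ∈ S, (v i - y i) ^ 2)
        + √(c * ∑ i ∈ S, (u i - x i) ^ 2) * √(c * ∑ i ∈ S, (v i - y i) ^ 2) := by
  have e : c * ∑ i ∈ S, u i * v i - c * ∑ i ∈ S, x i * y i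
      = c * ∑ i ∈ S, (u i - x i) * y i + c * ∑ i ∈ S, x i * (v i - y i)
        + c * ∑ i ∈ S, (u i - x i) * (v i - y i) := by
    rw [← mul_add, ← mul_add, ← mul_sub, ← Finset.sum_add_distrib, ← Finset.sum_add_distrib,
      ← Finset.sum_sub_distrib]
    congr 1
    exact Finset.sum_congr rfl fun i _ => by ring
  rw [e]
  exact (abs_add_le _ _).trans (add_le_add ((abs_add_le _ _).trans
    (add_le_add (abs_average_mul_le hc _ _) (abs_average_mul_le hc _ _)))
    (abs_average_mul_le hc _ _))

/-- The error bound of `abs_average_mul_sub_le` tends to zero if the mean squares of the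
perturbations do, and those of the unperturbed factors converge. -/
theorem tendstoInMeasure_of_abs_sub_le_sqrt {Ω : Type*} [MeasurableSpace Ω] {P : Measure Ω}
    {f g X Y E F : ℕ → Ω → ℝ} {γ ξ υ : ℝ} (hg : TendstoInMeasure P g atTop fun _ => γ)
    (hX : TendstoInMeasure P X atTop fun _ => ξ) (hY : TendstoInMeasure P Y atTop fun _ => υ)
    (hE : TendstoInMeasure P E atTop fun _ => 0) (hF : TendstoInMeasure P F atTop fun _ => 0)
    (h : ∀ᶠ m in atTop, ∀ ω, |f m ω - g m ω| ≤ √(E m ω) * √(Y m ω) + √(X m ω) * √(F m ω)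
      + √(E m ω) * √(F m ω)) :
    TendstoInMeasure P f atTop fun _ => γ := by
  have hb := tendstoInMeasure_of_continuousAt (P := P) (f := ![g, X, Y, E, F])
    (c := ![γ, ξ, υ, 0, 0]) (fun k => by fin_cases k <;> assumption)
    (F := fun x : Fin 5 → ℝ => |x 0 - γ| + (√(x 3) * √(x 2) + √(x 1) * √(x 4) + √(x 3) * √(x 4)))
    (Continuous.continuousAt (by fun_prop))
  simp at hb
  refine tendstoInMeasure_of_abs_sub_le (h.mono fun m hm ω => ?_) hb
  calc |f m ω - γ| ≤ |f m ω - g m ω| + |g m ω - γ| := abs_sub_le _ _ _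
    _ ≤ _ := by rw [add_comm]; exact add_le_add le_rfl (hm ω)

end Perturbation

/-! ### Bootstrap variances and window moments of asymptotically linear estimators -/

section Rows

variable {Ω : Type*} {d r p : ℕ} {Y : ℤ → Ω → Vec d} {q : ℕ → ℕ}

/-- Component `a` of the influence function of row `j`, as a function of the columns. -/
def rowScore (ψ : Fin p → Vec d → Vec r) (j : Fin p) (a : Fin r) (x : Fin p → Vec d) : ℝ :=
  ψ j (x j) a

theorem avg_apply {N : ℕ} (φ : Vec d → Vec r) (x : Fin N → Vec d) (a : Fin r) :
    avg φ x a = (N : ℝ)⁻¹ * ∑ s, φ (x s) a := by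
  simp [avg]

theorem sqrt_mul_avg (ψ : Fin p → Vec d → Vec r) (j : Fin p) (a : Fin r) (m i n : ℕ) (ω : Ω) :
    √n * avg (ψ j) (rowData Y (q m) j i n ω) a = normSum Y q (rowScore ψ j a) m i n ω := by
  rw [avg_apply, normSum, windowSum, ← mul_assoc, Finset.sum_range]
  congr 1
  rcases n.eq_zero_or_pos with rfl | hn
  · simp
  · have h : (0 : ℝ) < n := by exact_mod_cast hn
    have h2 := Real.mul_self_sqrt h.le
    have h3 := (Real.sqrt_pos.2 h).ne'
    field_simp
    rw [sq, h2]

theorem score_rowScore (ψ : Fin p → Vec d → Vec r) (j : Fin p) (a : Fin r) (m i : ℕ) (ω : Ω) :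
    score Y q (rowScore ψ j a) m i ω = ψ j (obs Y (q m) i j ω) a := rfl

variable [MeasurableSpace Ω] {P : Measure Ω}

theorem measurable_apply_vec (a : Fin r) : Measurable fun x : Vec r => x a :=
  (EuclideanSpace.proj (𝕜 := ℝ) a).continuous.measurable

theorem isCentredScore_rowScore [IsProbabilityMeasure P] (hY : ∀ t, Measurable (Y t))
    {ψ : Fin p → Vec d → Vec r} (hψ : ∀ j, Measurable (ψ j)) {C s : ℝ} (hs : 2 < s)
    (hmean : ∀ j : Fin p, ∫ ω, ψ j (Y ((j : ℤ) + 1) ω) ∂P = 0)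
    (hmom : ∀ j : Fin p, ∫⁻ ω, ‖ψ j (Y ((j : ℤ) + 1) ω)‖ₑ ^ s ∂P < ENNReal.ofReal C)
    (j : Fin p) (a : Fin r) : IsCentredScore P Y s (rowScore ψ j a) := by
  have hs0 : 0 < s := two_pos.trans hs
  have hV : MemLp (fun ω => ψ j (Y ((j : ℤ) + 1) ω)) (ENNReal.ofReal s) P := by
    refine ⟨((hψ j).comp (hY _)).aestronglyMeasurable, ?_⟩
    rw [eLpNorm_lt_top_iff_lintegral_rpow_enorm_lt_top (by simpa using hs0) ENNReal.ofReal_ne_top,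
      ENNReal.toReal_ofReal hs0.le]
    exact (hmom j).trans ENNReal.ofReal_lt_top
  have hVi : Integrable (fun ω => ψ j (Y ((j : ℤ) + 1) ω)) P := hV.integrable (by
    rw [← ENNReal.ofReal_one]; exact ENNReal.ofReal_le_ofReal (by linarith))
  refine ⟨(measurable_apply_vec a).comp ((hψ j).comp (measurable_pi_apply j)), ?_, ?_⟩
  · exact hV.of_le ((measurable_apply_vec a).comp ((hψ j).comp (hY _))).aestronglyMeasurable
      (Eventually.of_forall fun ω => PiLp.norm_apply_le _ a)
  · have := (EuclideanSpace.proj (𝕜 := ℝ) a).integral_comp_comm hVi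
    rw [hmean, map_zero] at this
    exact this

theorem measurable_rowData (hY : ∀ t, Measurable (Y t)) (q' : ℕ) (j : Fin p) (i N : ℕ) :
    Measurable (rowData Y q' j i N) :=
  measurable_pi_lambda _ fun _ => hY _

theorem measurable_avg {N : ℕ} {φ : Vec d → Vec r} (hφ : Measurable φ) :
    Measurable (avg (N := N) φ) :=
  Measurable.const_smul (g := fun x : Fin N → Vec d => ∑ s, φ (x s))
    (Finset.measurable_sum _ fun s _ => hφ.comp (measurable_pi_apply s)) (N : ℝ)⁻¹

theorem IsGappedArray.tendstoInMeasure_mean [IsProbabilityMeasure P] {s : ℝ}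
    {F : (Fin p → Vec d) → ℝ} (hA : IsGappedArray P p Y q s) (hF : IsCentredScore P Y s F)
    {ρ : ℕ → ℝ} (hρ : Tendsto ρ atTop (𝓝 0)) :
    TendstoInMeasure P (fun (m : ℕ) ω => ρ m * normSum Y q F m 0 m ω) atTop fun _ => 0 := by
  have h2 : TendstoInMeasure P (fun (m : ℕ) ω => (ρ m * normSum Y q F m 0 m ω) ^ 2) atTop
      fun _ => 0 := by
    refine tendstoInMeasure_of_integral
      (Eventually.of_forall fun m => ((hA.measurable_normSum hF m 0 m).const_mul _).pow_const 2)
      (Eventually.of_forall fun m => ?_) ?_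
    · simpa using ((hA.memLp_normSum hF m 0 m).const_mul (ρ m)).integrable_sq
    · have h := (hρ.pow 2).mul (hA.tendsto_integral_normSum_sq hF)
      simp only [ne_eq, OfNat.ofNat_ne_zero, not_false_eq_true, zero_pow, zero_mul] at h
      refine h.congr fun m => ?_
      rw [← integral_const_mul]
      simp only [sub_zero, mul_pow]
      exact integral_congr_ae (Eventually.of_forall fun ω =>
        (abs_of_nonneg (mul_nonneg (sq_nonneg _) (sq_nonneg _))).symm)
  have h3 := tendstoInMeasure_of_continuousAt (P := P) (κ := Unit) (fun _ => h2)
    (F := fun x => √(x ())) (Continuous.continuousAt (by fun_prop))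
  simp only [Real.sqrt_zero, Real.sqrt_sq_eq_abs] at h3
  exact tendstoInMeasure_of_abs_sub_le (Eventually.of_forall fun (m : ℕ) ω => by rw [sub_zero]) h3

/-- The sample covariance of two scores is consistent. -/
theorem IsGappedArray.tendstoInMeasure_sampleCov [IsProbabilityMeasure P] {s : ℝ}
    {F G : (Fin p → Vec d) → ℝ} (hA : IsGappedArray P p Y q s) (hF : IsCentredScore P Y s F)
    (hG : IsCentredScore P Y s G) :
    TendstoInMeasure P (fun (m : ℕ) ω =>
      (m : ℝ)⁻¹ * ∑ i : Fin m, score Y q F m i ω * score Y q G m i ω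
        - ((m : ℝ)⁻¹ * ∑ i : Fin m, score Y q F m i ω)
          * ((m : ℝ)⁻¹ * ∑ i : Fin m, score Y q G m i ω)) atTop fun _ => scoreCov P Y F G := by
  have hinv : Tendsto (fun m : ℕ => (√m)⁻¹) atTop (𝓝 0) :=
    tendsto_inv_atTop_zero.comp (Real.tendsto_sqrt_atTop.comp tendsto_natCast_atTop_atTop)
  have hone : Tendsto (fun m : ℕ => ((1 : ℕ) : ℝ) / m) atTop (𝓝 0) := by
    simpa using tendsto_one_div_atTop_nhds_zero_nat (𝕜 := ℝ)
  have h1 := hA.tendstoInMeasure_average_mul hF hG (ℓ := fun _ => 1)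
    ((eventually_gt_atTop 0).mono fun m hm => ⟨one_pos, hm⟩) hone
  have h2 := hA.tendstoInMeasure_mean hF hinv
  have h3 := hA.tendstoInMeasure_mean hG hinv
  have h := tendstoInMeasure_of_continuousAt (P := P) (f := ![_, _, _])
    (c := ![scoreCov P Y F G, 0, 0]) (fun k => by
      fin_cases k
      · exact h1
      · exact h2
      · exact h3)
    (F := fun x : Fin 3 → ℝ => x 0 - x 1 * x 2) (Continuous.continuousAt (by fun_prop))
  simp only [Matrix.cons_val, mul_zero, sub_zero] at h
  have hw : ∀ (H : (Fin p → Vec d) → ℝ) (m : ℕ) (ω : Ω),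
      (√m)⁻¹ * normSum Y q H m 0 m ω = (m : ℝ)⁻¹ * ∑ i : Fin m, score Y q H m i ω :=
    fun H m ω => by
      rw [normSum, windowSum, ← mul_assoc, ← mul_inv, Real.mul_self_sqrt (Nat.cast_nonneg m),
        Finset.sum_range]
      simp
  refine h.congr' ?_ (Eventually.of_forall fun _ => rfl)
  filter_upwards [eventually_gt_atTop 0] with m hm
  refine Eventually.of_forall fun ω => ?_
  have hm1 : m - 1 + 1 = m := by omega
  simp only [hw, hm1]
  rw [Finset.sum_range]
  simp [normSum, windowSum]

/-- The bootstrap estimators of the variances of the rows are consistent: their linear part gives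
the sample covariance of the scores. -/
theorem IsGappedArray.tendstoInMeasure_bootVarEst [IsProbabilityMeasure P] {s : ℝ}
    (hA : IsGappedArray P p Y q s) {ψ : Fin p → Vec d → Vec r} (hψ : ∀ j, Measurable (ψ j))
    (hF : ∀ j a, IsCentredScore P Y s (rowScore ψ j a)) {θ : Vec r}
    {T : Fin p → (N : ℕ) → (Fin N → Vec d) → Vec r} (hT : ∀ j N, Measurable (T j N)) {j : Fin p}
    (hboot : Tendsto (fun m : ℕ => (m : ℝ≥0∞) *
      ∫⁻ ω, ENNReal.ofReal (bootMean fun σ : Fin m → Fin m =>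
        ‖bootEst T Y (q m) j m ω σ - θ -
          avg (ψ j) (rowData Y (q m) j 0 m ω ∘ σ)‖ ^ 2) ∂P) atTop (𝓝 0)) (a b : Fin r) :
    TendstoInMeasure P (fun (m : ℕ) ω => m * bootVarEst T Y (q m) j m ω a b) atTop
      fun _ => scoreCov P Y (rowScore ψ j a) (rowScore ψ j b) := by
  -- the remainder of the linear representation
  set R : (m : ℕ) → Ω → (Fin m → Fin m) → Vec r := fun m ω σ =>
    bootEst T Y (q m) j m ω σ - θ - avg (ψ j) (rowData Y (q m) j 0 m ω ∘ σ) with hR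
  have hRm : ∀ m σ, Measurable fun ω => R m ω σ := fun m σ => by
    have hd : Measurable fun ω => rowData Y (q m) j 0 m ω ∘ σ :=
      measurable_pi_lambda _ fun _ => hA.measurable _
    exact (((hT j m).comp hd).sub_const θ).sub ((measurable_avg (hψ j)).comp hd)
  have hQ : TendstoInMeasure P (fun (m : ℕ) ω => m * bootMean fun σ => ‖R m ω σ‖ ^ 2) atTop
      fun _ => 0 := by
    refine tendstoInMeasure_of_lintegral (Eventually.of_forall fun m => ?_)
      (hboot.congr fun m => ?_)
    · exact ((Finset.measurable_sum _ fun σ _ => (hRm m σ).norm.pow_const 2).const_mul _).const_mul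
        _
    · have h0 : ∀ ω, 0 ≤ bootMean fun σ => ‖R m ω σ‖ ^ 2 := fun ω =>
        mul_nonneg (by positivity) (Finset.sum_nonneg fun σ _ => by positivity)
      rw [← lintegral_const_mul' _ _ (ENNReal.natCast_ne_top m)]
      refine lintegral_congr fun ω => ?_
      rw [sub_zero, Real.enorm_of_nonneg (mul_nonneg (Nat.cast_nonneg m) (h0 ω)),
        ENNReal.ofReal_mul (Nat.cast_nonneg m), ENNReal.ofReal_natCast]
  set u : (m : ℕ) → Ω → Fin r → (Fin m → Fin m) → ℝ := fun m ω a σ =>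
    √m * (bootEst T Y (q m) j m ω σ a - bootMean fun τ => bootEst T Y (q m) j m ω τ a) with hu
  set x : (m : ℕ) → Ω → Fin r → (Fin m → Fin m) → ℝ := fun m ω a σ =>
    √m * (avg (ψ j) (rowData Y (q m) j 0 m ω ∘ σ) a
      - bootMean fun τ => avg (ψ j) (rowData Y (q m) j 0 m ω ∘ τ) a) with hx
  have hxx : ∀ a b, TendstoInMeasure P
      (fun (m : ℕ) ω => ((m : ℝ) ^ m)⁻¹ * ∑ σ, x m ω a σ * x m ω b σ) atTop
      fun _ => scoreCov P Y (rowScore ψ j a) (rowScore ψ j b) := fun a b => by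
    refine (hA.tendstoInMeasure_sampleCov (hF j a) (hF j b)).congr' ?_
      (Eventually.of_forall fun _ => rfl)
    filter_upwards [eventually_gt_atTop 0] with m hm
    refine Eventually.of_forall fun ω => ?_
    have h := bootMean_average_cov (fun i : Fin m => ψ j (obs Y (q m) i j ω) a)
      (fun i : Fin m => ψ j (obs Y (q m) i j ω) b) hm
    simp only [score_rowScore]
    rw [← h, bootMean, hx, ← mul_assoc, mul_comm (m : ℝ), mul_assoc, Finset.mul_sum]
    congr 1
    refine Finset.sum_congr rfl fun σ _ => ?_
    simp only [avg_apply, Function.comp_apply, rowData, zero_add]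
    linear_combination (-(((m : ℝ)⁻¹ * ∑ s, ψ j (obs Y (q m) (σ s) j ω) a -
      bootMean fun τ => (m : ℝ)⁻¹ * ∑ s, ψ j (obs Y (q m) (τ s) j ω) a) *
      ((m : ℝ)⁻¹ * ∑ s, ψ j (obs Y (q m) (σ s) j ω) b -
      bootMean fun τ => (m : ℝ)⁻¹ * ∑ s, ψ j (obs Y (q m) (τ s) j ω) b)))
      * Real.mul_self_sqrt (Nat.cast_nonneg (α := ℝ) m)
  have hE : ∀ a, TendstoInMeasure P
      (fun (m : ℕ) ω => ((m : ℝ) ^ m)⁻¹ * ∑ σ, (u m ω a σ - x m ω a σ) ^ 2) atTop fun _ => 0 :=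
      fun a => by
    refine tendstoInMeasure_of_abs_sub_le (Eventually.of_forall fun (m : ℕ) ω => ?_) hQ
    have e : ∀ σ, (u m ω a σ - x m ω a σ) ^ 2
        = m * (R m ω σ a - bootMean fun τ => R m ω τ a) ^ 2 := fun σ => by
      have h1 : ∀ τ, R m ω τ a = (bootEst T Y (q m) j m ω τ a
          - avg (ψ j) (rowData Y (q m) j 0 m ω ∘ τ) a) - θ a := fun τ => by
        simp only [hR, PiLp.sub_apply]; ring
      simp_rw [h1]
      rw [bootMean_sub, bootMean_sub, bootMean_const, ← Real.sq_sqrt (Nat.cast_nonneg (α := ℝ) m),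
        ← mul_pow]
      simp only [hu, hx]
      ring
    have h0 : 0 ≤ ((m : ℝ) ^ m)⁻¹ * ∑ σ, (u m ω a σ - x m ω a σ) ^ 2 :=
      mul_nonneg (by positivity) (Finset.sum_nonneg fun _ _ => sq_nonneg _)
    rw [sub_zero, abs_of_nonneg h0]
    simp_rw [e]
    change bootMean (fun σ => m * (R m ω σ a - bootMean fun τ => R m ω τ a) ^ 2) ≤ _
    rw [bootMean_const_mul]
    refine mul_le_mul_of_nonneg_left ((bootMean_sq_sub_le _).trans
      (bootMean_mono fun σ => ?_)) (Nat.cast_nonneg m)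
    rw [← sq_abs]
    exact pow_le_pow_left₀ (abs_nonneg _)
      (show |R m ω σ a| ≤ ‖R m ω σ‖ from PiLp.norm_apply_le (R m ω σ) a) 2
  refine tendstoInMeasure_of_abs_sub_le_sqrt (hxx a b) (hxx a a) (hxx b b) (hE a) (hE b)
    (Eventually.of_forall fun (m : ℕ) ω => ?_)
  have e : m * bootVarEst T Y (q m) j m ω a b
      = ((m : ℝ) ^ m)⁻¹ * ∑ σ, u m ω a σ * u m ω b σ := by
    simp only [bootVarEst, bootVar, Matrix.of_apply, bootMean, hu]
    rw [← mul_assoc, mul_comm (m : ℝ), mul_assoc, Finset.mul_sum]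
    congr 1
    refine Finset.sum_congr rfl fun σ _ => ?_
    rw [mul_mul_mul_comm, Real.mul_self_sqrt (Nat.cast_nonneg m)]
  rw [e]
  have := abs_average_mul_sub_le (S := Finset.univ) (c := ((m : ℝ) ^ m)⁻¹) (by positivity)
    (u m ω a) (u m ω b) (x m ω a) (x m ω b)
  simpa only [sq (x m ω a _), sq (x m ω b _)] using this

end Rows

section Windows

variable {Ω : Type*} [MeasurableSpace Ω] {P : Measure Ω} {d r p : ℕ} {Y : ℤ → Ω → Vec d}
  {q : ℕ → ℕ}

theorem lintegral_enorm_sq_eq {E : Type*} [NormedAddCommGroup E] (f : Ω → E) :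
    ∫⁻ ω, ‖f ω‖ₑ ^ 2 ∂P = eLpNorm f 2 P ^ 2 := by
  have := eLpNorm_nnreal_pow_eq_lintegral (f := f) (μ := P) (p := 2) two_ne_zero
  simp only [NNReal.coe_ofNat, ENNReal.rpow_ofNat, ENNReal.coe_ofNat] at this
  exact this.symm

/-- Remainders that are small in `L²` uniformly over the windows have a small mean square over the
windows. -/
theorem tendstoInMeasure_average_norm_sq {V : ℕ → ℕ → Ω → Vec r} {ρ : ℕ → ℝ} {I : ℕ → ℕ}
    (hV : ∀ m i, Measurable (V m i)) (hI : ∀ m, 0 < I m)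
    (h : Tendsto (fun m => ENNReal.ofReal (ρ m) *
      ⨆ i ∈ Finset.range (I m), eLpNorm (V m i) 2 P) atTop (𝓝 0)) (hρ : ∀ m, 0 ≤ ρ m) :
    TendstoInMeasure P (fun m ω => (I m : ℝ)⁻¹ *
      ∑ i ∈ Finset.range (I m), (ρ m * ‖V m i ω‖) ^ 2) atTop fun _ => 0 := by
  refine tendstoInMeasure_of_lintegral (Eventually.of_forall fun m => (Finset.measurable_sum _
    fun i _ => ((hV m i).norm.const_mul _).pow_const 2).const_mul _) ?_
  have h2 := ENNReal.Tendsto.pow (n := 2) h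
  rw [zero_pow two_ne_zero] at h2
  refine tendsto_of_tendsto_of_tendsto_of_le_of_le tendsto_const_nhds h2 (fun _ => zero_le)
    fun m => ?_
  have hI0 : (0 : ℝ) < I m := by exact_mod_cast hI m
  have e : ∀ ω, ‖(I m : ℝ)⁻¹ * ∑ i ∈ Finset.range (I m), (ρ m * ‖V m i ω‖) ^ 2 - 0‖ₑ
      = (I m : ℝ≥0∞)⁻¹ * ∑ i ∈ Finset.range (I m), ENNReal.ofReal (ρ m) ^ 2 * ‖V m i ω‖ₑ ^ 2 :=
    fun ω => by
      rw [sub_zero, Real.enorm_of_nonneg (mul_nonneg (by positivity)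
          (Finset.sum_nonneg fun _ _ => sq_nonneg _)), ENNReal.ofReal_mul (by positivity),
        ENNReal.ofReal_inv_of_pos hI0, ENNReal.ofReal_natCast,
        ENNReal.ofReal_sum_of_nonneg fun _ _ => sq_nonneg _]
      congr 1
      refine Finset.sum_congr rfl fun i _ => ?_
      rw [ENNReal.ofReal_pow (mul_nonneg (hρ m) (norm_nonneg _)), ENNReal.ofReal_mul (hρ m),
        mul_pow, ofReal_norm]
  simp_rw [e]
  have hterm : ∀ i, Measurable fun ω => ENNReal.ofReal (ρ m) ^ 2 * ‖V m i ω‖ₑ ^ 2 := fun i =>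
    ((hV m i).enorm.pow_const 2).const_mul _
  rw [lintegral_const_mul _ (Finset.measurable_sum _ fun i _ => hterm i),
    lintegral_finsetSum _ fun i _ => hterm i]
  set K := ENNReal.ofReal (ρ m) * ⨆ i ∈ Finset.range (I m), eLpNorm (V m i) 2 P with hK
  have hle : ∀ i ∈ Finset.range (I m),
      ∫⁻ ω, ENNReal.ofReal (ρ m) ^ 2 * ‖V m i ω‖ₑ ^ 2 ∂P ≤ K ^ 2 := fun i hi => by
    rw [lintegral_const_mul _ ((hV m i).enorm.pow_const 2), lintegral_enorm_sq_eq, ← mul_pow]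
    exact pow_le_pow_left₀ zero_le (mul_le_mul' le_rfl
      (le_iSup₂ (f := fun i (_ : i ∈ Finset.range (I m)) => eLpNorm (V m i) 2 P) i hi)) 2
  calc _ ≤ (I m : ℝ≥0∞)⁻¹ * ∑ i ∈ Finset.range (I m), K ^ 2 := by
        gcongr with i hi; exact hle i hi
    _ = K ^ 2 := by
        rw [Finset.sum_const, Finset.card_range, nsmul_eq_mul, ← mul_assoc,
          ENNReal.inv_mul_cancel (by exact_mod_cast (hI m).ne') (ENNReal.natCast_ne_top _), one_mul]

/-- The window moments of asymptotically linear estimators are consistent, for any centre that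
converges faster than the window averages. -/
theorem IsGappedArray.tendstoInMeasure_windowMoment [IsProbabilityMeasure P] {s : ℝ}
    (hA : IsGappedArray P p Y q s) {ψ : Fin p → Vec d → Vec r} (hψ : ∀ j, Measurable (ψ j))
    (hF : ∀ j a, IsCentredScore P Y s (rowScore ψ j a)) {θ : Vec r}
    {T : Fin p → (N : ℕ) → (Fin N → Vec d) → Vec r} (hT : ∀ j N, Measurable (T j N))
    {ℓ : ℕ → ℕ} (hℓ : ∀ᶠ m in atTop, 0 < ℓ m ∧ ℓ m ≤ m)
    (hℓm : Tendsto (fun m => (ℓ m : ℝ) / m) atTop (𝓝 0))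
    (hsub : ∀ j, Tendsto (fun m : ℕ => ENNReal.ofReal √(ℓ m : ℝ) *
      ⨆ i ∈ Finset.range (m - ℓ m + 1),
        eLpNorm (fun ω => rowEst T Y (q m) j i (ℓ m) ω - θ -
          avg (ψ j) (rowData Y (q m) j i (ℓ m) ω)) 2 P) atTop (𝓝 0))
    {t : ℕ → Ω → Vec r}
    (ht : ∀ a, TendstoInMeasure P (fun m ω => √(ℓ m) * (t m ω a - θ a)) atTop fun _ => 0)
    (j k : Fin p) (a b : Fin r) :
    TendstoInMeasure P (fun m ω => ℓ m * windowMoment T Y (q m) m (ℓ m) (t m ω) j k ω a b) atTop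
      fun _ => scoreCov P Y (rowScore ψ j a) (rowScore ψ k b) := by
  set V : Fin p → ℕ → ℕ → Ω → Vec r := fun j m i ω => rowEst T Y (q m) j i (ℓ m) ω - θ -
    avg (ψ j) (rowData Y (q m) j i (ℓ m) ω) with hV
  have hVm : ∀ j m i, Measurable (V j m i) := fun j m i =>
    (((hT j _).comp (measurable_rowData hA.measurable _ _ _ _)).sub_const θ).sub
      ((measurable_avg (hψ j)).comp (measurable_rowData hA.measurable _ _ _ _))
  have hVt := fun j => tendstoInMeasure_average_norm_sq (P := P) (hVm j)
    (fun m => Nat.succ_pos (m - ℓ m)) (hsub j) (fun m => Real.sqrt_nonneg _)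
  set u : Fin p → Fin r → ℕ → Ω → ℕ → ℝ := fun j a m ω i =>
    √(ℓ m) * (rowEst T Y (q m) j i (ℓ m) ω a - t m ω a) with hu
  set x : Fin p → Fin r → ℕ → Ω → ℕ → ℝ := fun j a m ω i =>
    normSum Y q (rowScore ψ j a) m i (ℓ m) ω with hx
  have hE : ∀ j a, TendstoInMeasure P (fun m ω => ((m - ℓ m + 1 : ℕ) : ℝ)⁻¹ *
      ∑ i ∈ Finset.range (m - ℓ m + 1), (u j a m ω i - x j a m ω i) ^ 2) atTop fun _ => 0 := by
    intro j a
    have hlim := tendstoInMeasure_of_continuousAt (P := P) (f := ![_, _]) (c := ![0, 0])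
      (fun k => by
        fin_cases k
        · exact hVt j
        · exact ht a)
      (F := fun y : Fin 2 → ℝ => 2 * y 0 + 2 * y 1 ^ 2) (Continuous.continuousAt (by fun_prop))
    simp only [Matrix.cons_val, mul_zero, ne_eq, OfNat.ofNat_ne_zero, not_false_eq_true, zero_pow,
      add_zero] at hlim
    refine tendstoInMeasure_of_abs_sub_le (Eventually.of_forall fun m ω => ?_) hlim
    have hI0 : (0 : ℝ) < ((m - ℓ m + 1 : ℕ) : ℝ) := by exact_mod_cast Nat.succ_pos _
    rw [sub_zero, abs_of_nonneg (mul_nonneg (by positivity)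
      (Finset.sum_nonneg fun _ _ => sq_nonneg _))]
    have hterm : ∀ i ∈ Finset.range (m - ℓ m + 1), (u j a m ω i - x j a m ω i) ^ 2
        ≤ 2 * (√(ℓ m) * ‖V j m i ω‖) ^ 2 + 2 * (√(ℓ m) * (t m ω a - θ a)) ^ 2 := fun i _ => by
      have e : u j a m ω i - x j a m ω i
          = √(ℓ m) * V j m i ω a - √(ℓ m) * (t m ω a - θ a) := by
        simp only [hu, hx, hV, ← sqrt_mul_avg, PiLp.sub_apply]; ring
      have h1 : (√(ℓ m) * V j m i ω a) ^ 2 ≤ (√(ℓ m) * ‖V j m i ω‖) ^ 2 := by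
        rw [mul_pow, mul_pow, ← sq_abs (V j m i ω a)]
        exact mul_le_mul_of_nonneg_left (pow_le_pow_left₀ (abs_nonneg _)
          (show |V j m i ω a| ≤ ‖V j m i ω‖ from PiLp.norm_apply_le (V j m i ω) a) 2)
          (sq_nonneg _)
      rw [e]
      nlinarith [sq_nonneg (√(ℓ m) * V j m i ω a + √(ℓ m) * (t m ω a - θ a))]
    refine (mul_le_mul_of_nonneg_left (Finset.sum_le_sum hterm) (inv_nonneg.2 hI0.le)).trans
      (le_of_eq ?_)
    rw [Finset.sum_add_distrib, ← Finset.mul_sum]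
    simp only [Finset.sum_const, Finset.card_range, nsmul_eq_mul]
    field_simp
  refine tendstoInMeasure_of_abs_sub_le_sqrt (hA.tendstoInMeasure_average_mul (hF j a) (hF k b)
      hℓ hℓm) (hA.tendstoInMeasure_average_sq (hF j a) hℓ hℓm)
    (hA.tendstoInMeasure_average_sq (hF k b) hℓ hℓm) (hE j a) (hE k b)
    (Eventually.of_forall fun m ω => ?_)
  have e : ℓ m * windowMoment T Y (q m) m (ℓ m) (t m ω) j k ω a b
      = ((m - ℓ m + 1 : ℕ) : ℝ)⁻¹ * ∑ i ∈ Finset.range (m - ℓ m + 1),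
        u j a m ω i * u k b m ω i := by
    simp only [windowMoment, Matrix.of_apply, hu]
    rw [← mul_assoc, mul_comm (ℓ m : ℝ), mul_assoc, Finset.mul_sum]
    congr 1
    refine Finset.sum_congr rfl fun i _ => ?_
    rw [mul_mul_mul_comm, Real.mul_self_sqrt (Nat.cast_nonneg _)]
  rw [e]
  exact abs_average_mul_sub_le (by positivity) (u j a m ω) (u k b m ω) (x j a m ω) (x k b m ω)

end Windows

/-! ### The variance of the full-sample estimator -/

section FullSample

variable {Ω : Type*} [MeasurableSpace Ω] {P : Measure Ω} {d r p : ℕ}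
  {Y : ℤ → Ω → Vec d} {q : ℕ → ℕ} {s : ℝ}

/-- The linear part of the normalized full-sample estimator. -/
noncomputable def linearPart (Y : ℤ → Ω → Vec d) (q : ℕ → ℕ) (ψ : Fin p → Vec d → Vec r)
    (w : ℕ → Fin p → ℝ) (a : Fin r) (m : ℕ) (ω : Ω) : ℝ :=
  ∑ j, w m j * normSum Y q (rowScore ψ j a) m 0 m ω

variable {ψ : Fin p → Vec d → Vec r} {θ : Vec r} {w : ℕ → Fin p → ℝ} {t : ℕ → Ω → Vec r}

/-- A weighted mean of asymptotically linear row-wise estimators is asymptotically linear. -/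
theorem tendsto_eLpNorm_sub_linearPart (hp : 0 < p) (hY : ∀ t, Measurable (Y t))
    (hψ : ∀ j, Measurable (ψ j)) {T : Fin p → (N : ℕ) → (Fin N → Vec d) → Vec r}
    (hT : ∀ j N, Measurable (T j N)) (ht : ∀ m, Measurable (t m))
    (hw : ∀ m j, w m j ∈ Set.Icc (0 : ℝ) 1) (hw1 : ∀ m, ∑ j, w m j = 1)
    (hlin : Tendsto (fun m : ℕ => ENNReal.ofReal √((m : ℝ) * p) *
      eLpNorm (fun ω => t m ω - ∑ j, w m j • rowEst T Y (q m) j 0 m ω) 2 P) atTop (𝓝 0))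
    (hrow : ∀ j, Tendsto (fun m : ℕ => ENNReal.ofReal √(m : ℝ) *
      eLpNorm (fun ω => rowEst T Y (q m) j 0 m ω - θ -
        avg (ψ j) (rowData Y (q m) j 0 m ω)) 2 P) atTop (𝓝 0)) (a : Fin r) :
    Tendsto (fun m : ℕ => eLpNorm (fun ω => √m * (t m ω a - θ a) - linearPart Y q ψ w a m ω) 2 P)
      atTop (𝓝 0) := by
  have hlim := hlin.add (tendsto_finsetSum Finset.univ fun j _ => hrow j)
  simp only [Finset.sum_const_zero, add_zero] at hlim
  refine tendsto_of_tendsto_of_tendsto_of_le_of_le tendsto_const_nhds hlim (fun _ => zero_le)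
    fun m => ?_
  set D₀ : Ω → Vec r := fun ω => t m ω - ∑ j, w m j • rowEst T Y (q m) j 0 m ω with hD₀
  set D : Fin p → Ω → Vec r := fun j ω => rowEst T Y (q m) j 0 m ω - θ -
    avg (ψ j) (rowData Y (q m) j 0 m ω) with hD
  have hem : ∀ j, Measurable (rowEst T Y (q m) j 0 m) := fun j =>
    (hT j _).comp (measurable_rowData hY _ _ _ _)
  have hD₀m : Measurable D₀ :=
    (ht m).sub (Finset.measurable_sum _ fun j _ => (hem j).const_smul (w m j))
  have hDm : ∀ j, Measurable (D j) := fun j => ((hem j).sub_const θ).sub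
    ((measurable_avg (hψ j)).comp (measurable_rowData hY _ _ _ _))
  have hpt : ∀ ω, √m * (t m ω a - θ a) - linearPart Y q ψ w a m ω
      = (√m • (D₀ + ∑ j, w m j • D j)) ω a := fun ω => by
    have h1 : ∑ j, w m j * θ a = θ a := by rw [← Finset.sum_mul, hw1, one_mul]
    simp only [linearPart, ← sqrt_mul_avg, hD₀, hD, Pi.smul_apply, Pi.add_apply, Finset.sum_apply,
      PiLp.smul_apply, PiLp.add_apply, PiLp.sub_apply, WithLp.ofLp_sum, smul_eq_mul, mul_sub,
      Finset.sum_sub_distrib, h1, mul_add, Finset.mul_sum]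
    have h2 : ∀ j, w m j * (√m * avg (ψ j) (rowData Y (q m) j 0 m ω) a)
        = √m * (w m j * avg (ψ j) (rowData Y (q m) j 0 m ω) a) := fun j => by ring
    simp only [h2]
    ring
  have hsm : ∀ c : ℝ, 0 ≤ c → ‖c‖ₑ = ENNReal.ofReal c := fun c hc => Real.enorm_of_nonneg hc
  calc eLpNorm (fun ω => √m * (t m ω a - θ a) - linearPart Y q ψ w a m ω) 2 P
      ≤ eLpNorm (√m • (D₀ + ∑ j, w m j • D j)) 2 P := by
        refine eLpNorm_mono fun ω => ?_
        rw [hpt]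
        exact PiLp.norm_apply_le _ a
    _ = ENNReal.ofReal √m * eLpNorm (D₀ + ∑ j, w m j • D j) 2 P := by
        rw [eLpNorm_const_smul, hsm _ (Real.sqrt_nonneg _)]
    _ ≤ ENNReal.ofReal √m * (eLpNorm D₀ 2 P + ∑ j, eLpNorm (D j) 2 P) := by
        gcongr
        refine (eLpNorm_add_le hD₀m.aestronglyMeasurable
          (Finset.aestronglyMeasurable_sum _ fun j _ =>
            ((hDm j).const_smul (w m j)).aestronglyMeasurable) one_le_two).trans ?_
        gcongr
        refine (eLpNorm_sum_le (fun j _ => ((hDm j).const_smul (w m j)).aestronglyMeasurable)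
          one_le_two).trans (Finset.sum_le_sum fun j _ => ?_)
        rw [eLpNorm_const_smul, hsm _ (hw m j).1]
        exact mul_le_of_le_one_left zero_le (by simpa using (hw m j).2)
    _ ≤ _ := by
        rw [mul_add, Finset.mul_sum]
        gcongr
        exact le_mul_of_one_le_right (Nat.cast_nonneg m) (by exact_mod_cast hp)

variable [IsProbabilityMeasure P]

/-- The Cauchy-Schwarz inequality for covariances. -/
theorem abs_covariance_le {X Z : Ω → ℝ} (hX : MemLp X 2 P) (hZ : MemLp Z 2 P) :
    |cov[X, Z; P]| ≤ √(∫ ω, X ω ^ 2 ∂P) * √(∫ ω, Z ω ^ 2 ∂P) := by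
  have hvar : ∀ {U : Ω → ℝ}, MemLp U 2 P → Var[U; P] ≤ ∫ ω, U ω ^ 2 ∂P := fun hU =>
    variance_le_expectation_sq hU.aestronglyMeasurable
  have hd : discrim Var[X; P] (2 * cov[X, Z; P]) Var[Z; P] ≤ 0 := by
    refine discrim_le_zero fun t => ?_
    have h := variance_nonneg (t • X + Z) P
    rw [variance_add (hX.const_smul t) hZ, variance_smul, covariance_smul_left] at h
    linarith
  rw [discrim] at hd
  rw [← Real.sqrt_mul (integral_nonneg fun _ => sq_nonneg _)]
  refine Real.abs_le_sqrt ?_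
  have h1 := mul_le_mul (hvar hX) (hvar hZ) (variance_nonneg _ _)
    (integral_nonneg fun _ => sq_nonneg _)
  nlinarith

/-- Covariances are stable under perturbations that are small in `L²`. -/
theorem abs_covariance_sub_le {U V X Z : Ω → ℝ} (hU : MemLp U 2 P) (hV : MemLp V 2 P)
    (hX : MemLp X 2 P) (hZ : MemLp Z 2 P) :
    |cov[U, V; P] - cov[X, Z; P]|
      ≤ √(∫ ω, (U ω - X ω) ^ 2 ∂P) * √(∫ ω, Z ω ^ 2 ∂P)
        + √(∫ ω, X ω ^ 2 ∂P) * √(∫ ω, (V ω - Z ω) ^ 2 ∂P)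
        + √(∫ ω, (U ω - X ω) ^ 2 ∂P) * √(∫ ω, (V ω - Z ω) ^ 2 ∂P) := by
  have hUX := hU.sub hX
  have hVZ := hV.sub hZ
  have e : cov[U, V; P] - cov[X, Z; P]
      = cov[U - X, Z; P] + cov[X, V - Z; P] + cov[U - X, V - Z; P] := by
    rw [covariance_sub_left hU hX hZ, covariance_sub_right hX hV hZ,
      covariance_sub_left hU hX hVZ, covariance_sub_right hU hV hZ, covariance_sub_right hX hV hZ]
    ring
  rw [e]
  exact (abs_add_le _ _).trans (add_le_add ((abs_add_le _ _).trans
    (add_le_add (abs_covariance_le hUX hZ) (abs_covariance_le hX hVZ)))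
    (abs_covariance_le hUX hVZ))

theorem memLp_linearPart (hA : IsGappedArray P p Y q s)
    (hF : ∀ j a, IsCentredScore P Y s (rowScore ψ j a)) (a : Fin r) (m : ℕ) :
    MemLp (linearPart Y q ψ w a m) 2 P :=
  memLp_finsetSum _ fun j _ => (hA.memLp_normSum (hF j a) m 0 m).const_mul _

/-- Since `ℓ / m → 0`, the error of the full-sample estimator is negligible on the scale of the
windows. -/
theorem tendstoInMeasure_sqrt_mul_sub (hA : IsGappedArray P p Y q s)
    (hF : ∀ j a, IsCentredScore P Y s (rowScore ψ j a)) (ht : ∀ m, Measurable (t m))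
    (hw : ∀ m j, w m j ∈ Set.Icc (0 : ℝ) 1) {a : Fin r}
    (h : Tendsto (fun m : ℕ =>
      eLpNorm (fun ω => √m * (t m ω a - θ a) - linearPart Y q ψ w a m ω) 2 P) atTop (𝓝 0))
    {ℓ : ℕ → ℕ} (hℓm : Tendsto (fun m => (ℓ m : ℝ) / m) atTop (𝓝 0)) :
    TendstoInMeasure P (fun m ω => √(ℓ m) * (t m ω a - θ a)) atTop fun _ => 0 := by
  have hρ : Tendsto (fun m => √((ℓ m : ℝ) / m)) atTop (𝓝 0) := by simpa using hℓm.sqrt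
  have h1 : TendstoInMeasure P (fun (m : ℕ) ω =>
      √m * (t m ω a - θ a) - linearPart Y q ψ w a m ω) atTop fun _ => 0 := by
    refine tendstoInMeasure_of_tendsto_eLpNorm two_ne_zero (fun m => ?_) aestronglyMeasurable_const
      (h.congr fun m => ?_)
    · exact ((((measurable_apply_vec a).comp (ht m)).sub_const _).const_mul
        _).aestronglyMeasurable.sub (memLp_linearPart hA hF a m).aestronglyMeasurable
    · congr 1; ext ω; simp
  have hlim := tendstoInMeasure_of_continuousAt (P := P) (κ := Option (Fin p))
    (f := fun o => o.elim (fun (m : ℕ) ω => √m * (t m ω a - θ a) - linearPart Y q ψ w a m ω)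
      fun j (m : ℕ) ω => √((ℓ m : ℝ) / m) * normSum Y q (rowScore ψ j a) m 0 m ω)
    (c := fun _ => 0) (fun o => by
      cases o with
      | none => exact h1
      | some j => exact hA.tendstoInMeasure_mean (hF j a) hρ)
    (F := fun x => |x none| + ∑ j, |x (some j)|) (Continuous.continuousAt (by fun_prop))
  simp only [abs_zero, Finset.sum_const_zero, add_zero, Option.elim] at hlim
  refine tendstoInMeasure_of_abs_sub_le ?_ hlim
  filter_upwards [eventually_gt_atTop 0, hℓm.eventually_le_const one_pos] with m hm hm1 ω
  have hm0 : (0 : ℝ) < m := by exact_mod_cast hm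
  have hρ1 : √((ℓ m : ℝ) / m) ≤ 1 := Real.sqrt_le_one.2 hm1
  have e : √(ℓ m) * (t m ω a - θ a) = √((ℓ m : ℝ) / m)
      * (√m * (t m ω a - θ a) - linearPart Y q ψ w a m ω)
      + ∑ j, w m j * (√((ℓ m : ℝ) / m) * normSum Y q (rowScore ψ j a) m 0 m ω) := by
    have h2 : √((ℓ m : ℝ) / m) * √m = √(ℓ m) := by
      rw [← Real.sqrt_mul (by positivity), div_mul_cancel₀ _ hm0.ne']
    have h3 : ∑ j, w m j * (√((ℓ m : ℝ) / m) * normSum Y q (rowScore ψ j a) m 0 m ω)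
        = √((ℓ m : ℝ) / m) * linearPart Y q ψ w a m ω := by
      rw [linearPart, Finset.mul_sum]
      exact Finset.sum_congr rfl fun j _ => by ring
    rw [h3, ← h2]; ring
  rw [sub_zero, e]
  refine (abs_add_le _ _).trans (add_le_add ?_ ((Finset.abs_sum_le_sum_abs _ _).trans
    (Finset.sum_le_sum fun j _ => ?_)))
  · rw [abs_mul, abs_of_nonneg (Real.sqrt_nonneg _)]
    exact mul_le_of_le_one_left (abs_nonneg _) hρ1
  · rw [abs_mul, abs_of_nonneg (hw m j).1]
    exact mul_le_of_le_one_left (abs_nonneg _) (hw m j).2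

theorem covariance_linearPart (hA : IsGappedArray P p Y q s)
    (hF : ∀ j a, IsCentredScore P Y s (rowScore ψ j a)) (a b : Fin r) (m : ℕ) :
    cov[linearPart Y q ψ w a m, linearPart Y q ψ w b m; P] = ∑ j, ∑ k, w m j * w m k *
      ∫ ω, normSum Y q (rowScore ψ j a) m 0 m ω * normSum Y q (rowScore ψ k b) m 0 m ω ∂P := by
  have hL := fun j a => hA.memLp_normSum (hF j a) m 0 m
  unfold linearPart
  rw [covariance_fun_sum_fun_sum (fun j => (hL j a).const_mul _) (fun k => (hL k b).const_mul _)]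
  refine Finset.sum_congr rfl fun j _ => Finset.sum_congr rfl fun k _ => ?_
  rw [covariance_const_mul_left, covariance_const_mul_right, covariance_eq_sub (hL j a) (hL k b),
    hA.integral_normSum (hF j a), zero_mul, sub_zero, mul_assoc]
  rfl

/-- The variance matrix of the full-sample estimator is asymptotic to the weighted sum of the
covariances of the scores of a single column. -/
theorem tendsto_varMatrix_sub (hA : IsGappedArray P p Y q s)
    (hF : ∀ j a, IsCentredScore P Y s (rowScore ψ j a)) (ht : ∀ m, Measurable (t m))
    (hw : ∀ m j, w m j ∈ Set.Icc (0 : ℝ) 1)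
    (h : ∀ a, Tendsto (fun m : ℕ =>
      eLpNorm (fun ω => √m * (t m ω a - θ a) - linearPart Y q ψ w a m ω) 2 P) atTop (𝓝 0))
    (a b : Fin r) :
    Tendsto (fun m : ℕ => m * varMatrix P (t m) a b
      - ∑ j, ∑ k, w m j * w m k * scoreCov P Y (rowScore ψ j a) (rowScore ψ k b))
      atTop (𝓝 0) := by
  set Z : Fin r → ℕ → Ω → ℝ := fun a m ω => √m * (t m ω a - θ a) with hZ
  set W : Fin r → ℕ → Ω → ℝ := fun a m => linearPart Y q ψ w a m with hW
  have hWL : ∀ a m, MemLp (W a m) 2 P := fun a m => memLp_linearPart hA hF a m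
  have hZm : ∀ a m, Measurable (Z a m) := fun a m =>
    (((measurable_apply_vec a).comp (ht m)).sub_const _).const_mul _
  have hZL : ∀ a, ∀ᶠ m in atTop, MemLp (Z a m) 2 P := fun a => by
    filter_upwards [(h a).eventually_lt_const (ENNReal.zero_lt_top)] with m hm
    have h1 : MemLp (fun ω => Z a m ω - W a m ω) 2 P :=
      ⟨(hZm a m).aestronglyMeasurable.sub (hWL a m).aestronglyMeasurable, hm⟩
    refine (h1.add (hWL a m)).ae_eq (Eventually.of_forall fun ω => ?_)
    simp
  have hWW : ∀ a b, Tendsto (fun m => cov[W a m, W b m; P]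
      - ∑ j, ∑ k, w m j * w m k * scoreCov P Y (rowScore ψ j a) (rowScore ψ k b)) atTop
      (𝓝 0) := fun a b => by
    have hlim : Tendsto (fun m : ℕ => ∑ j, ∑ k,
        |∫ ω, normSum Y q (rowScore ψ j a) m 0 m ω * normSum Y q (rowScore ψ k b) m 0 m ω ∂P
          - scoreCov P Y (rowScore ψ j a) (rowScore ψ k b)|) atTop (𝓝 (∑ j : Fin p, ∑ k : Fin p,
        |scoreCov P Y (rowScore ψ j a) (rowScore ψ k b)
          - scoreCov P Y (rowScore ψ j a) (rowScore ψ k b)|)) :=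
      tendsto_finsetSum _ fun j _ => tendsto_finsetSum _ fun k _ =>
        ((hA.tendsto_integral_normSum_mul (hF j a) (hF k b)).sub_const _).abs
    simp only [sub_self, abs_zero, Finset.sum_const_zero] at hlim
    refine squeeze_zero_norm (fun m => ?_) hlim
    rw [hW, covariance_linearPart hA hF, ← Finset.sum_sub_distrib, Real.norm_eq_abs]
    refine (Finset.abs_sum_le_sum_abs _ _).trans (Finset.sum_le_sum fun j _ => ?_)
    rw [← Finset.sum_sub_distrib]
    refine (Finset.abs_sum_le_sum_abs _ _).trans (Finset.sum_le_sum fun k _ => ?_)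
    rw [← mul_sub, abs_mul, abs_of_nonneg (mul_nonneg (hw m j).1 (hw m k).1)]
    exact mul_le_of_le_one_left (abs_nonneg _) (mul_le_one₀ (hw m j).2 (hw m k).1 (hw m k).2)
  have hE : ∀ a, Tendsto (fun m => ∫ ω, (Z a m ω - W a m ω) ^ 2 ∂P) atTop (𝓝 0) := fun a => by
    have h1 := ENNReal.Tendsto.pow (n := 2) (h a)
    rw [zero_pow two_ne_zero] at h1
    have h2 := (ENNReal.tendsto_toReal ENNReal.zero_ne_top).comp h1
    rw [ENNReal.toReal_zero] at h2
    refine h2.congr fun m => ?_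
    rw [Function.comp_apply, ← lintegral_enorm_sq_eq, integral_eq_lintegral_of_nonneg_ae
      (f := fun ω => (Z a m ω - W a m ω) ^ 2) (Eventually.of_forall fun _ => sq_nonneg _)
      (((hZm a m).aestronglyMeasurable.sub (hWL a m).aestronglyMeasurable).pow 2)]
    congr 1
    refine lintegral_congr fun ω => ?_
    rw [← Real.enorm_of_nonneg (sq_nonneg _), enorm_pow]
  have hWmean : ∀ a m, ∫ ω, W a m ω ^ 2 ∂P = cov[W a m, W a m; P] := fun a m => by
    have h0 : ∫ ω, W a m ω ∂P = 0 := by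
      simp only [hW, linearPart]
      rw [integral_finsetSum _ fun j _ =>
        ((hA.memLp_normSum (hF j a) m 0 m).integrable one_le_two).const_mul _]
      refine Finset.sum_eq_zero fun j _ => ?_
      rw [integral_const_mul, hA.integral_normSum (hF j a), mul_zero]
    rw [covariance_eq_sub (hWL a m) (hWL a m), h0, mul_zero, sub_zero]
    exact integral_congr_ae (Eventually.of_forall fun ω => sq _)
  have hWb : ∀ a, ∃ B, ∀ᶠ m in atTop, √(∫ ω, W a m ω ^ 2 ∂P) ≤ B := fun a => by
    refine ⟨√(1 + ∑ j : Fin p, ∑ k : Fin p, |scoreCov P Y (rowScore ψ j a) (rowScore ψ k a)|), ?_⟩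
    filter_upwards [(hWW a a).eventually_le_const one_pos] with m hm
    refine Real.sqrt_le_sqrt ?_
    rw [hWmean]
    have : ∑ j, ∑ k, w m j * w m k * scoreCov P Y (rowScore ψ j a) (rowScore ψ k a)
        ≤ ∑ j : Fin p, ∑ k : Fin p, |scoreCov P Y (rowScore ψ j a) (rowScore ψ k a)| := by
      refine Finset.sum_le_sum fun j _ => Finset.sum_le_sum fun k _ => (le_abs_self _).trans ?_
      rw [abs_mul, abs_of_nonneg (mul_nonneg (hw m j).1 (hw m k).1)]
      exact mul_le_of_le_one_left (abs_nonneg _) (mul_le_one₀ (hw m j).2 (hw m k).1 (hw m k).2)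
    linarith
  have hZW : Tendsto (fun m => cov[Z a m, Z b m; P] - cov[W a m, W b m; P]) atTop (𝓝 0) := by
    obtain ⟨A, hA'⟩ := hWb a
    obtain ⟨B, hB'⟩ := hWb b
    have h1 : ∀ a, Tendsto (fun m => √(∫ ω, (Z a m ω - W a m ω) ^ 2 ∂P)) atTop (𝓝 0) :=
      fun a => by simpa using (hE a).sqrt
    have hlim := (((h1 a).mul_const B).add ((h1 b).const_mul A)).add ((h1 a).mul (h1 b))
    simp only [zero_mul, mul_zero, add_zero] at hlim
    refine squeeze_zero_norm' ?_ hlim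
    filter_upwards [hA', hB', hZL a, hZL b] with m h2 h3 h4 h5
    refine (abs_covariance_sub_le h4 h5 (hWL a m) (hWL b m)).trans ?_
    gcongr
  have hfin := hZW.add (hWW a b)
  rw [add_zero] at hfin
  refine hfin.congr' ?_
  filter_upwards [hZL a, hZL b, eventually_gt_atTop 0] with m h1 h2 hm
  have hm0 : (0 : ℝ) < m := by exact_mod_cast hm
  have hti : ∀ a, MemLp (Z a m) 2 P → Integrable (fun ω => t m ω a) P := fun a hZa => by
    have h3 := ((hZa.const_mul (√m)⁻¹).add (memLp_const (θ a))).integrable one_le_two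
    refine h3.congr (Eventually.of_forall fun ω => ?_)
    have := (Real.sqrt_pos.2 hm0).ne'
    simp only [hZ, Pi.add_apply]
    field_simp
    ring
  have e : cov[Z a m, Z b m; P] = m * varMatrix P (t m) a b := by
    simp only [hZ, varMatrix, Matrix.of_apply]
    rw [covariance_const_mul_left, covariance_const_mul_right,
      covariance_sub_const_left (hti a h1), covariance_sub_const_right (hti b h2), ← mul_assoc,
      Real.mul_self_sqrt hm0.le]
  rw [e]; ring

end FullSample

/-! ### Consistency of the Gap Bootstrap II variance estimator -/

section Blocks

variable {Ω : Type*} [MeasurableSpace Ω] {P : Measure Ω} {r : ℕ}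

theorem tendstoInMeasure_entryDist {A B : ℕ → Ω → Matrix (Fin r) (Fin r) ℝ}
    {Γ : Matrix (Fin r) (Fin r) ℝ}
    (hA : ∀ a b, TendstoInMeasure P (fun m ω => A m ω a b) atTop fun _ => Γ a b)
    (hB : ∀ a b, TendstoInMeasure P (fun m ω => B m ω a b) atTop fun _ => Γ a b) :
    TendstoInMeasure P (fun m ω => entryDist (A m ω) (B m ω)) atTop fun _ => 0 := by
  have h := tendstoInMeasure_of_continuousAt (P := P) (κ := (Fin r × Fin r) ⊕ (Fin r × Fin r))
    (f := Sum.elim (fun e m ω => A m ω e.1 e.2) fun e m ω => B m ω e.1 e.2)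
    (c := Sum.elim (fun e => Γ e.1 e.2) fun e => Γ e.1 e.2)
    (by rintro (e | e); exacts [hA _ _, hB _ _])
    (F := fun x => ∑ a, ∑ b, |x (.inl (a, b)) - x (.inr (a, b))|)
    (Continuous.continuousAt (by fun_prop))
  simpa [entryDist] using h

theorem tendstoInMeasure_trace {A : ℕ → Ω → Matrix (Fin r) (Fin r) ℝ}
    {Γ : Matrix (Fin r) (Fin r) ℝ}
    (hA : ∀ a b, TendstoInMeasure P (fun m ω => A m ω a b) atTop fun _ => Γ a b) :
    TendstoInMeasure P (fun m ω => (A m ω).trace) atTop fun _ => Γ.trace :=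
  tendstoInMeasure_of_continuousAt (P := P) (f := fun (a : Fin r) m ω => A m ω a a)
    (c := fun a => Γ a a) (fun a => hA a a) (F := fun x => ∑ a, x a)
    (Continuous.continuousAt (by fun_prop))

/-- If the scale matrices and the product moments converge, after scaling, to compatible limits,
then so do the rescaled correlation matrices. -/
theorem tendstoInMeasure_smul_corr {ι : Type*} {S : ℕ → Finset ι} {c : ℕ → ℝ} (hc : ∀ m, 0 ≤ c m)
    {u v : ℕ → Ω → ι → Fin r → ℝ} {A B : ℕ → Ω → Matrix (Fin r) (Fin r) ℝ}
    (hA : ∀ m ω, (A m ω).PosSemidef) (hB : ∀ m ω, (B m ω).PosSemidef) {x y : ℕ → ℝ}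
    (hx : ∀ m, 0 ≤ x m) (hy : ∀ m, 0 ≤ y m) {Γu Γuv Γv : Matrix (Fin r) (Fin r) ℝ}
    (hAΓ : ∀ a b, TendstoInMeasure P (fun m ω => x m * A m ω a b) atTop fun _ => Γu a b)
    (hBΓ : ∀ a b, TendstoInMeasure P (fun m ω => x m * B m ω a b) atTop fun _ => Γv a b)
    (hu : ∀ a b, TendstoInMeasure P
      (fun m ω => y m * crossMoment (S m) (c m) (u m ω) (u m ω) a b) atTop fun _ => Γu a b)
    (huv : ∀ a b, TendstoInMeasure P
      (fun m ω => y m * crossMoment (S m) (c m) (u m ω) (v m ω) a b) atTop fun _ => Γuv a b)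
    (hv : ∀ a b, TendstoInMeasure P
      (fun m ω => y m * crossMoment (S m) (c m) (v m ω) (v m ω) a b) atTop fun _ => Γv a b)
    (a b : Fin r) :
    TendstoInMeasure P (fun m ω => x m * (matSqrt (A m ω) *
      crossCorr (S m) (c m) (u m ω) (v m ω) * matSqrt (B m ω)) a b) atTop fun _ => Γuv a b := by
  have hlim := tendstoInMeasure_of_continuousAt (P := P) (κ := Fin 5)
    (f := ![fun m ω => entryDist (x m • A m ω) (y m • crossMoment (S m) (c m) (u m ω) (u m ω)),
      fun m ω => (x m • B m ω).trace,
      fun m ω => (y m • crossMoment (S m) (c m) (u m ω) (u m ω)).trace,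
      fun m ω => entryDist (x m • B m ω) (y m • crossMoment (S m) (c m) (v m ω) (v m ω)),
      fun m ω => y m * crossMoment (S m) (c m) (u m ω) (v m ω) a b])
    (c := ![0, Γv.trace, Γu.trace, 0, Γuv a b])
    (fun i => by
      fin_cases i
      exacts [tendstoInMeasure_entryDist hAΓ hu, tendstoInMeasure_trace hBΓ,
        tendstoInMeasure_trace hu, tendstoInMeasure_entryDist hBΓ hv, huv a b])
    (F := fun z => r ^ 2 * (√(z 0) * √(z 1) + √(z 2) * √(z 3)) + |z 4 - Γuv a b|)
    (Continuous.continuousAt (by fun_prop))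
  simp only [Matrix.cons_val, Real.sqrt_zero, zero_mul, mul_zero, add_zero, sub_self,
    abs_zero] at hlim
  refine tendstoInMeasure_of_abs_sub_le (Eventually.of_forall fun m ω => ?_) hlim
  refine (abs_sub_le _ (y m * crossMoment (S m) (c m) (u m ω) (v m ω) a b) _).trans ?_
  gcongr
  exact abs_smul_corr_sub_apply_le (hc m) (hA m ω) (hB m ω) (hx m) (hy m) a b

end Blocks

end GapBootstrap

theorem theorem4p2 {Ω : Type*} [MeasurableSpace Ω] (P : Measure Ω) [IsProbabilityMeasure P]
    {d r p : ℕ}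
    -- the parent series; `q m` and `ℓ m` are the gap and the window length for `m` columns
    (Y : ℤ → Ω → GapBootstrap.Vec d) (hY : ∀ t, Measurable (Y t))
    (q ℓ : ℕ → ℕ)
    -- the process of columns is strictly stationary
    (hstat : ∀ m, IdentDistrib
      (fun ω (i : ℕ) (j : Fin p) => GapBootstrap.obs Y (q m) i j ω)
      (fun ω (i : ℕ) (j : Fin p) => GapBootstrap.obs Y (q m) (i + 1) j ω) P P)
    -- window length
    (hℓ : ∀ᶠ m in atTop, 1 < ℓ m ∧ ℓ m < m)
    (hℓm : Tendsto (fun m => (ℓ m : ℝ) / m) atTop (𝓝 0))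
    -- the parameter, the full-sample and the row-wise estimation algorithms
    (θ : GapBootstrap.Vec r)
    (T₀ : (m : ℕ) → (Fin m → Fin p → GapBootstrap.Vec d) → GapBootstrap.Vec r)
    (hT₀ : ∀ m, Measurable (T₀ m))
    (T : Fin p → (N : ℕ) → (Fin N → GapBootstrap.Vec d) → GapBootstrap.Vec r)
    (hT : ∀ j N, Measurable (T j N))
    (ψ : Fin p → GapBootstrap.Vec d → GapBootstrap.Vec r) (hψ : ∀ j, Measurable (ψ j))
    -- the weights
    (w : ℕ → Fin p → ℝ) (hw : ∀ m j, w m j ∈ Set.Icc (0 : ℝ) 1) (hw1 : ∀ m, ∑ j, w m j = 1)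
    -- (C.1) moments and mixing
    (C δ : ℝ) (hC : 0 < C) (hδ : 0 < δ)
    (hmean : ∀ j : Fin p, ∫ ω, ψ j (Y ((j : ℤ) + 1) ω) ∂P = 0)
    (hmom : ∀ j : Fin p, ∫⁻ ω, ‖ψ j (Y ((j : ℤ) + 1) ω)‖ₑ ^ (2 + δ) ∂P < ENNReal.ofReal C)
    (hmix : Summable fun n : ℕ => GapBootstrap.alphaMixing P Y (n + 1) ^ (δ / (2 + δ)))
    -- (C.2) asymptotic linearity
    (hlin : Tendsto (fun m : ℕ => ENNReal.ofReal √((m : ℝ) * p) *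
      eLpNorm (fun ω => T₀ m (GapBootstrap.fullData p Y (q m) m ω) -
        ∑ j, w m j • GapBootstrap.rowEst T Y (q m) j 0 m ω) 2 P) atTop (𝓝 0))
    -- (C.3) linear representations of the row-wise, bootstrap and subseries estimators
    (hrow : ∀ j, Tendsto (fun m : ℕ => ENNReal.ofReal √(m : ℝ) *
      eLpNorm (fun ω => GapBootstrap.rowEst T Y (q m) j 0 m ω - θ -
        GapBootstrap.avg (ψ j) (GapBootstrap.rowData Y (q m) j 0 m ω)) 2 P) atTop (𝓝 0))
    (hboot : ∀ j, Tendsto (fun m : ℕ => (m : ℝ≥0∞) *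
      ∫⁻ ω, ENNReal.ofReal (GapBootstrap.bootMean fun σ : Fin m → Fin m =>
        ‖GapBootstrap.bootEst T Y (q m) j m ω σ - θ -
          GapBootstrap.avg (ψ j) (GapBootstrap.rowData Y (q m) j 0 m ω ∘ σ)‖ ^ 2) ∂P)
      atTop (𝓝 0))
    (hsub : ∀ j, Tendsto (fun m : ℕ => ENNReal.ofReal √(ℓ m : ℝ) *
      ⨆ i ∈ Finset.range (m - ℓ m + 1),
        eLpNorm (fun ω => GapBootstrap.rowEst T Y (q m) j i (ℓ m) ω - θ -
          GapBootstrap.avg (ψ j) (GapBootstrap.rowData Y (q m) j i (ℓ m) ω)) 2 P) atTop (𝓝 0))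
    -- (C.4) gaps and weights
    (hq : Tendsto q atTop atTop)
    (hww : (fun m => (p : ℝ) * ∑ j, w m j ^ 2) =O[atTop] fun _ => (1 : ℝ)) :
    ∀ a b : Fin r, TendstoInMeasure P
      (fun (m : ℕ) ω => ((m : ℝ) * p) *
        (GapBootstrap.gapBootVarII T₀ T (w m) Y (q m) m (ℓ m) ω -
          GapBootstrap.varMatrix P
            (fun ω' => T₀ m (GapBootstrap.fullData p Y (q m) m ω'))) a b)
      atTop (fun _ => 0) := by
  
  intro a b
  have hp : 0 < p := by
    rcases p.eq_zero_or_pos with rfl | h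
    · simpa using hw1 0
    · exact h
  have hA : GapBootstrap.IsGappedArray P p Y q (2 + δ) :=
    ⟨hp, by linarith, hY, hstat, by rwa [add_sub_cancel_left], hq⟩
  have hF : ∀ j a, GapBootstrap.IsCentredScore P Y (2 + δ) (GapBootstrap.rowScore ψ j a) :=
    GapBootstrap.isCentredScore_rowScore hY hψ (by linarith) hmean hmom
  set t : ℕ → Ω → GapBootstrap.Vec r := fun m ω =>
    T₀ m (GapBootstrap.fullData p Y (q m) m ω) with ht
  have htm : ∀ m, Measurable (t m) := fun m => (hT₀ m).comp
    (measurable_pi_lambda _ fun i => measurable_pi_lambda _ fun j =>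
      GapBootstrap.measurable_obs hY _ _ _)
  have hL := GapBootstrap.tendsto_eLpNorm_sub_linearPart hp hY hψ hT htm hw hw1 hlin hrow
  have ht0 := fun a => GapBootstrap.tendstoInMeasure_sqrt_mul_sub hA hF htm hw (hL a) hℓm
  have hℓ' : ∀ᶠ m in atTop, 0 < ℓ m ∧ ℓ m ≤ m :=
    hℓ.mono fun m hm => ⟨by omega, hm.2.le⟩
  have hM := hA.tendstoInMeasure_windowMoment hψ hF hT hℓ' hℓm hsub ht0
  have hB := fun j => hA.tendstoInMeasure_bootVarEst hψ hF hT (hboot j)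
  set Γ : Fin p → Fin p → Matrix (Fin r) (Fin r) ℝ := fun j k => Matrix.of fun a b =>
    GapBootstrap.scoreCov P Y (GapBootstrap.rowScore ψ j a) (GapBootstrap.rowScore ψ k b) with hΓ
  set D : Fin p → Fin p → ℕ → Ω → ℝ := fun j k m ω => m * (GapBootstrap.matSqrt
    (GapBootstrap.bootVarEst T Y (q m) j m ω) * GapBootstrap.windowCorr T Y (q m) m (ℓ m) (t m ω)
      j k ω * GapBootstrap.matSqrt (GapBootstrap.bootVarEst T Y (q m) k m ω)) a b with hD
  have hDΓ : ∀ j k, TendstoInMeasure P (D j k) atTop fun _ => Γ j k a b := fun j k =>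
    GapBootstrap.tendstoInMeasure_smul_corr
      (S := fun m => Finset.range (m - ℓ m + 1)) (c := fun m => ((m - ℓ m + 1 : ℕ) : ℝ)⁻¹)
      (fun m => by positivity)
      (u := fun m ω i a => GapBootstrap.rowEst T Y (q m) j i (ℓ m) ω a - t m ω a)
      (v := fun m ω i a => GapBootstrap.rowEst T Y (q m) k i (ℓ m) ω a - t m ω a)
      (fun _ _ => GapBootstrap.bootVar_posSemidef _) (fun _ _ => GapBootstrap.bootVar_posSemidef _)
      (x := fun m => m) (y := fun m => ℓ m) (fun _ => Nat.cast_nonneg _)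
      (fun _ => Nat.cast_nonneg _) (Γu := Γ j j) (Γuv := Γ j k) (Γv := Γ k k)
      (hB j) (hB k) (hM j j) (hM j k) (hM k k) a b
  -- The weights need not converge, so the target is followed only up to a vanishing difference.
  have hV := GapBootstrap.tendsto_varMatrix_sub hA hF htm hw hL a b
  -- The component `none` is the deterministic error of the variance.
  have hlim := GapBootstrap.tendstoInMeasure_of_continuousAt (P := P) (κ := Option (Fin p × Fin p))
    (f := fun o => o.elim (fun (m : ℕ) _ => (m * GapBootstrap.varMatrix P (t m) a b -
      ∑ j, ∑ k, w m j * w m k * Γ j k a b)) fun e => D e.1 e.2)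
    (c := fun o => o.elim 0 fun e => Γ e.1 e.2 a b)
    (fun o => by
      cases o with
      | none =>
        exact tendstoInMeasure_of_tendsto_ae (fun _ => aestronglyMeasurable_const)
          (Eventually.of_forall fun _ => hV)
      | some e => exact hDΓ e.1 e.2)
    (F := fun z => p * (∑ j, ∑ k, |z (some (j, k)) - Γ j k a b| + |z none|))
    (Continuous.continuousAt (by fun_prop))
  simp only [Option.elim, sub_self, abs_zero, Finset.sum_const_zero, add_zero, mul_zero] at hlim
  refine GapBootstrap.tendstoInMeasure_of_abs_sub_le (Eventually.of_forall fun m ω => ?_) hlim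
  have e : ((m : ℝ) * p) * (GapBootstrap.gapBootVarII T₀ T (w m) Y (q m) m (ℓ m) ω -
        GapBootstrap.varMatrix P (t m)) a b - 0
      = p * (∑ j, ∑ k, w m j * w m k * (D j k m ω - Γ j k a b)
        - (m * GapBootstrap.varMatrix P (t m) a b - ∑ j, ∑ k, w m j * w m k * Γ j k a b)) := by
    have h1 : (m : ℝ) * GapBootstrap.gapBootVarII T₀ T (w m) Y (q m) m (ℓ m) ω a b
        = ∑ j, ∑ k, w m j * w m k * D j k m ω := by
      simp only [GapBootstrap.gapBootVarII, Matrix.sum_apply, Matrix.smul_apply, smul_eq_mul,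
        Finset.mul_sum, hD]
      exact Finset.sum_congr rfl fun j _ => Finset.sum_congr rfl fun k _ => mul_left_comm _ _ _
    simp only [mul_sub (_ * _), Finset.sum_sub_distrib, ← h1, Matrix.sub_apply]
    ring
  rw [e, abs_mul, abs_of_nonneg (Nat.cast_nonneg p)]
  refine mul_le_mul_of_nonneg_left ((abs_sub _ _).trans (add_le_add_left
    ((Finset.abs_sum_le_sum_abs _ _).trans (Finset.sum_le_sum fun j _ =>
      (Finset.abs_sum_le_sum_abs _ _).trans (Finset.sum_le_sum fun k _ => ?_))) _))
    (Nat.cast_nonneg p)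
  rw [abs_mul, abs_of_nonneg (mul_nonneg (hw m j).1 (hw m k).1)]
  exact mul_le_of_le_one_left (abs_nonneg _) (mul_le_one₀ (hw m j).2 (hw m k).1 (hw m k).2)
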